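/- **Setting.** Let $W$ be a free $\mathbb Z$-module with basis $e_1,\dots,e_4$, let $e_5,\dots,e_8$ be the dual basis of $W^*$, and let $V=W\oplus W^*$ with the symmetric form $(x,y)_V=\sum_{i=1}^4(x_iy_{i+4}+x_{i+4}y_i)$. The exterior algebra $\wedge^\bullet W$ is a module over the Clifford algebra of $V$: $w\in W$ acts by $w\wedge\cdot$ and $w^*\in W^*$ by contraction; write $v\cdot\eta$ for the action of $v\in V$. Let $S^+=\wedge^{even}W\cong\mathbb Z^8$ with the coordinates $z_1,\dots,z_8$ given by the coefficients of $1,e_{12},e_{13},e_{14},e_{1234},-e_{34},e_{24},-e_{23}$ and with the bilinear form for which $(z,z)_{S^+}=2(z_1z_5+z_2z_6+z_3z_7+z_4z_8)$. For a non-zero isotropic $z\in S^+_{\mathbb C}$ let $Z_z=\{v\in V_{\mathbb C}: v\cdot z=0\}$; this is the maximal isotropic subspace, in the family of $W^*_{\mathbb C}$, that the spinor map sends to $[z]$. Let $\Omega=\{\ell\in\mathbb P(S^+_{\mathbb C}):(\ell,\ell)_{S^+}=0,\ (\ell,\bar\ell)_{S^+}>0\}$. For $\ell\in\Omega$ let $\mathcal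 T_\ell=V_{\mathbb C}/(Z_\ell+V)$, the complex torus with $H^1(\mathcal T_\ell,\mathbb Z)=V$ and $H^{1,0}(\mathcal T_\ell)=Z_\ell$. The unimodular form $(\cdot,\cdot)_V$ identifies $H_1(\mathcal T_\ell,\mathbb Z)$ with $V$, so $H^k(\mathcal T_\ell,\mathbb Z)=\wedge^kV$ is the group of integral alternating $k$-forms on $V$. For $s\in S^+$ the Cayley class $c_s\in\wedge^4V=H^4(\mathcal T_\ell,\mathbb Z)$ is, up to a non-zero scalar, the image of $s\odot s$ under the $Spin(V)$-equivariant map $\mathrm{Sym}^2(S^+)\to\wedge^4V$; explicitly it is the alternating form $c_s(v_1,\dots,v_4)=\sum_\sigma \mathrm{sgn}(\sigma)\,(s,\;v_{\sigma(1)}\cdot v_{\sigma(2)}\cdot v_{\sigma(3)}\cdot v_{\sigma(4)}\cdot s)_{S^+}$. **Weil type.** Let $d>0$ be an integer such that $K=\mathbb Q(\sqrt{-d})\subset\mathbb C$. An abelian variety $A$ with $K\subset \mathrm{End}(A)_{\mathbb Q}$ is of Weil type if for each $x\in K\setminus\mathbb Q$ the eigenvalues $x,\bar x$ of $x$ on $T_0A$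 have the same multiplicity. A polarization $\omega$ is of Weil type if $x^*\omega=x\bar x\,\omega$ for all $x\in K$; then $(A,K,\omega)$ is a polarized abelian variety of Weil type. Its discriminant is the class in $\mathbb Q^\times/\mathrm{Nm}(K^\times)$ of the determinant of a Gram matrix, in a $K$-basis of $H_1(A,\mathbb Q)$, of the Hermitian form $H(x,y)=\omega(x,\sqrt{-d}\,y)+\sqrt{-d}\,\omega(x,y)$. **Theorem.** Let $h,s\in S^+$ be perpendicular and such that $\langle h,s\rangle\subset S^+$ is a positive definite sublattice of rank two. Put $d=(h,h)_{S^+}(s,s)_{S^+}$ and $K=\mathbb Q(\sqrt{-d})$. Then $$\Omega_{\{h,s\}^\perp}=\{\ell\in\Omega:(\ell,s)_{S^+}=(\ell,h)_{S^+}=0\}$$ is a non-empty complex submanifold of $\mathbb P(S^+_{\mathbb C})$ of dimension four. Let $\kappa=\sqrt{-d}\,h+(h,h)_{S^+}s$ and $\bar\kappa=-\sqrt{-d}\,h+(h,h)_{S^+}s$, which span the two isotropic lines in $\langle h,s\rangle_{\mathbb C}$. Then $V_{\mathbb C}=Z_\kappa\oplus Z_{\bar\kappa}$, and there is an action of $K$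 on $V_{\mathbb Q}$ for which $x\in K$ is multiplication by $x$ on $Z_\kappa$ and by $\bar x$ on $Z_{\bar\kappa}$. The form $E(v,w)=(\sqrt{-d}\cdot v,w)_V$ on $V$ is alternating. For every $\ell\in\Omega_{\{h,s\}^\perp}$: a) The action of $K$ on $V_{\mathbb Q}$ is by endomorphisms of the complex four-dimensional torus $\mathcal T_\ell$, so $K\subset\mathrm{End}(\mathcal T_\ell)_{\mathbb Q}$. b) One of the two forms $E,-E$, denoted by $\omega_K\in H^2(\mathcal T_\ell,\mathbb Z)$, is a polarization of $\mathcal T_\ell$, and $(\mathcal T_\ell,K,\omega_K)$ is a polarized abelian fourfold of Weil type. c) The discriminant of $(\mathcal T_\ell,K,\omega_K)$ is trivial. d) The Cayley class $c_s$ lies in $H^{2,2}(\mathcal T_\ell,\mathbb Z)$ and is not contained in $\mathbb Q\,\omega_K^2$, where $\omega_K^2=\omega_K\wedge\omega_K$. e) The family parametrized by $\Omega_{\{h,s\}^\perp}$ is complete: if $J$ is any complex structure on $V_{\mathbb R}$ and $\omega\in\{E,-E\}$ is such that the torus $T=(V_{\mathbb R},J)/V$, with the above action of $K$ on $H_1(T,\mathbb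 Q)=V_{\mathbb Q}$ and with $\omega$, is a polarized abelian fourfold of Weil type, then there is a unique $\ell\in\Omega_{\{h,s\}^\perp}$ with $T=\mathcal T_\ell$ (that is, with $H^{1,0}(T)=Z_\ell$). -/

import Mathlib

open scoped ComplexConjugate LinearAlgebra.Projectivization

noncomputable section

namespace WeilFourfold

/-! ### Lattices, spinors and the spinor map

`V = W ⊕ W^*` with `W` free of rank four.  For a commutative ring `R`, an element of `V ⊗ R` is the
vector `v : Fin 8 → R` of its coordinates in the basis `e_1, …, e_4` of `W` followed by the dual
basis `e_5, …, e_8` of `W^*` (indices are shifted by one: `v 0, …, v 7`). -/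

/-- The bilinear form of `U^{⊕ 4}`: `(x, y) = ∑_{i=1}^4 x_i y_{i+4} + x_{i+4} y_i`.
It is the form on `V` and, in the coordinates `z_1, …, z_8` used below, also the form on `S^+`. -/
def hyp {R : Type*} [CommRing R] : LinearMap.BilinForm R (Fin 8 → R) :=
  LinearMap.mk₂ R
    (fun x y => ∑ i : Fin 4,
      (x (Fin.castAdd 4 i) * y (Fin.natAdd 4 i) + x (Fin.natAdd 4 i) * y (Fin.castAdd 4 i)))
    (fun x y z => by
      rw [← Finset.sum_add_distrib]; refine Finset.sum_congr rfl fun i _ => ?_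
      simp only [Pi.add_apply]; ring)
    (fun c x y => by
      rw [smul_eq_mul, Finset.mul_sum]; refine Finset.sum_congr rfl fun i _ => ?_
      simp only [Pi.smul_apply, smul_eq_mul]; ring)
    (fun x y z => by
      rw [← Finset.sum_add_distrib]; refine Finset.sum_congr rfl fun i _ => ?_
      simp only [Pi.add_apply]; ring)
    (fun c x y => by
      rw [smul_eq_mul, Finset.mul_sum]; refine Finset.sum_congr rfl fun i _ => ?_
      simp only [Pi.smul_apply, smul_eq_mul]; ring)

/-- The exterior algebra `⋀^• W ⊗ R`, as coordinate vectors in the basis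
`e_I = e_{i_1} ∧ … ∧ e_{i_r}` (`i_1 < … < i_r`), `I ⊆ {1, 2, 3, 4}`. -/
abbrev Spinor (R : Type*) : Type _ := Finset (Fin 4) → R

/-- The sign `(-1)^{#{j ∈ I : j < i}}`: for `i ∉ J` one has `e_i ∧ e_J = sgn i J • e_{J ∪ {i}}`, and
for `i ∈ J` the contraction of `e_J` with `e_i^*` is `sgn i J • e_{J \ {i}}`. -/
def sgn (i : Fin 4) (I : Finset (Fin 4)) : ℤ := (-1) ^ (I.filter (· < i)).card

/-- Clifford multiplication `V × ⋀^• W → ⋀^• W`: `w ∈ W` acts as `w ∧ ·` and `w^* ∈ W^*` acts as the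
contraction (the antiderivation `D_{w^*}`). -/
def cliff {R : Type*} [CommRing R] : (Fin 8 → R) →ₗ[R] Module.End R (Spinor R) :=
  LinearMap.mk₂ R
    (fun v η I => ∑ i : Fin 4,
      if i ∈ I then (sgn i I : R) * v (Fin.castAdd 4 i) * η (I.erase i)
      else (sgn i I : R) * v (Fin.natAdd 4 i) * η (insert i I))
    (fun v w η => by
      funext I; simp only [Pi.add_apply]
      rw [← Finset.sum_add_distrib]; refine Finset.sum_congr rfl fun i _ => ?_
      split_ifs <;> ring)
    (fun c v η => by
      funext I; simp only [Pi.smul_apply, smul_eq_mul]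
      rw [Finset.mul_sum]; refine Finset.sum_congr rfl fun i _ => ?_
      split_ifs <;> ring)
    (fun v η ξ => by
      funext I; simp only [Pi.add_apply]
      rw [← Finset.sum_add_distrib]; refine Finset.sum_congr rfl fun i _ => ?_
      split_ifs <;> ring)
    (fun c v η => by
      funext I; simp only [Pi.smul_apply, smul_eq_mul]
      rw [Finset.mul_sum]; refine Finset.sum_congr rfl fun i _ => ?_
      split_ifs <;> ring)

/-- The coordinates `z_1, …, z_8` on `S^+ = ⋀^{even} W`: the coefficients of
`1, e_{12}, e_{13}, e_{14}, e_{1234}, -e_{34}, e_{24}, -e_{23}`. -/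
def evenCoord {R : Type*} [CommRing R] : Spinor R →ₗ[R] (Fin 8 → R) where
  toFun η := ![η ∅, η {0, 1}, η {0, 2}, η {0, 3}, η {0, 1, 2, 3}, -η {2, 3}, η {1, 3}, -η {1, 2}]
  map_add' η ξ := by
    funext i; fin_cases i <;> simp [add_comm]
  map_smul' c η := by
    funext i; fin_cases i <;> simp

/-- The even spinor with given coordinates `z_1, …, z_8`. -/
def evenSpinor {R : Type*} [CommRing R] (z : Fin 8 → R) : Spinor R :=
  Pi.single ∅ (z 0) + Pi.single {0, 1} (z 1) + Pi.single {0, 2} (z 2) + Pi.single {0, 3} (z 3) +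
    Pi.single {0, 1, 2, 3} (z 4) + Pi.single {2, 3} (-z 5) + Pi.single {1, 3} (z 6) +
    Pi.single {1, 2} (-z 7)

/-- For `z ∈ S^+ ⊗ R`, the subspace `{v ∈ V ⊗ R : v · z = 0}` (Clifford multiplication).
If `z ≠ 0` is isotropic, this is the maximal isotropic subspace `Z` in the family of `W^*` whose
image `γ([Z])` under the spinor map is the point `[z]` of the spinor quadric: `W^*` is the annihilator
of `1 = γ([W^*])`, and annihilators are compatible with the actions of the spin group on `V` and on
`S^+`.  For instance, if `B` is an alternating matrix, the span `Z_B` of the columns of `(B; 1)` is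
the annihilator of `exp(∑_{i<j} b_{ij} e_i ∧ e_j)`, whose coordinates are
`(1, b_{12}, b_{13}, b_{14}, Pf B, -b_{34}, b_{24}, -b_{23})`. -/
def annihilator {R : Type*} [CommRing R] (z : Fin 8 → R) : Submodule R (Fin 8 → R) :=
  LinearMap.ker ((LinearMap.applyₗ (evenSpinor z)).comp (cliff (R := R)))

/-! ### Complex tori `ℝ^ι / ℤ^ι` -/

/-- A complex structure `J` on the real vector space `ℝ^ι`.  It stands for the complex torus
`T = (ℝ^ι, J) / ℤ^ι`, with `H_1(T, ℤ) = ℤ^ι` and tangent space `T_0 = (ℝ^ι, J)`. -/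
structure ComplexTorus (ι : Type*) [Fintype ι] [DecidableEq ι] where
  J : Matrix ι ι ℝ
  J_mul_J : J * J = -1

/-- `H^k(T, ℝ)` for a torus `T = ℝ^ι / ℤ^ι`: the alternating `k`-forms on `H_1(T, ℝ) = ℝ^ι`. -/
abbrev Coh (ι : Type*) (k : ℕ) : Type _ := (ι → ℝ) [⋀^Fin k]→ₗ[ℝ] ℝ

/-- `α` lies in `H^k(T, ℤ)`: it takes integral values on `H_1(T, ℤ) = ℤ^ι`. -/
def IsIntegralClass {ι : Type*} {k : ℕ} (α : Coh ι k) : Prop :=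
  ∀ v : Fin k → ι → ℤ, ∃ m : ℤ, α (fun j i => (v j i : ℝ)) = m

/-- The wedge product of alternating forms. -/
def wedge {ι : Type*} {p q : ℕ} (α : Coh ι p) (β : Coh ι q) : Coh ι (p + q) :=
  ((LinearMap.mul' ℝ ℝ).compAlternatingMap (α.domCoprod β)).domDomCongr finSumFinEquiv

namespace ComplexTorus

variable {ι : Type*} [Fintype ι] [DecidableEq ι]

/-- For `k = 2 p`: a real class `α` is of Hodge type `(p, p)`, that is, it is invariant under the
multiplication by all `a + b i` with `a ^ 2 + b ^ 2 = 1` on the tangent space. -/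
def IsMiddleType (T : ComplexTorus ι) {k : ℕ} (α : Coh ι k) : Prop :=
  ∀ a b : ℝ, a ^ 2 + b ^ 2 = 1 → ∀ v : Fin k → ι → ℝ,
    α (fun j => a • v j + b • T.J.mulVec (v j)) = α v

/-- A polarization of `T`: an integral class of type `(1, 1)` which is positive. -/
structure IsPolarization (T : ComplexTorus ι) (ω : Coh ι 2) : Prop where
  integral : IsIntegralClass ω
  type_one_one : T.IsMiddleType ω
  pos : ∀ v : ι → ℝ, v ≠ 0 → 0 < ω ![T.J.mulVec v, v]

/-- `End(T)_ℚ`: the endomorphisms of `H_1(T, ℚ) = ℚ^ι` whose real extension is complex linear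
on the tangent space. -/
def endQ (T : ComplexTorus ι) : Subalgebra ℚ (Matrix ι ι ℚ) where
  carrier := {A | A.map (algebraMap ℚ ℝ) * T.J = T.J * A.map (algebraMap ℚ ℝ)}
  mul_mem' {A B} hA hB := by
    simp only [Set.mem_ofPred_eq, Matrix.map_mul] at *
    rw [Matrix.mul_assoc, hB, ← Matrix.mul_assoc, hA, Matrix.mul_assoc]
  add_mem' {A B} hA hB := by
    simp only [Set.mem_ofPred_eq] at *
    rw [Matrix.map_add _ (map_add _), Matrix.add_mul, Matrix.mul_add, hA, hB]
  algebraMap_mem' q := by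
    simp only [Set.mem_ofPred_eq, Matrix.algebraMap_eq_diagonal]
    rw [Matrix.diagonal_map (map_zero _)]
    ext i j
    simp [Matrix.diagonal_mul, Matrix.mul_diagonal, mul_comm]

/-- The eigenspace, for the eigenvalue `x : ℂ`, of an endomorphism `A` on the complex vector space
`T_0 = (ℝ^ι, J)`, as a real subspace; its complex dimension is half of its real dimension. -/
def eigenspace (T : ComplexTorus ι) (A : Matrix ι ι ℚ) (x : ℂ) : Submodule ℝ (ι → ℝ) :=
  LinearMap.ker (Matrix.toLin' (A.map (algebraMap ℚ ℝ) - (x.re • (1 : Matrix ι ι ℝ) + x.im • T.J)))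

end ComplexTorus

/-! ### Abelian varieties of Weil type -/

/-- `√(-d) = √d · i`. -/
def sqrtNeg (d : ℤ) : ℂ := (Real.sqrt d : ℂ) * Complex.I

/-- The field `K = ℚ(√(-d))`, as a subfield of `ℂ`. -/
def imQuad (d : ℤ) : IntermediateField ℚ ℂ := IntermediateField.adjoin ℚ {sqrtNeg d}

/-- `√(-d)` as an element of `K`. -/
def sqrtNegK (d : ℤ) : imQuad d := ⟨sqrtNeg d, IntermediateField.mem_adjoin_simple_self ℚ _⟩

/-- `(T, K)` is an abelian variety of Weil type, where `K = ℚ(√(-d))` acts on `H_1(T, ℚ)` by `φ`. -/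
structure IsWeilType {ι : Type*} [Fintype ι] [DecidableEq ι] {d : ℤ} (T : ComplexTorus ι)
    (φ : imQuad d →ₐ[ℚ] Matrix ι ι ℚ) : Prop where
  abelian : ∃ ω : Coh ι 2, T.IsPolarization ω
  endo : ∀ x : imQuad d, φ x ∈ T.endQ
  multiplicity : ∀ x : imQuad d, x ∉ Set.range (algebraMap ℚ (imQuad d)) →
    Module.finrank ℝ (T.eigenspace (φ x) (x : ℂ)) =
      Module.finrank ℝ (T.eigenspace (φ x) (conj (x : ℂ)))

/-- `(T, K, ω)` is a polarized abelian variety of Weil type: `ω` is a polarization and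
`x^* ω = Nm(x) ω` for all `x ∈ K`. -/
structure IsPolarizedWeilType {ι : Type*} [Fintype ι] [DecidableEq ι] {d : ℤ}
    (T : ComplexTorus ι) (φ : imQuad d →ₐ[ℚ] Matrix ι ι ℚ) (ω : Coh ι 2) : Prop where
  weil : IsWeilType T φ
  polarization : T.IsPolarization ω
  norm : ∀ (x : imQuad d) (v w : ι → ℝ),
    ω ![((φ x).map (algebraMap ℚ ℝ)).mulVec v, ((φ x).map (algebraMap ℚ ℝ)).mulVec w] =
      Complex.normSq (x : ℂ) * ω ![v, w]

/-- The `K`-valued Hermitian form `H(x, y) = ω(x, √(-d) y) + √(-d) ω(x, y)` on `H_1(T, ℚ)`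
(with `K ⊆ ℂ`). -/
def hermitian {ι : Type*} [Fintype ι] [DecidableEq ι] {d : ℤ}
    (φ : imQuad d →ₐ[ℚ] Matrix ι ι ℚ) (ω : Coh ι 2) (x y : ι → ℚ) : ℂ :=
  (ω ![fun i => (x i : ℝ), fun i => ((φ (sqrtNegK d)).mulVec y i : ℝ)] : ℂ) +
    sqrtNeg d * (ω ![fun i => (x i : ℝ), fun i => (y i : ℝ)] : ℂ)

/-- `b` is a basis of the `K`-vector space `H_1(T, ℚ)`. -/
def IsKBasis {ι : Type*} [Fintype ι] [DecidableEq ι] {d : ℤ} {n : ℕ}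
    (φ : imQuad d →ₐ[ℚ] Matrix ι ι ℚ) (b : Fin n → ι → ℚ) : Prop :=
  Function.Bijective fun c : Fin n → imQuad d => ∑ j, (φ (c j)).mulVec (b j)

/-- The discriminant, in `ℚ^× / Nm(K^×)`, of the Hermitian form `H` is trivial. -/
def HasTrivialDiscriminant {ι : Type*} [Fintype ι] [DecidableEq ι] {d : ℤ}
    (φ : imQuad d →ₐ[ℚ] Matrix ι ι ℚ) (ω : Coh ι 2) : Prop :=
  ∃ (n : ℕ) (b : Fin n → ι → ℚ), IsKBasis φ b ∧ ∃ x : imQuad d, x ≠ 0 ∧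
    (Matrix.of fun i j => hermitian φ ω (b i) (b j)).det = (x : ℂ) * conj (x : ℂ)

/-! ### The period domains and the tori `T_ℓ` -/

/-- `Ω = {ℓ ∈ ℙ(S^+_ℂ) : (ℓ, ℓ) = 0, (ℓ, ℓ̄) > 0}`. -/
def Omega : Set (ℙ ℂ (Fin 8 → ℂ)) :=
  {ℓ | hyp ℓ.rep ℓ.rep = 0 ∧ 0 < (hyp ℓ.rep (fun i => conj (ℓ.rep i))).re}

/-- `Ω_{{h,s}^⊥} = {ℓ ∈ Ω : (ℓ, s) = (ℓ, h) = 0}`. -/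
def OmegaPerp (h s : Fin 8 → ℤ) : Set (ℙ ℂ (Fin 8 → ℂ)) :=
  {ℓ | ℓ ∈ Omega ∧ hyp ℓ.rep (fun i => (s i : ℂ)) = 0 ∧ hyp ℓ.rep (fun i => (h i : ℂ)) = 0}

/-- `M` is a (locally closed) complex submanifold of dimension `n` of the vector space `E`: locally
it is the zero locus of a holomorphic submersion to `ℂ^m`, with `m + n = dim E`. -/
def IsComplexSubmanifold {E : Type*} [NormedAddCommGroup E] [NormedSpace ℂ E] (n : ℕ)
    (M : Set E) : Prop :=
  ∀ z ∈ M, ∃ (m : ℕ) (D : Set E) (F : E → Fin m → ℂ), m + n = Module.finrank ℂ E ∧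
    IsOpen D ∧ z ∈ D ∧ DifferentiableOn ℂ F D ∧
    (∀ w ∈ D, Function.Surjective (fderiv ℂ F w)) ∧ M ∩ D = {w ∈ D | F w = 0}

/-- `M` is a complex submanifold of dimension `n` of the projective space `ℙ(E)`: the punctured
cone over `M` is a complex submanifold of `E` of dimension `n + 1`. -/
def IsProjectiveSubmanifold {E : Type*} [NormedAddCommGroup E] [NormedSpace ℂ E] (n : ℕ)
    (M : Set (ℙ ℂ E)) : Prop :=
  IsComplexSubmanifold (n + 1) {z : E | ∃ hz : z ≠ 0, Projectivization.mk ℂ z hz ∈ M}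

/-- `T` is the torus `T_ℓ`: with `V = H^1(T, ℤ)` one has `H^{1,0}(T) = Z_ℓ`.  Here the unimodular form
on `V` identifies `V` with `H^1(T, ℤ) = Hom(H_1(T, ℤ), ℤ)`, where `H_1(T, ℤ) = V`, by `z ↦ (z, ·)`,
and `H^{1,0}(T)` consists of the complex linear maps `(ℝ^8, J) → ℂ`. Since a complex structure is
determined by its `H^{1,0}`, there is at most one such `T`. -/
def ComplexTorus.IsTorusOf (T : ComplexTorus (Fin 8)) (ℓ : ℙ ℂ (Fin 8 → ℂ)) : Prop :=
  ∀ z : Fin 8 → ℂ, z ∈ annihilator ℓ.rep ↔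
    ∀ v : Fin 8 → ℝ, hyp z (fun i => (T.J.mulVec v i : ℂ)) =
      Complex.I * hyp z (fun i => (v i : ℂ))

/-! ### The `K`-action and the Cayley class -/

/-- `d = (h, h)(s, s)`. -/
def dd (h s : Fin 8 → ℤ) : ℤ := hyp h h * hyp s s

/-- `κ = √(-d) h + (h, h) s`; if `(h, s) = 0` it spans one of the two isotropic lines in the complex
span of `h` and `s`. -/
def kappa (h s : Fin 8 → ℤ) : Fin 8 → ℂ :=
  fun i => sqrtNeg (dd h s) * h i + (hyp h h : ℤ) * s i

/-- `κ̄ = -√(-d) h + (h, h) s`, which spans the other isotropic line. -/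
def kappaBar (h s : Fin 8 → ℤ) : Fin 8 → ℂ :=
  fun i => -sqrtNeg (dd h s) * h i + (hyp h h : ℤ) * s i

/-- The action of `K = ℚ(√(-d))` on `V_ℚ` defined by `h` and `s`: after extension of scalars, `x ∈ K`
is multiplication by `x` on `Z_κ` and by `x̄` on `Z_κ̄`, where `V_ℂ = Z_κ ⊕ Z_κ̄`. -/
structure IsKAction (h s : Fin 8 → ℤ)
    (φ : imQuad (dd h s) →ₐ[ℚ] Matrix (Fin 8) (Fin 8) ℚ) : Prop where
  isCompl : IsCompl (annihilator (kappa h s)) (annihilator (kappaBar h s))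
  on_kappa : ∀ x : imQuad (dd h s), ∀ v ∈ annihilator (kappa h s),
    ((φ x).map (algebraMap ℚ ℂ)).mulVec v = (x : ℂ) • v
  on_kappaBar : ∀ x : imQuad (dd h s), ∀ v ∈ annihilator (kappaBar h s),
    ((φ x).map (algebraMap ℚ ℂ)).mulVec v = conj (x : ℂ) • v

/-- The Cayley class `c_s ∈ ⋀^4 V`, as an alternating form on `V` (using the identification of `V`
with its dual given by the form):
`c_s(v_1, …, v_4) = ∑_σ sign(σ) (s, v_{σ(1)} · v_{σ(2)} · v_{σ(3)} · v_{σ(4)} · s)_{S^+}`.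
The form on `S^+` being invariant under the spin group, this is the value at `s ⊙ s` of a non-zero
`Spin(V)`-equivariant linear map `Sym^2(S^+) → ⋀^4 V`; such a map is unique up to a scalar, and it
is zero on the trivial summand of `Sym^2(S^+)`.  For instance, for `s = 1 - n e_{1234}` it is
`6 (-n α^2 + 4 n^2 β + 4 γ)` with `α = ∑_i e_i ∧ e_{i+4}`, `β = e_1 ∧ … ∧ e_4`,
`γ = e_5 ∧ … ∧ e_8`. -/
def cayley (s : Fin 8 → ℤ) : Coh (Fin 8) 4 :=
  MultilinearMap.alternatization
    (((hyp fun i => (s i : ℝ)) ∘ₗ evenCoord ∘ₗ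
        LinearMap.applyₗ (evenSpinor fun i => (s i : ℝ))).compMultilinearMap
      ((MultilinearMap.mkPiAlgebraFin ℝ 4 (Module.End ℝ (Spinor ℝ))).compLinearMap
        fun _ => cliff))

end WeilFourfold

end

open WeilFourfold

open scoped Matrix

noncomputable section

namespace WeilFourfold


/-! ### Clifford multiplication by even spinors as 8×8 matrices -/

section Algebra

variable {R : Type*} [CommRing R]

/-! Write q for `quad`. For z in S^+ let `cliffMat z` be the map v ↦ v·z and `cliffAdj z` its
adjoint. They satisfy the Clifford relations (`cliffAdj_mul_cliffMat_add`,
`cliffMat_mul_cliffAdj_add`), so `twist a b = cliffAdj a * cliffMat b` is the action on V of the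
element ab of the even Clifford algebra of S^+. For orthogonal a, b it is skew with square
-q(a)q(b), and products of such elements commute or anticommute as in a Clifford algebra.
Multiplication by √(-d) is N = 2 `twist s h`. For ℓ = [x + iy] the complex structure is J = q(y)⁻¹
`twist y x` (`IsPosFrame.isTorusOf`). Since x, y are orthogonal to h, s, the two commute.

The product NJ is a positive multiple of the volume element P of the positive 4-plane ⟨h, s, x, y⟩
in S^+ ⊗ ℝ, which has signature (4,4). The form (Pv, v) is definite (`IsPosFrame.vol_definite`):
from one non-isotropic eigenvector v₀ of P every vector is reached as `twist h p` v₀, P commutes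
with this operator for p in the 4-plane and anticommutes with it for p in the negative complement,
and the two signs compensate. Hence E or -E is a polarization. For p orthogonal to the 4-plane,
`twist h p` commutes with J and anticommutes with N, so it exchanges the eigenspaces and gives equal
multiplicities (`IsPosFrame.finrank_ker_eq`).

A rational isotropic z orthogonal to h, s has a K-stable isotropic 4-dimensional annihilator. The
Hermitian form is therefore hyperbolic and its discriminant is a norm (`hasTrivialDiscriminant`).

The circle a + bJ acts on S^+ by rotations of the plane ⟨x, y⟩, which fix s; hence c_s has type
(2,2) (`middleType_cayley`). Four explicit orthogonal vectors on which ω∧ω vanishes and c_s does not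
show independence (`IsPosPair.cayley_ne`).

For completeness, J splits V_ℝ into the parts where N = ∓√d J, each of real dimension 4, and the
polarization makes the first part definite. If v, w span this part over J, the spinor z = (v +
iJv)·(w + iJw)·κ̄ has the -i-eigenspace of J as annihilator (`IsCompatible.exists_isPeriod`). It is
orthogonal to κ and κ̄ because it shares annihilated vectors with both. Uniqueness holds because the
annihilator determines the line of z (`mk_eq_mk_of_annihilator_eq`). -/

/-- The quadratic form `∑ x_i x_{i+4}`, half of `hyp x x`. -/
def quad (x : Fin 8 → R) : R := ∑ i : Fin 4, x (Fin.castAdd 4 i) * x (Fin.natAdd 4 i)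

lemma hyp_apply (x y : Fin 8 → R) :
    hyp x y = x 0 * y 4 + x 4 * y 0 + x 1 * y 5 + x 5 * y 1 + x 2 * y 6 + x 6 * y 2 +
      x 3 * y 7 + x 7 * y 3 := by
  simp only [hyp, LinearMap.mk₂_apply, Fin.sum_univ_four]
  simp [Fin.castAdd, Fin.natAdd, Fin.castLE]
  ring_nf

lemma quad_apply (x : Fin 8 → R) :
    quad x = x 0 * x 4 + x 1 * x 5 + x 2 * x 6 + x 3 * x 7 := by
  simp only [quad, Fin.sum_univ_four]
  rfl

lemma hyp_self (x : Fin 8 → R) : hyp x x = 2 * quad x := by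
  rw [hyp_apply, quad_apply]; ring

lemma hyp_comm (x y : Fin 8 → R) : hyp x y = hyp y x := by
  rw [hyp_apply, hyp_apply]; ring

lemma quad_add (x y : Fin 8 → R) : quad (x + y) = quad x + quad y + hyp x y := by
  simp only [hyp_apply, quad_apply, Pi.add_apply]; ring

lemma quad_smul (c : R) (x : Fin 8 → R) : quad (c • x) = c ^ 2 * quad x := by
  simp only [quad_apply, Pi.smul_apply, smul_eq_mul]; ring

lemma hyp_map {S : Type*} [CommRing S] (f : R →+* S) (x y : Fin 8 → R) :
    hyp (fun i => f (x i)) (fun i => f (y i)) = f (hyp x y) := by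
  simp [hyp_apply]

lemma hyp_ext {x y : Fin 8 → R} (h : ∀ z, hyp z x = hyp z y) : x = y := by
  funext i
  -- Addition in `Fin 8` wraps around, so `i + 4` is the index dual to `i` in both halves.
  have key := h (Pi.single (i + 4) 1)
  fin_cases i <;> simpa [hyp_apply, Pi.single_apply] using key

/-- The matrix of `v ↦ v · z` from `V` to the odd spinors, for an even spinor `z`. -/
def cliffMat (z : Fin 8 → R) : Matrix (Fin 8) (Fin 8) R :=
  !![z 0, 0, 0, 0, 0, -z 1, -z 2, -z 3;
     0, z 0, 0, 0, z 1, 0, z 7, -z 6;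
     0, 0, z 0, 0, z 2, -z 7, 0, z 5;
     0, 0, 0, z 0, z 3, z 6, -z 5, 0;
     0, -z 5, -z 6, -z 7, z 4, 0, 0, 0;
     z 5, 0, z 3, -z 2, 0, z 4, 0, 0;
     z 6, -z 3, 0, z 1, 0, 0, z 4, 0;
     z 7, z 2, -z 1, 0, 0, 0, 0, z 4]

/-- The adjoint of `cliffMat z`. -/
def cliffAdj (z : Fin 8 → R) : Matrix (Fin 8) (Fin 8) R :=
  !![z 4, 0, 0, 0, 0, z 1, z 2, z 3;
     0, z 4, 0, 0, -z 1, 0, -z 7, z 6;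
     0, 0, z 4, 0, -z 2, z 7, 0, -z 5;
     0, 0, 0, z 4, -z 3, -z 6, z 5, 0;
     0, z 5, z 6, z 7, z 0, 0, 0, 0;
     -z 5, 0, -z 3, z 2, 0, z 0, 0, 0;
     -z 6, z 3, 0, -z 1, 0, 0, z 0, 0;
     -z 7, -z 2, z 1, 0, 0, 0, 0, z 0]

lemma cliffMat_add (a b : Fin 8 → R) : cliffMat (a + b) = cliffMat a + cliffMat b := by
  ext i j
  fin_cases i <;> fin_cases j <;> simp [cliffMat, add_comm]

lemma cliffMat_smul (c : R) (a : Fin 8 → R) : cliffMat (c • a) = c • cliffMat a := by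
  ext i j
  fin_cases i <;> fin_cases j <;> simp [cliffMat]

lemma cliffAdj_add (a b : Fin 8 → R) : cliffAdj (a + b) = cliffAdj a + cliffAdj b := by
  ext i j
  fin_cases i <;> fin_cases j <;> simp [cliffAdj, add_comm]

lemma cliffAdj_smul (c : R) (a : Fin 8 → R) : cliffAdj (c • a) = c • cliffAdj a := by
  ext i j
  fin_cases i <;> fin_cases j <;> simp [cliffAdj]

lemma cliffMat_map {S : Type*} [CommRing S] (f : R →+* S) (z : Fin 8 → R) :
    cliffMat (fun i => f (z i)) = (cliffMat z).map f := by
  ext i j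
  fin_cases i <;> fin_cases j <;> simp [cliffMat]

lemma cliffAdj_map {S : Type*} [CommRing S] (f : R →+* S) (z : Fin 8 → R) :
    cliffAdj (fun i => f (z i)) = (cliffAdj z).map f := by
  ext i j
  fin_cases i <;> fin_cases j <;> simp [cliffAdj]

/-- One of the two entrywise checks behind the Clifford relations. With adjointness it says that v ↦
v·z multiplies the form by q(z), the composition law of the split octonions. -/
lemma cliffAdj_mul_cliffMat (z : Fin 8 → R) : cliffAdj z * cliffMat z = quad z • 1 := by
  ext i j
  rw [quad_apply, Matrix.mul_apply]
  fin_cases i <;> fin_cases j <;>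
    simp [cliffMat, cliffAdj, Fin.sum_univ_eight] <;> ring

lemma cliffMat_mul_cliffAdj (z : Fin 8 → R) : cliffMat z * cliffAdj z = quad z • 1 := by
  ext i j
  rw [quad_apply, Matrix.mul_apply]
  fin_cases i <;> fin_cases j <;>
    simp [cliffMat, cliffAdj, Fin.sum_univ_eight] <;> ring

lemma cliffAdj_mul_cliffMat_add (a b : Fin 8 → R) :
    cliffAdj a * cliffMat b + cliffAdj b * cliffMat a = hyp a b • 1 := by
  have h := cliffAdj_mul_cliffMat (a + b)
  rw [cliffAdj_add, cliffMat_add, quad_add, add_smul, add_smul, ← cliffAdj_mul_cliffMat a,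
    ← cliffAdj_mul_cliffMat b] at h
  rw [← add_right_inj (cliffAdj a * cliffMat a + cliffAdj b * cliffMat b), ← h]
  noncomm_ring

lemma cliffMat_mul_cliffAdj_add (a b : Fin 8 → R) :
    cliffMat a * cliffAdj b + cliffMat b * cliffAdj a = hyp a b • 1 := by
  have h := cliffMat_mul_cliffAdj (a + b)
  rw [cliffAdj_add, cliffMat_add, quad_add, add_smul, add_smul, ← cliffMat_mul_cliffAdj a,
    ← cliffMat_mul_cliffAdj b] at h
  rw [← add_right_inj (cliffMat a * cliffAdj a + cliffMat b * cliffAdj b), ← h]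
  noncomm_ring

/-- In suitable coordinates the odd spinors carry the same hyperbolic form, so the single `hyp`
serves V, S^+ and S^-. -/
lemma hyp_cliffMat_mulVec (z v w : Fin 8 → R) :
    hyp (cliffMat z *ᵥ v) w = hyp v (cliffAdj z *ᵥ w) := by
  simp [hyp_apply, cliffMat, cliffAdj, dotProduct, Fin.sum_univ_eight]
  ring

lemma hyp_cliffAdj_mulVec (z v w : Fin 8 → R) :
    hyp (cliffAdj z *ᵥ v) w = hyp v (cliffMat z *ᵥ w) := by
  rw [hyp_comm, ← hyp_cliffMat_mulVec, hyp_comm]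

lemma finset_fin_four_cases (I : Finset (Fin 4)) :
    I = ∅ ∨ I = {0} ∨ I = {1} ∨ I = {2} ∨ I = {3} ∨ I = {0, 1} ∨ I = {0, 2} ∨ I = {0, 3} ∨
      I = {1, 2} ∨ I = {1, 3} ∨ I = {2, 3} ∨ I = {0, 1, 2} ∨ I = {0, 1, 3} ∨ I = {0, 2, 3} ∨
      I = {1, 2, 3} ∨ I = {0, 1, 2, 3} := by
  revert I; decide

lemma cliff_apply (v : Fin 8 → R) (η : Spinor R) (I : Finset (Fin 4)) :
    cliff v η I = ∑ i : Fin 4,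
      if i ∈ I then (sgn i I : R) * v (Fin.castAdd 4 i) * η (I.erase i)
      else (sgn i I : R) * v (Fin.natAdd 4 i) * η (insert i I) := rfl


end Algebra


/-! ### From the exterior algebra to coordinates; the Clifford relations for V -/

section Spinors

variable {R : Type*} [CommRing R]

/-- The odd spinor with given coordinates. -/
def oddSpinor (w : Fin 8 → R) : Spinor R :=
  Pi.single {0} (w 0) + Pi.single {1} (w 1) + Pi.single {2} (w 2) + Pi.single {3} (w 3) +
    Pi.single {1, 2, 3} (w 4) + Pi.single {0, 2, 3} (-w 5) + Pi.single {0, 1, 3} (w 6) +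
    Pi.single {0, 1, 2} (-w 7)

/-- The matrix of Clifford multiplication by `v`, from the odd spinors to the even ones. -/
def cliffOdd (v : Fin 8 → R) : Matrix (Fin 8) (Fin 8) R :=
  !![v 4, v 5, v 6, v 7, 0, 0, 0, 0;
     -v 1, v 0, 0, 0, 0, 0, v 7, -v 6;
     -v 2, 0, v 0, 0, 0, -v 7, 0, v 5;
     -v 3, 0, 0, v 0, 0, v 6, -v 5, 0;
     0, 0, 0, 0, v 0, v 1, v 2, v 3;
     0, 0, v 3, -v 2, -v 5, v 4, 0, 0;
     0, -v 3, 0, v 1, -v 6, 0, v 4, 0;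
     0, v 2, -v 1, 0, -v 7, 0, 0, v 4]

set_option maxRecDepth 4000 in
-- The link between the exterior algebra and the matrices, checked on the sixteen basis elements.
lemma cliff_evenSpinor (v z : Fin 8 → R) :
    cliff v (evenSpinor z) = oddSpinor (cliffMat z *ᵥ v) := by
  funext I
  rw [cliff_apply]
  rcases finset_fin_four_cases I with h | h | h | h | h | h | h | h | h | h | h | h | h | h | h | h <;>
    subst h <;>
    simp +decide [sgn, Fin.sum_univ_four, evenSpinor, oddSpinor, Pi.single_apply, cliffMat,
      Matrix.vecHead, Matrix.vecTail] <;>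
    ring

set_option maxRecDepth 4000 in
lemma cliff_oddSpinor (v w : Fin 8 → R) :
    cliff v (oddSpinor w) = evenSpinor (cliffOdd v *ᵥ w) := by
  funext I
  rw [cliff_apply]
  rcases finset_fin_four_cases I with h | h | h | h | h | h | h | h | h | h | h | h | h | h | h | h <;>
    subst h <;>
    simp +decide [sgn, Fin.sum_univ_four, evenSpinor, oddSpinor, Pi.single_apply, cliffOdd,
      Matrix.vecHead, Matrix.vecTail] <;>
    ring

lemma evenCoord_evenSpinor (z : Fin 8 → R) : evenCoord (evenSpinor z) = z := by
  funext i
  fin_cases i <;> simp +decide [evenCoord, evenSpinor]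

lemma oddSpinor_eq_zero {w : Fin 8 → R} (h : oddSpinor w = 0) : w = 0 := by
  funext i
  fin_cases i
  · simpa +decide [oddSpinor, Pi.single_apply] using congr_fun h {0}
  · simpa +decide [oddSpinor, Pi.single_apply] using congr_fun h {1}
  · simpa +decide [oddSpinor, Pi.single_apply] using congr_fun h {2}
  · simpa +decide [oddSpinor, Pi.single_apply] using congr_fun h {3}
  · simpa +decide [oddSpinor, Pi.single_apply] using congr_fun h {1, 2, 3}
  · simpa +decide [oddSpinor, Pi.single_apply] using congr_fun h {0, 2, 3}
  · simpa +decide [oddSpinor, Pi.single_apply] using congr_fun h {0, 1, 3}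
  · simpa +decide [oddSpinor, Pi.single_apply] using congr_fun h {0, 1, 2}

lemma mem_annihilator {z v : Fin 8 → R} : v ∈ annihilator z ↔ cliffMat z *ᵥ v = 0 := by
  have : v ∈ annihilator z ↔ cliff v (evenSpinor z) = 0 := Iff.rfl
  rw [this, cliff_evenSpinor]
  refine ⟨oddSpinor_eq_zero, fun h => ?_⟩
  rw [h]; simp [oddSpinor]

/-- Clifford multiplication by v from S^- to S^+ is adjoint to the one from S^+ to S^-: both
pairings are the same trilinear form of triality. -/
lemma hyp_cliffOdd_mulVec (a v w : Fin 8 → R) :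
    hyp a (cliffOdd v *ᵥ w) = hyp (cliffMat a *ᵥ v) w := by
  simp [hyp_apply, cliffMat, cliffOdd, Matrix.vecHead, Matrix.vecTail]
  ring

/-- `v · w · z` for `v, w ∈ V` and an even spinor `z`. -/
def cliffTwo (v w z : Fin 8 → R) : Fin 8 → R := cliffOdd v *ᵥ (cliffMat z *ᵥ w)

lemma cliff_cliff_evenSpinor (v w z : Fin 8 → R) :
    cliff v (cliff w (evenSpinor z)) = evenSpinor (cliffTwo v w z) := by
  rw [cliff_evenSpinor, cliff_oddSpinor, cliffTwo]

lemma hyp_cliffTwo (a v w z : Fin 8 → R) :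
    hyp a (cliffTwo v w z) = hyp (cliffMat a *ᵥ v) (cliffMat z *ᵥ w) :=
  hyp_cliffOdd_mulVec _ _ _

lemma cliffTwo_add (v w z : Fin 8 → R) : cliffTwo v w z + cliffTwo w v z = hyp v w • z := by
  funext i
  fin_cases i <;> simp [cliffTwo, cliffOdd, cliffMat, hyp_apply, Matrix.vecHead, Matrix.vecTail] <;>
    ring

lemma cliffMat_cliffOdd_add (v w u : Fin 8 → R) :
    cliffMat (cliffOdd w *ᵥ u) *ᵥ v + cliffMat (cliffOdd v *ᵥ u) *ᵥ w = hyp v w • u := by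
  funext i
  fin_cases i <;> simp [cliffOdd, cliffMat, hyp_apply, Matrix.vecHead, Matrix.vecTail] <;> ring

lemma evenSpinor_add (a b : Fin 8 → R) : evenSpinor (a + b) = evenSpinor a + evenSpinor b := by
  simp only [evenSpinor, Pi.add_apply, Pi.single_add, neg_add]; abel

lemma oddSpinor_add (a b : Fin 8 → R) : oddSpinor (a + b) = oddSpinor a + oddSpinor b := by
  simp only [oddSpinor, Pi.add_apply, Pi.single_add, neg_add]; abel

lemma evenSpinor_smul (c : R) (a : Fin 8 → R) : evenSpinor (c • a) = c • evenSpinor a := by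
  simp only [evenSpinor, Pi.smul_apply, smul_eq_mul, smul_add, ← Pi.single_smul, mul_neg]

lemma oddSpinor_smul (c : R) (a : Fin 8 → R) : oddSpinor (c • a) = c • oddSpinor a := by
  simp only [oddSpinor, Pi.smul_apply, smul_eq_mul, smul_add, ← Pi.single_smul, mul_neg]

lemma exists_evenSpinor_add_oddSpinor (η : Spinor R) :
    ∃ z w, η = evenSpinor z + oddSpinor w := by
  refine ⟨evenCoord η, ![η {0}, η {1}, η {2}, η {3}, η {1, 2, 3}, -η {0, 2, 3}, η {0, 1, 3},
    -η {0, 1, 2}], ?_⟩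
  funext I
  rcases finset_fin_four_cases I with h | h | h | h | h | h | h | h | h | h | h | h | h | h | h | h <;>
    subst h <;> simp +decide [evenSpinor, oddSpinor, evenCoord]

/-- The Clifford relation. -/
lemma cliff_mul_add (v w : Fin 8 → R) :
    cliff v * cliff w + cliff w * cliff v = hyp v w • (1 : Module.End R (Spinor R)) := by
  refine LinearMap.ext fun η => ?_
  change cliff v (cliff w η) + cliff w (cliff v η) = hyp v w • η
  obtain ⟨z, u, rfl⟩ := exists_evenSpinor_add_oddSpinor η
  simp only [map_add, smul_add, cliff_oddSpinor, cliff_evenSpinor]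
  rw [← evenSpinor_smul, ← oddSpinor_smul, ← cliffTwo_add, ← cliffMat_cliffOdd_add, evenSpinor_add,
    oddSpinor_add]
  simp only [cliffTwo]
  abel

/-- The commutator of `cliffAdj b * cliffMat a` with Clifford multiplications. -/
lemma cliffAdj_mul_mul_sub (z x y : Fin 8 → R) :
    cliffAdj z * (cliffMat y * cliffAdj x) - cliffAdj y * cliffMat x * cliffAdj z =
      hyp z y • cliffAdj x - hyp z x • cliffAdj y := by
  have h1 : cliffAdj z * cliffMat y = hyp z y • 1 - cliffAdj y * cliffMat z :=
    eq_sub_of_add_eq (cliffAdj_mul_cliffMat_add z y)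
  have h2 : cliffMat z * cliffAdj x = hyp z x • 1 - cliffMat x * cliffAdj z :=
    eq_sub_of_add_eq (cliffMat_mul_cliffAdj_add z x)
  rw [← Matrix.mul_assoc, h1, Matrix.sub_mul, Matrix.mul_assoc (cliffAdj y), h2, Matrix.mul_sub]
  simp only [Matrix.smul_mul, Matrix.mul_smul, Matrix.one_mul, Matrix.mul_one, Matrix.mul_assoc]
  abel

/-- Two even spinors which are killed by the same isotropic subspace are proportional. -/
lemma proportional_of_cliffMat_mul_cliffAdj_eq_zero {F : Type*} [Field F] [CharZero F]
    {w z : Fin 8 → F} (h : cliffMat w * cliffAdj z = 0) (i j : Fin 8) :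
    w i * z j = w j * z i := by
  have e (r c : Fin 8) : (cliffMat w * cliffAdj z) r c = 0 := by rw [h]; rfl
  simp only [Matrix.mul_apply, Fin.sum_univ_eight] at e
  have e00 := e 0 0
  have e01 := e 0 1
  have e02 := e 0 2
  have e03 := e 0 3
  have e05 := e 0 5
  have e06 := e 0 6
  have e07 := e 0 7
  have e10 := e 1 0
  have e11 := e 1 1
  have e12 := e 1 2
  have e13 := e 1 3
  have e16 := e 1 6
  have e17 := e 1 7
  have e20 := e 2 0
  have e21 := e 2 1
  have e22 := e 2 2
  have e23 := e 2 3
  have e27 := e 2 7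
  have e30 := e 3 0
  have e31 := e 3 1
  have e32 := e 3 2
  have e33 := e 3 3
  have e41 := e 4 1
  have e42 := e 4 2
  have e43 := e 4 3
  have e52 := e 5 2
  have e53 := e 5 3
  have e63 := e 6 3
  have e66 := e 6 6
  have e77 := e 7 7
  simp [cliffMat, cliffAdj] at e00 e01 e02 e03 e05 e06 e07 e10 e11 e12 e13 e16 e17 e20 e21 e22 e23 e27 e30 e31 e32 e33 e41 e42 e43 e52 e53 e63 e66 e77
  have p01 : w 0 * z 1 = w 1 * z 0 := by linear_combination e05
  have p02 : w 0 * z 2 = w 2 * z 0 := by linear_combination e06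
  have p03 : w 0 * z 3 = w 3 * z 0 := by linear_combination e07
  have p04 : w 0 * z 4 = w 4 * z 0 := by linear_combination (e00 + e11 - e66 - e77) / 2
  have p05 : w 0 * z 5 = w 5 * z 0 := by linear_combination -e27
  have p06 : w 0 * z 6 = w 6 * z 0 := by linear_combination e17
  have p07 : w 0 * z 7 = w 7 * z 0 := by linear_combination -e16
  have p12 : w 1 * z 2 = w 2 * z 1 := by linear_combination -e03
  have p13 : w 1 * z 3 = w 3 * z 1 := by linear_combination e02
  have p14 : w 1 * z 4 = w 4 * z 1 := by linear_combination e63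
  have p15 : w 1 * z 5 = w 5 * z 1 := by linear_combination (e00 + e11 - e22 - e33) / 2
  have p16 : w 1 * z 6 = w 6 * z 1 := by linear_combination e12
  have p17 : w 1 * z 7 = w 7 * z 1 := by linear_combination e13
  have p23 : w 2 * z 3 = w 3 * z 2 := by linear_combination -e01
  have p24 : w 2 * z 4 = w 4 * z 2 := by linear_combination -e53
  have p25 : w 2 * z 5 = w 5 * z 2 := by linear_combination e21
  have p26 : w 2 * z 6 = w 6 * z 2 := by linear_combination (e00 + e22 - e11 - e33) / 2
  have p27 : w 2 * z 7 = w 7 * z 2 := by linear_combination e23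
  have p34 : w 3 * z 4 = w 4 * z 3 := by linear_combination e52
  have p35 : w 3 * z 5 = w 5 * z 3 := by linear_combination e31
  have p36 : w 3 * z 6 = w 6 * z 3 := by linear_combination e32
  have p37 : w 3 * z 7 = w 7 * z 3 := by linear_combination (e00 + e33 - e11 - e22) / 2
  have p45 : w 4 * z 5 = w 5 * z 4 := by linear_combination e41
  have p46 : w 4 * z 6 = w 6 * z 4 := by linear_combination e42
  have p47 : w 4 * z 7 = w 7 * z 4 := by linear_combination e43
  have p56 : w 5 * z 6 = w 6 * z 5 := by linear_combination e30
  have p57 : w 5 * z 7 = w 7 * z 5 := by linear_combination -e20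
  have p67 : w 6 * z 7 = w 7 * z 6 := by linear_combination e10
  fin_cases i <;> fin_cases j <;> first | rfl | assumption | (symm; assumption)

end Spinors


/-! ### The imaginary quadratic field K -/

section ImaginaryQuadratic

open Polynomial

variable {d : ℤ}

lemma sqrtNeg_mul_self (hd : 0 < d) : sqrtNeg d * sqrtNeg d = -(d : ℂ) := by
  have : (Real.sqrt d : ℂ) * Real.sqrt d = (d : ℂ) := by
    rw [← Complex.ofReal_mul, Real.mul_self_sqrt (by exact_mod_cast hd.le)]; simp
  rw [sqrtNeg]
  linear_combination (-1 : ℂ) * this + (Real.sqrt d : ℂ) * Real.sqrt d * Complex.I_mul_I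

lemma conj_sqrtNeg : conj (sqrtNeg d) = -sqrtNeg d := by
  simp [sqrtNeg]

lemma sqrtNeg_im_pos (hd : 0 < d) : 0 < (sqrtNeg d).im := by
  simpa [sqrtNeg] using hd

lemma sqrtNeg_re : (sqrtNeg d).re = 0 := by simp [sqrtNeg]

lemma sqrtNeg_im : (sqrtNeg d).im = Real.sqrt d := by simp [sqrtNeg]

lemma sqrtNeg_ne_zero (hd : 0 < d) : sqrtNeg d ≠ 0 := fun h => by
  have := sqrtNeg_im_pos hd
  rw [h] at this
  simp at this

/-- Positivity of d alone excludes rational roots; d need not be squarefree. -/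
lemma minpoly_sqrtNegK (hd : 0 < d) : minpoly ℚ (sqrtNegK d) = X ^ 2 + C (d : ℚ) := by
  have hmonic : (X ^ 2 + C (d : ℚ)).Monic := by monicity!
  have hdeg : (X ^ 2 + C (d : ℚ)).natDegree = 2 := by compute_degree!
  refine (minpoly.eq_of_irreducible_of_monic ?_ ?_ hmonic).symm
  · refine (Polynomial.irreducible_iff_roots_eq_zero_of_degree_le_three (by omega) (by omega)).2 ?_
    refine Multiset.eq_zero_of_forall_notMem fun x hx => ?_
    have := (mem_roots'.1 hx).2
    simp only [IsRoot.def, eval_add, eval_pow, eval_X, eval_C] at this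
    have hd' : (0 : ℚ) < d := by exact_mod_cast hd
    nlinarith
  · have : (sqrtNegK d) ^ 2 = -(d : imQuad d) := by
      apply Subtype.ext
      rw [pow_two]
      simpa [sqrtNegK] using sqrtNeg_mul_self hd
    simp [this]

lemma isIntegral_sqrtNeg (hd : 0 < d) : IsIntegral ℚ (sqrtNeg d) := by
  refine ⟨X ^ 2 + C (d : ℚ), by monicity!, ?_⟩
  rw [← aeval_def]
  simp [pow_two, sqrtNeg_mul_self hd]

/-- The power basis `1, √(-d)` of `K`. -/
def imQuadPowerBasis (hd : 0 < d) : PowerBasis ℚ (imQuad d) :=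
  IntermediateField.adjoin.powerBasis (isIntegral_sqrtNeg hd)

lemma imQuadPowerBasis_gen (hd : 0 < d) : (imQuadPowerBasis hd).gen = sqrtNegK d := rfl

lemma imQuadPowerBasis_dim (hd : 0 < d) : (imQuadPowerBasis hd).dim = 2 := by
  rw [← PowerBasis.natDegree_minpoly, imQuadPowerBasis_gen, minpoly_sqrtNegK hd]
  compute_degree!

lemma finrank_imQuad (hd : 0 < d) : Module.finrank ℚ (imQuad d) = 2 := by
  rw [(imQuadPowerBasis hd).finrank, imQuadPowerBasis_dim]

lemma exists_eq_add_mul_sqrtNegK (hd : 0 < d) (x : imQuad d) :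
    ∃ a b : ℚ, x = algebraMap ℚ _ a + algebraMap ℚ _ b * sqrtNegK d := by
  obtain ⟨f, hf, hx⟩ := (imQuadPowerBasis hd).exists_eq_aeval x
  rw [imQuadPowerBasis_dim] at hf
  rw [imQuadPowerBasis_gen] at hx
  refine ⟨f.coeff 0, f.coeff 1, ?_⟩
  rw [hx, Polynomial.aeval_eq_sum_range' hf]
  simp [Finset.sum_range_succ, Algebra.smul_def]

/-- The algebra homomorphism from `K` that sends `√(-d)` to a given element of square `-d`. -/
def imQuadLift {S : Type*} [Ring S] [Algebra ℚ S] (hd : 0 < d) (y : S)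
    (hy : y * y = -(d : S)) : imQuad d →ₐ[ℚ] S :=
  (imQuadPowerBasis hd).lift y (by
    rw [imQuadPowerBasis_gen, minpoly_sqrtNegK hd]
    simp [pow_two, hy])

lemma imQuadLift_sqrtNegK {S : Type*} [Ring S] [Algebra ℚ S] (hd : 0 < d) (y : S)
    (hy : y * y = -(d : S)) : imQuadLift hd y hy (sqrtNegK d) = y := by
  rw [imQuadLift, ← imQuadPowerBasis_gen hd]
  exact (imQuadPowerBasis hd).lift_gen _ _

end ImaginaryQuadratic


/-! ### The even Clifford algebra of S^+ acting on V -/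

section Twist

variable {R : Type*} [CommRing R]

/-- `v ↦ a^* (v · b)`: for orthogonal `a`, `b` this is, up to a factor, the action on `V` of the
element `a ∧ b` of the orthogonal Lie algebra of `S^+`. -/
def twist (a b : Fin 8 → R) : Matrix (Fin 8) (Fin 8) R := cliffAdj a * cliffMat b

lemma cliffAdj_mul_cliffMat_swap {a b : Fin 8 → R} (h : hyp a b = 0) :
    cliffAdj a * cliffMat b = -(cliffAdj b * cliffMat a) := by
  have := cliffAdj_mul_cliffMat_add a b
  rw [h, zero_smul] at this
  exact eq_neg_of_add_eq_zero_left this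

lemma cliffMat_mul_cliffAdj_swap {a b : Fin 8 → R} (h : hyp a b = 0) :
    cliffMat a * cliffAdj b = -(cliffMat b * cliffAdj a) := by
  have := cliffMat_mul_cliffAdj_add a b
  rw [h, zero_smul] at this
  exact eq_neg_of_add_eq_zero_left this

lemma twist_swap {a b : Fin 8 → R} (h : hyp a b = 0) : twist a b = -twist b a :=
  cliffAdj_mul_cliffMat_swap h

lemma twist_self (a : Fin 8 → R) : twist a a = quad a • 1 := cliffAdj_mul_cliffMat a

lemma twist_mul_self {a b : Fin 8 → R} (h : hyp a b = 0) :
    twist a b * twist a b = -(quad a * quad b) • 1 := by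
  nth_rw 2 [twist_swap h]
  rw [twist, twist, Matrix.mul_neg, Matrix.mul_assoc, ← Matrix.mul_assoc (cliffMat b),
    cliffMat_mul_cliffAdj]
  simp [cliffAdj_mul_cliffMat, smul_smul, mul_comm]

lemma hyp_twist_mulVec (a b v w : Fin 8 → R) :
    hyp (twist a b *ᵥ v) w = hyp v (twist b a *ᵥ w) := by
  rw [twist, twist, ← Matrix.mulVec_mulVec, ← Matrix.mulVec_mulVec, hyp_cliffAdj_mulVec,
    hyp_cliffMat_mulVec]

lemma hyp_twist_mulVec_of_ortho {a b : Fin 8 → R} (h : hyp a b = 0) (v w : Fin 8 → R) :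
    hyp (twist a b *ᵥ v) w = -hyp v (twist a b *ᵥ w) := by
  rw [hyp_twist_mulVec, twist_swap h, Matrix.neg_mulVec, map_neg, neg_neg]

/-- Moving ce past ab takes four transpositions of orthogonal vectors, so no sign remains. -/
lemma twist_commute {a b c e : Fin 8 → R} (hac : hyp a c = 0) (hae : hyp a e = 0)
    (hbc : hyp b c = 0) (hbe : hyp b e = 0) : twist a b * twist c e = twist c e * twist a b := by
  calc twist a b * twist c e
      = cliffAdj a * (cliffMat b * cliffAdj c) * cliffMat e := by
        simp only [twist, Matrix.mul_assoc]
    _ = -(cliffAdj a * cliffMat c * (cliffAdj b * cliffMat e)) := by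
        rw [cliffMat_mul_cliffAdj_swap hbc]; simp only [Matrix.mul_neg, Matrix.neg_mul, Matrix.mul_assoc]
    _ = -(cliffAdj c * (cliffMat a * cliffAdj e) * cliffMat b) := by
        rw [cliffAdj_mul_cliffMat_swap hbe, cliffAdj_mul_cliffMat_swap hac]
        simp only [Matrix.mul_neg, Matrix.neg_mul, Matrix.mul_assoc, neg_neg]
    _ = twist c e * twist a b := by
        rw [cliffMat_mul_cliffAdj_swap hae]
        simp only [twist, Matrix.mul_neg, Matrix.neg_mul, Matrix.mul_assoc, neg_neg]

/-- The repeated vector a need not pass itself, so only three transpositions of orthogonal vectors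
occur, which leaves a sign. -/
lemma twist_anticommute {a b c : Fin 8 → R} (hab : hyp a b = 0) (hac : hyp a c = 0)
    (hbc : hyp b c = 0) : twist a b * twist c a = -(twist c a * twist a b) := by
  calc twist a b * twist c a
      = cliffAdj a * (cliffMat b * cliffAdj c) * cliffMat a := by
        simp only [twist, Matrix.mul_assoc]
    _ = -(cliffAdj a * cliffMat c * (cliffAdj b * cliffMat a)) := by
        rw [cliffMat_mul_cliffAdj_swap hbc]; simp only [Matrix.mul_neg, Matrix.neg_mul, Matrix.mul_assoc]
    _ = -(twist c a * twist a b) := by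
        rw [cliffAdj_mul_cliffMat_swap hac, cliffAdj_mul_cliffMat_swap (a := b) (by rw [hyp_comm, hab])]
        simp only [twist, Matrix.mul_neg, Matrix.neg_mul, Matrix.mul_assoc, neg_neg]

lemma twist_anticommute_right {a b c : Fin 8 → R} (hab : hyp a b = 0) (hac : hyp a c = 0)
    (hbc : hyp b c = 0) : twist b c * twist a c = -(twist a c * twist b c) := by
  rw [twist_swap hac, Matrix.mul_neg, Matrix.neg_mul, neg_neg,
    twist_anticommute (by rw [hyp_comm, hac]) (by rw [hyp_comm, hbc]) hab]

lemma hyp_cliffMat_cliffMat_same (a v w : Fin 8 → R) :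
    hyp (cliffMat a *ᵥ v) (cliffMat a *ᵥ w) = quad a * hyp v w := by
  rw [hyp_cliffMat_mulVec, Matrix.mulVec_mulVec, cliffAdj_mul_cliffMat, Matrix.smul_mulVec,
    Matrix.one_mulVec, map_smul, smul_eq_mul]

lemma hyp_cliffAdj_cliffAdj_same (a v w : Fin 8 → R) :
    hyp (cliffAdj a *ᵥ v) (cliffAdj a *ᵥ w) = quad a * hyp v w := by
  rw [hyp_cliffAdj_mulVec, Matrix.mulVec_mulVec, cliffMat_mul_cliffAdj, Matrix.smul_mulVec,
    Matrix.one_mulVec, map_smul, smul_eq_mul]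

lemma hyp_twist_twist_same (a b v w : Fin 8 → R) :
    hyp (twist a b *ᵥ v) (twist a b *ᵥ w) = quad a * quad b * hyp v w := by
  rw [twist, ← Matrix.mulVec_mulVec, ← Matrix.mulVec_mulVec, hyp_cliffAdj_cliffAdj_same,
    hyp_cliffMat_cliffMat_same]
  ring

lemma twist_add (a b c : Fin 8 → R) : twist a (b + c) = twist a b + twist a c := by
  rw [twist, cliffMat_add, Matrix.mul_add]; rfl

lemma twist_smul (a b : Fin 8 → R) (r : R) : twist a (r • b) = r • twist a b := by
  rw [twist, cliffMat_smul, Matrix.mul_smul]; rfl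

lemma twist_zero (a : Fin 8 → R) : twist a 0 = 0 := by
  simpa using twist_smul a 0 0

lemma twist_map {S : Type*} [CommRing S] (f : R →+* S) (a b : Fin 8 → R) :
    twist (fun i => f (a i)) (fun i => f (b i)) = (twist a b).map f := by
  rw [twist, cliffAdj_map, cliffMat_map, ← Matrix.map_mul]; rfl

lemma quad_map {S : Type*} [CommRing S] (f : R →+* S) (x : Fin 8 → R) :
    quad (fun i => f (x i)) = f (quad x) := by
  simp [quad]

end Twist

/-! ### Vectors of V reached from a non-isotropic one -/

section Field

variable {F : Type*} [Field F] [CharZero F]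

/-- The other half of the composition law: for fixed v the map z ↦ v·z is a similarity of ratio
q(v). It follows from v·v = q(v). -/
lemma hyp_cliffMat_cliffMat (a b v : Fin 8 → F) :
    hyp (cliffMat a *ᵥ v) (cliffMat b *ᵥ v) = quad v * hyp a b := by
  have h := congrArg (hyp a) (cliffTwo_add v v b)
  rw [map_add, hyp_cliffTwo, map_smul, hyp_self, smul_eq_mul] at h
  linear_combination h / 2

lemma hyp_twist_twist (a b c v : Fin 8 → F) :
    hyp (twist a b *ᵥ v) (twist a c *ᵥ v) = quad a * quad v * hyp b c := by
  rw [twist, twist, ← Matrix.mulVec_mulVec, ← Matrix.mulVec_mulVec, hyp_cliffAdj_cliffAdj_same,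
    hyp_cliffMat_cliffMat]
  ring

lemma cliffMat_cliffOdd_self (v u : Fin 8 → F) :
    cliffMat (cliffOdd v *ᵥ u) *ᵥ v = quad v • u := by
  have h := cliffMat_cliffOdd_add v v u
  rw [hyp_self, mul_smul, ← two_smul F] at h
  exact smul_right_injective _ (two_ne_zero (α := F)) h

/-- If `v` is not isotropic, then every vector is `a^* (v · p)` for some `p ∈ S^+`. -/
lemma exists_twist_mulVec_eq {a v : Fin 8 → F} (ha : quad a ≠ 0) (hv : quad v ≠ 0)
    (w : Fin 8 → F) : ∃ p, twist a p *ᵥ v = w := by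
  -- Multiplication by v on S^- inverts p ↦ v·p up to q(v), and `cliffMat a` inverts `cliffAdj a` up
  -- to q(a).
  refine ⟨(quad a)⁻¹ • (quad v)⁻¹ • (cliffOdd v *ᵥ (cliffMat a *ᵥ w)), ?_⟩
  rw [twist, ← Matrix.mulVec_mulVec, cliffMat_smul, cliffMat_smul, Matrix.smul_mulVec,
    Matrix.smul_mulVec, cliffMat_cliffOdd_self, inv_smul_smul₀ hv, Matrix.mulVec_smul,
    Matrix.mulVec_mulVec, cliffAdj_mul_cliffMat, Matrix.smul_mulVec, Matrix.one_mulVec,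
    inv_smul_smul₀ ha]

lemma exists_ne_zero_forall_eq_zero {F : Type*} [Field F] {m n : ℕ} (hmn : m < n)
    (f : Fin m → Module.Dual F (Fin n → F)) : ∃ p : Fin n → F, p ≠ 0 ∧ ∀ i, f i p = 0 := by
  have := LinearMap.ker_ne_bot_of_finrank_lt (f := LinearMap.pi f) (by simpa using hmn)
  obtain ⟨p, hp, hp0⟩ := (Submodule.ne_bot_iff _).1 this
  exact ⟨p, hp0, fun i => congr_fun (LinearMap.mem_ker.1 hp) i⟩

end Field

/-! ### Positive 4-planes in S^+ ⊗ ℝ and their volume elements -/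

/-- Four pairwise orthogonal vectors of positive norm in `S^+ ⊗ ℝ`. -/
structure IsPosFrame (h s x y : Fin 8 → ℝ) : Prop where
  hs : hyp h s = 0
  hx : hyp h x = 0
  hy : hyp h y = 0
  sx : hyp s x = 0
  sy : hyp s y = 0
  xy : hyp x y = 0
  h_pos : 0 < quad h
  s_pos : 0 < quad s
  x_pos : 0 < quad x
  y_pos : 0 < quad y

namespace IsPosFrame

variable {h s x y : Fin 8 → ℝ} (H : IsPosFrame h s x y)

lemma exists_ortho (h s x y : Fin 8 → ℝ) :
    ∃ p : Fin 8 → ℝ, p ≠ 0 ∧ hyp h p = 0 ∧ hyp s p = 0 ∧ hyp x p = 0 ∧ hyp y p = 0 := by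
  obtain ⟨p, hp, hp'⟩ := exists_ne_zero_forall_eq_zero (by norm_num : 4 < 8) ![hyp h, hyp s, hyp x, hyp y]
  exact ⟨p, hp, hp' 0, hp' 1, hp' 2, hp' 3⟩

lemma hyp_combination (a b c e f : ℝ) {p : Fin 8 → ℝ} (H : IsPosFrame h s x y) (ph : hyp h p = 0)
    (ps : hyp s p = 0) (px : hyp x p = 0) (py : hyp y p = 0) :
    quad (a • h + b • s + c • x + e • y + f • p) = a ^ 2 * quad h + b ^ 2 * quad s +
      c ^ 2 * quad x + e ^ 2 * quad y + f ^ 2 * quad p := by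
  simp only [quad_add, quad_smul, map_add, map_smul, LinearMap.add_apply, LinearMap.smul_apply,
    H.hs, H.hx, H.hy, H.sx, H.sy, H.xy, ph, ps, px, py]
  simp

/-- The signature is (4,4). If q(p) ≥ 0, the form would be non-negative on the combinations of five
vectors, and some non-trivial combination lies in the four-dimensional negative definite space
x_{i+4} = -x_i. Its frame coefficients must vanish, and the vector itself is zero, which kills the
coefficient of p as well. -/
lemma quad_neg (H : IsPosFrame h s x y) {p : Fin 8 → ℝ} (hp : p ≠ 0) (ph : hyp h p = 0)
    (ps : hyp s p = 0) (px : hyp x p = 0) (py : hyp y p = 0) : quad p < 0 := by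
  by_contra! hq
  let L : (Fin 5 → ℝ) →ₗ[ℝ] (Fin 8 → ℝ) := Fintype.linearCombination ℝ ![h, s, x, y, p]
  obtain ⟨c, hc, hc'⟩ := exists_ne_zero_forall_eq_zero (by norm_num : 4 < 5)
    fun i : Fin 4 => ((LinearMap.proj (Fin.castAdd 4 i) : (Fin 8 → ℝ) →ₗ[ℝ] ℝ) +
      LinearMap.proj (Fin.natAdd 4 i)) ∘ₗ L
  set u := L c with hu
  have hL : u = c 0 • h + c 1 • s + c 2 • x + c 3 • y + c 4 • p := by
    simp [hu, L, Fintype.linearCombination_apply, Fin.sum_univ_five]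
  have hneg (i : Fin 4) : u (Fin.natAdd 4 i) = -u (Fin.castAdd 4 i) :=
    (eq_neg_of_add_eq_zero_right (hc' i))
  have hqu : quad u = -∑ i : Fin 4, u (Fin.castAdd 4 i) ^ 2 := by
    rw [quad, ← Finset.sum_neg_distrib]
    exact Finset.sum_congr rfl fun i _ => by rw [hneg]; ring
  have hqu' := hL ▸ H.hyp_combination (c 0) (c 1) (c 2) (c 3) (c 4) ph ps px py
  have hs1 : 0 ≤ ∑ i : Fin 4, u (Fin.castAdd 4 i) ^ 2 := Finset.sum_nonneg fun i _ => sq_nonneg _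
  have e0 := mul_nonneg (sq_nonneg (c 0)) H.h_pos.le
  have e1 := mul_nonneg (sq_nonneg (c 1)) H.s_pos.le
  have e2 := mul_nonneg (sq_nonneg (c 2)) H.x_pos.le
  have e3 := mul_nonneg (sq_nonneg (c 3)) H.y_pos.le
  have e4 := mul_nonneg (sq_nonneg (c 4)) hq
  have z {a b : ℝ} (hb : 0 < b) (hab : a ^ 2 * b = 0) : a = 0 := by
    simpa [hb.ne'] using hab
  have z0 := z H.h_pos (by linarith : c 0 ^ 2 * quad h = 0)
  have z1 := z H.s_pos (by linarith : c 1 ^ 2 * quad s = 0)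
  have z2 := z H.x_pos (by linarith : c 2 ^ 2 * quad x = 0)
  have z3 := z H.y_pos (by linarith : c 3 ^ 2 * quad y = 0)
  have hu0 : ∀ i : Fin 4, u (Fin.castAdd 4 i) = 0 := fun i => by
    have := (Finset.sum_eq_zero_iff_of_nonneg fun i _ => sq_nonneg (u (Fin.castAdd 4 i))).1
      (by linarith : ∑ i : Fin 4, u (Fin.castAdd 4 i) ^ 2 = 0) i (Finset.mem_univ i)
    simpa using this
  have hu00 : u = 0 := by
    funext i
    refine Fin.addCases (m := 4) (n := 4) (fun i => hu0 i) (fun i => ?_) i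
    rw [hneg, hu0, neg_zero]; rfl
  rw [z0, z1, z2, z3, hu00] at hL
  simp only [zero_smul, zero_add] at hL
  have z4 : c 4 = 0 := (smul_eq_zero.1 hL.symm).resolve_right hp
  exact hc (funext fun i => by fin_cases i <;> assumption)

/-- The action on `V` of the volume element of the span of the frame. -/
def vol (h s x y : Fin 8 → ℝ) : Matrix (Fin 8) (Fin 8) ℝ := twist s h * twist y x

lemma twist_comm_twist (H : IsPosFrame h s x y) :
    twist s h * twist y x = twist y x * twist s h :=
  twist_commute H.sy H.sx H.hy H.hx

lemma vol_mul_vol (H : IsPosFrame h s x y) :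
    vol h s x y * vol h s x y = (quad s * quad h * (quad y * quad x)) • 1 := by
  rw [vol, Matrix.mul_assoc, ← Matrix.mul_assoc (twist y x), ← H.twist_comm_twist,
    Matrix.mul_assoc, twist_mul_self (by rw [hyp_comm, H.xy]), ← Matrix.mul_assoc,
    twist_mul_self (by rw [hyp_comm, H.hs])]
  simp [smul_smul, mul_comm]

lemma hyp_vol_mulVec (H : IsPosFrame h s x y) (v w : Fin 8 → ℝ) :
    hyp (vol h s x y *ᵥ v) w = hyp v (vol h s x y *ᵥ w) := by
  rw [vol, ← Matrix.mulVec_mulVec, hyp_twist_mulVec_of_ortho (by rw [hyp_comm, H.hs]),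
    hyp_twist_mulVec_of_ortho (by rw [hyp_comm, H.xy]), neg_neg, H.twist_comm_twist,
    Matrix.mulVec_mulVec]

/-- The norm of the volume element. -/
def volNorm (h s x y : Fin 8 → ℝ) : ℝ := Real.sqrt (quad s * quad h * (quad y * quad x))

lemma volNorm_pos (H : IsPosFrame h s x y) : 0 < volNorm h s x y := by
  have := H.h_pos; have := H.s_pos; have := H.x_pos; have := H.y_pos
  rw [volNorm]; positivity

lemma volNorm_sq (H : IsPosFrame h s x y) :
    volNorm h s x y * volNorm h s x y = quad s * quad h * (quad y * quad x) := by
  have := H.h_pos; have := H.s_pos; have := H.x_pos; have := H.y_pos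
  rw [volNorm, Real.mul_self_sqrt (by positivity)]

/-- Since P² = r², the vectors ru ± Pu satisfy the eigenvalue equation for ±r, for any u in V. Their
values under q are 2r²q(u) ± r(u, Pu), which cannot both vanish when q(u) ≠ 0. -/
lemma exists_vol_eigenvector (H : IsPosFrame h s x y) : ∃ (v : Fin 8 → ℝ) (ε : ℝ),
    (ε = 1 ∨ ε = -1) ∧ quad v ≠ 0 ∧ vol h s x y *ᵥ v = (ε * volNorm h s x y) • v := by
  have hr := H.volNorm_pos
  have hPP (w : Fin 8 → ℝ) : vol h s x y *ᵥ (vol h s x y *ᵥ w) =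
      (volNorm h s x y * volNorm h s x y) • w := by
    rw [Matrix.mulVec_mulVec, H.vol_mul_vol, H.volNorm_sq, Matrix.smul_mulVec, Matrix.one_mulVec]
  set r := volNorm h s x y
  set P := vol h s x y
  -- The spinor `h` is reused here as a vector of V. The coordinate spaces and forms coincide, and
  -- only q(h) ≠ 0 matters.
  have e (ε : ℝ) (hε : ε * ε = 1) :
      P *ᵥ (r • h + ε • P *ᵥ h) = (ε * r) • (r • h + ε • P *ᵥ h) := by
    rw [Matrix.mulVec_add, Matrix.mulVec_smul, Matrix.mulVec_smul, hPP, smul_add, smul_smul,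
      smul_smul, smul_smul, add_comm]
    congr 2
    · ring
    · linear_combination (-r) * hε
  have hq (ε : ℝ) (hε : ε * ε = 1) :
      quad (r • h + ε • P *ᵥ h) = 2 * r * r * quad h + ε * r * hyp h (P *ᵥ h) := by
    have hP : quad (P *ᵥ h) = r * r * quad h := by
      have := hyp_self (P *ᵥ h)
      rw [H.hyp_vol_mulVec, hPP, map_smul, hyp_self, smul_eq_mul] at this
      linarith
    rw [quad_add, quad_smul, quad_smul, hP]
    simp only [map_smul, LinearMap.smul_apply, smul_eq_mul]
    linear_combination (r * r * quad h) * hε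
  have hpos := H.h_pos
  by_cases h1 : quad (r • h + (1 : ℝ) • P *ᵥ h) = 0
  · refine ⟨_, -1, Or.inr rfl, ?_, e (-1) (by norm_num)⟩
    rw [hq _ (by norm_num)] at h1 ⊢
    intro h2
    have : 0 < r * r * quad h := by positivity
    linarith
  · exact ⟨_, 1, Or.inl rfl, h1, e 1 (by norm_num)⟩

/-- In the Clifford algebra the volume element of a 4-plane anticommutes with vectors of the plane
and commutes with vectors orthogonal to it; the product hp has one factor of each kind. -/
lemma vol_mul_twist_of_ortho (H : IsPosFrame h s x y) {p : Fin 8 → ℝ} (ph : hyp h p = 0)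
    (ps : hyp s p = 0) (px : hyp x p = 0) (py : hyp y p = 0) :
    vol h s x y * twist h p = -(twist h p * vol h s x y) := by
  rw [vol, Matrix.mul_assoc, twist_commute (a := y) (by rw [hyp_comm, H.hy]) py
    (by rw [hyp_comm, H.hx]) px, ← Matrix.mul_assoc, ← Matrix.mul_assoc,
    twist_anticommute ph H.hs (by rw [hyp_comm, ps])]
  rw [Matrix.neg_mul, neg_neg]

/-- Both factors of the product now lie in the 4-plane and anticommute with its volume element, so
the signs cancel. -/
lemma vol_mul_twist_frame (H : IsPosFrame h s x y) (a b c e : ℝ) :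
    vol h s x y * twist h (a • h + b • s + c • x + e • y) =
      twist h (a • h + b • s + c • x + e • y) * vol h s x y := by
  have hs := twist_swap H.hs
  have hy := twist_swap H.hy
  have hsh := H.hs ▸ hyp_comm s h
  have hyx := H.xy ▸ hyp_comm y x
  have hyh := H.hy ▸ hyp_comm y h
  have hxs := H.sx ▸ hyp_comm x s
  have hys := H.sy ▸ hyp_comm y s
  have e2 : vol h s x y * twist h s = twist h s * vol h s x y := by
    rw [vol, hs, Matrix.mul_neg, Matrix.neg_mul, Matrix.mul_assoc, ← H.twist_comm_twist]
  have hxh := H.hx ▸ hyp_comm x h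
  have hsx : twist s h * twist h x = -(twist h x * twist s h) := by
    rw [twist_anticommute H.hx H.hs hxs, neg_neg]
  have hsy : twist s h * twist h y = -(twist h y * twist s h) := by
    rw [twist_anticommute H.hy H.hs hys, neg_neg]
  have e3 : vol h s x y * twist h x = twist h x * vol h s x y := by
    rw [vol, Matrix.mul_assoc, twist_anticommute_right H.hy H.hx hyx, Matrix.mul_neg,
      ← Matrix.mul_assoc, ← Matrix.mul_assoc, hsx, Matrix.neg_mul, neg_neg]
  have e4 : vol h s x y * twist h y = twist h y * vol h s x y := by
    rw [vol, Matrix.mul_assoc, twist_anticommute hyx hyh hxh, Matrix.mul_neg,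
      ← Matrix.mul_assoc, ← Matrix.mul_assoc, hsy, Matrix.neg_mul, neg_neg]
  simp only [twist_add, twist_smul, Matrix.mul_add, Matrix.add_mul, Matrix.mul_smul,
    Matrix.smul_mul, e2, e3, e4, twist_self, Matrix.mul_one, Matrix.one_mul]

/-- The quadratic form `(P v, v)`, where `P` is the volume element of the frame, is definite. -/
lemma vol_definite (H : IsPosFrame h s x y) : ∃ ε : ℝ, (ε = 1 ∨ ε = -1) ∧
    ∀ v : Fin 8 → ℝ, v ≠ 0 → 0 < ε * hyp (vol h s x y *ᵥ v) v := by
  obtain ⟨v₀, ε, hε, hv₀, hP⟩ := H.exists_vol_eigenvector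
  have hr := H.volNorm_pos
  -- Write v = `twist h p` v₀ and p = p₁ + p' along the 4-plane and its complement. P acts by the
  -- sign of v₀ on the p₁-part and by the opposite sign on the p'-part, so (Pv, v) is ε q(v₀) times
  -- a positive multiple of q(p₁) - q(p'), and q(p') ≤ 0.
  have key (v : Fin 8 → ℝ) (hv : v ≠ 0) : ∃ t : ℝ, 0 < t ∧
      hyp (vol h s x y *ᵥ v) v = ε * quad v₀ * t := by
    obtain ⟨p, rfl⟩ := exists_twist_mulVec_eq H.h_pos.ne' hv₀ v
    have hp0 : p ≠ 0 := by
      rintro rfl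
      exact hv (by rw [twist_zero, Matrix.zero_mulVec])
    obtain ⟨a, b, c, e, p', hp, ph, ps, px, py⟩ : ∃ (a b c e : ℝ) (p' : Fin 8 → ℝ),
        p = a • h + b • s + c • x + e • y + p' ∧ hyp h p' = 0 ∧ hyp s p' = 0 ∧ hyp x p' = 0 ∧
          hyp y p' = 0 := by
      have h1 := H.h_pos.ne'; have h2 := H.s_pos.ne'; have h3 := H.x_pos.ne'; have h4 := H.y_pos.ne'
      refine ⟨hyp h p / (2 * quad h), hyp s p / (2 * quad s), hyp x p / (2 * quad x),
        hyp y p / (2 * quad y), _, (add_sub_cancel _ _).symm, ?_, ?_, ?_, ?_⟩ <;>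
      simp only [map_sub, map_add, map_smul, hyp_self, H.hs, H.hx, H.hy, H.sx, H.sy, H.xy,
        H.hs ▸ hyp_comm s h, H.hx ▸ hyp_comm x h, H.hy ▸ hyp_comm y h, H.sx ▸ hyp_comm x s,
        H.sy ▸ hyp_comm y s, H.xy ▸ hyp_comm y x, smul_eq_mul] <;> field_simp <;> ring
    set p₁ := a • h + b • s + c • x + e • y with hp₁
    have hq₁ : quad p₁ = a ^ 2 * quad h + b ^ 2 * quad s + c ^ 2 * quad x + e ^ 2 * quad y := by
      have := H.hyp_combination a b c e 0 ph ps px py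
      simpa using this
    have hpp : hyp p₁ p' = 0 := by
      simp [hp₁, ph, ps, px, py]
    have e1 := H.vol_mul_twist_frame a b c e
    rw [← hp₁] at e1
    have e2 := H.vol_mul_twist_of_ortho ph ps px py
    have f1 : vol h s x y *ᵥ (twist h p *ᵥ v₀) =
        (ε * volNorm h s x y) • (twist h p₁ *ᵥ v₀ - twist h p' *ᵥ v₀) := by
      rw [hp, Matrix.mulVec_mulVec, twist_add, Matrix.mul_add, e1, e2, Matrix.add_mulVec,
        Matrix.neg_mulVec, ← Matrix.mulVec_mulVec, ← Matrix.mulVec_mulVec, hP, Matrix.mulVec_smul,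
        Matrix.mulVec_smul, smul_sub, sub_eq_add_neg]
    have f2 : hyp (twist h p₁ *ᵥ v₀ - twist h p' *ᵥ v₀) (twist h p *ᵥ v₀) =
        quad h * quad v₀ * (2 * (quad p₁ - quad p')) := by
      rw [map_sub, LinearMap.sub_apply, hyp_twist_twist, hyp_twist_twist, hp,
        map_add (hyp p₁), map_add (hyp p'), hyp_self, hyp_self, hpp, hyp_comm p', hpp]
      ring
    refine ⟨volNorm h s x y * quad h * (2 * (quad p₁ - quad p')), ?_, ?_⟩
    · have hh := H.h_pos
      have e0 := mul_nonneg (sq_nonneg a) H.h_pos.le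
      have e1 := mul_nonneg (sq_nonneg b) H.s_pos.le
      have e2 := mul_nonneg (sq_nonneg c) H.x_pos.le
      have e3 := mul_nonneg (sq_nonneg e) H.y_pos.le
      suffices 0 < quad p₁ - quad p' by positivity
      by_cases hp' : p' = 0
      · have hz : quad (0 : Fin 8 → ℝ) = 0 := by simp [quad]
        rw [hp', hz]
        by_contra hneg
        have z {a b : ℝ} (hb : 0 < b) (hab : a ^ 2 * b = 0) : a = 0 := by
          simpa [hb.ne'] using hab
        have z0 := z H.h_pos (by linarith : a ^ 2 * quad h = 0)
        have z1 := z H.s_pos (by linarith : b ^ 2 * quad s = 0)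
        have z2 := z H.x_pos (by linarith : c ^ 2 * quad x = 0)
        have z3 := z H.y_pos (by linarith : e ^ 2 * quad y = 0)
        exact hp0 (by rw [hp, hp', hp₁, z0, z1, z2, z3]; simp)
      · have := H.quad_neg hp' ph ps px py
        linarith
    · rw [f1, map_smul, LinearMap.smul_apply, f2, smul_eq_mul]
      ring
  rcases lt_or_gt_of_ne (show ε * quad v₀ ≠ 0 by rcases hε with rfl | rfl <;> simpa using hv₀)
    with hlt | hgt
  · refine ⟨-1, Or.inr rfl, fun v hv => ?_⟩
    obtain ⟨t, ht, e⟩ := key v hv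
    rw [e]
    nlinarith
  · refine ⟨1, Or.inl rfl, fun v hv => ?_⟩
    obtain ⟨t, ht, e⟩ := key v hv
    rw [e, one_mul]
    positivity

end IsPosFrame


/-! ### The action of K on V -/

section Action

variable {h s : Fin 8 → ℤ}

/-- The images in `R` of the coordinates of an integral vector. -/
def castVec (R : Type*) [Ring R] (h : Fin 8 → ℤ) : Fin 8 → R := fun i => (h i : R)

/-- `√(-d)` as an endomorphism of `V`. -/
def sqrtMat {R : Type*} [CommRing R] (h s : Fin 8 → R) : Matrix (Fin 8) (Fin 8) R :=
  (2 : R) • twist s h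

lemma sqrtMat_map {R S : Type*} [CommRing R] [CommRing S] (f : R →+* S) (h s : Fin 8 → R) :
    sqrtMat (fun i => f (h i)) (fun i => f (s i)) = (sqrtMat h s).map f := by
  rw [sqrtMat, twist_map, sqrtMat]
  ext i j
  simp [map_ofNat]

/-- The factor 2 in `sqrtMat` turns -q(s)q(h) into -(h,h)(s,s) = -d and keeps the matrix integral.
-/
lemma sqrtMat_mul_self {R : Type*} [CommRing R] {h s : Fin 8 → R} (hs : hyp h s = 0) :
    sqrtMat h s * sqrtMat h s = (-(hyp h h * hyp s s)) • 1 := by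
  rw [sqrtMat, Matrix.smul_mul, Matrix.mul_smul, twist_mul_self (by rw [hyp_comm, hs]), smul_smul,
    smul_smul, hyp_self, hyp_self]
  congr 1; ring

lemma hyp_sqrtMat {R : Type*} [CommRing R] {h s : Fin 8 → R} (hs : hyp h s = 0)
    (v w : Fin 8 → R) : hyp (sqrtMat h s *ᵥ v) w = -hyp v (sqrtMat h s *ᵥ w) := by
  rw [sqrtMat, Matrix.smul_mulVec, Matrix.smul_mulVec, map_smul, map_smul, LinearMap.smul_apply,
    hyp_twist_mulVec_of_ortho (by rw [hyp_comm, hs]), smul_neg]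

lemma hyp_castVec {R : Type*} [CommRing R] (x y : Fin 8 → ℤ) :
    hyp (castVec R x) (castVec R y) = (hyp x y : ℤ) :=
  hyp_map (Int.castRingHom R) x y

/-- `h`, `s` are orthogonal vectors of positive norm in `S^+`. -/
structure IsPosPair (h s : Fin 8 → ℤ) : Prop where
  ortho : hyp h s = 0
  h_pos : 0 < hyp h h
  s_pos : 0 < hyp s s

namespace IsPosPair

lemma dd_pos (P : IsPosPair h s) : 0 < dd h s := mul_pos P.h_pos P.s_pos

lemma ortho_cast (P : IsPosPair h s) (R : Type*) [CommRing R] : hyp (castVec R h) (castVec R s) = 0 := by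
  rw [hyp_castVec, P.ortho, Int.cast_zero]

lemma sqrtMat_sq (P : IsPosPair h s) (R : Type*) [CommRing R] :
    sqrtMat (castVec R h) (castVec R s) * sqrtMat (castVec R h) (castVec R s) =
      (-(dd h s : R)) • 1 := by
  rw [sqrtMat_mul_self (P.ortho_cast R), hyp_castVec, hyp_castVec, dd, Int.cast_mul]

/-- The action of `K` on `V_ℚ`. -/
def action (P : IsPosPair h s) : imQuad (dd h s) →ₐ[ℚ] Matrix (Fin 8) (Fin 8) ℚ :=
  imQuadLift P.dd_pos (sqrtMat (castVec ℚ h) (castVec ℚ s)) (by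
    rw [P.sqrtMat_sq, neg_smul, Int.cast_smul_eq_zsmul, zsmul_one])

lemma action_sqrtNegK (P : IsPosPair h s) : P.action (sqrtNegK (dd h s)) = sqrtMat (castVec ℚ h) (castVec ℚ s) :=
  imQuadLift_sqrtNegK _ _ _

lemma action_map (P : IsPosPair h s) {S : Type*} [Field S] [Algebra ℚ S] (a b : ℚ) :
    (P.action (algebraMap ℚ _ a + algebraMap ℚ _ b * sqrtNegK (dd h s))).map (algebraMap ℚ S) =
      (algebraMap ℚ S a) • (1 : Matrix (Fin 8) (Fin 8) S) +
        (algebraMap ℚ S b) • sqrtMat (castVec S h) (castVec S s) := by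
  have : sqrtMat (castVec S h) (castVec S s) =
      (sqrtMat (castVec ℚ h) (castVec ℚ s)).map (algebraMap ℚ S) := by
    rw [← sqrtMat_map]
    congr 1 <;> (funext i; simp [castVec])
  rw [this, map_add, map_mul, AlgHom.commutes, AlgHom.commutes, action_sqrtNegK, Algebra.algebraMap_eq_smul_one,
    Algebra.algebraMap_eq_smul_one]
  ext i j
  by_cases hij : i = j <;> simp [-eq_ratCast, -algebraMap_smul, hij]

lemma action_sqrtNegK_map (P : IsPosPair h s) {S : Type*} [Field S] [Algebra ℚ S] :
    (P.action (sqrtNegK (dd h s))).map (algebraMap ℚ S) = sqrtMat (castVec S h) (castVec S s) := by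
  simpa using P.action_map (S := S) 0 1

lemma kappa_eq (h s : Fin 8 → ℤ) : kappa h s =
    sqrtNeg (dd h s) • castVec ℂ h + ((hyp h h : ℤ) : ℂ) • castVec ℂ s := rfl

lemma kappaBar_eq (h s : Fin 8 → ℤ) : kappaBar h s =
    (-sqrtNeg (dd h s)) • castVec ℂ h + ((hyp h h : ℤ) : ℂ) • castVec ℂ s := rfl

/-- Applying 2 `cliffAdj s` to the equation that defines the annihilator gives δNv + dv = 0, that is
δNv = δ²v. Both roots δ are allowed, so κ and κ̄ are treated together. -/
lemma sqrtMat_mulVec_of_mem (P : IsPosPair h s) {δ : ℂ} (hδ : δ * δ = -(dd h s : ℂ))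
    {v : Fin 8 → ℂ}
    (hv : v ∈ annihilator (δ • castVec ℂ h + ((hyp h h : ℤ) : ℂ) • castVec ℂ s)) :
    sqrtMat (castVec ℂ h) (castVec ℂ s) *ᵥ v = δ • v := by
  have hd : (dd h s : ℂ) ≠ 0 := by exact_mod_cast P.dd_pos.ne'
  have hδ0 : δ ≠ 0 := by rintro rfl; simp [hd] at hδ
  rw [mem_annihilator, cliffMat_add, cliffMat_smul, cliffMat_smul, Matrix.add_mulVec,
    Matrix.smul_mulVec, Matrix.smul_mulVec] at hv
  have h1 := congrArg (fun u => (2 : ℂ) • (cliffAdj (castVec ℂ s) *ᵥ u)) hv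
  simp only [Matrix.mulVec_add, Matrix.mulVec_smul, Matrix.mulVec_mulVec, cliffAdj_mul_cliffMat,
    Matrix.smul_mulVec, Matrix.one_mulVec, Matrix.mulVec_zero, smul_zero, smul_add] at h1
  have h2 : (2 : ℂ) • ((hyp h h : ℤ) : ℂ) • quad (castVec ℂ s) • v = (dd h s : ℂ) • v := by
    have := hyp_self (castVec ℂ s)
    rw [hyp_castVec] at this
    rw [smul_smul, smul_smul, dd, Int.cast_mul, this]
    congr 1; ring
  have h3 : δ • (sqrtMat (castVec ℂ h) (castVec ℂ s) *ᵥ v) = δ • δ • v := by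
    rw [smul_smul, hδ, neg_smul, ← h2, sqrtMat, Matrix.smul_mulVec, twist, smul_comm δ]
    exact eq_neg_of_add_eq_zero_left h1
  exact smul_right_injective _ hδ0 h3

end IsPosPair

/-- The annihilators of two isotropic even spinors which are not orthogonal are complementary. -/
lemma isCompl_annihilator {F : Type*} [Field F] {z w : Fin 8 → F} (hz : quad z = 0)
    (hw : quad w = 0) (hzw : hyp z w ≠ 0) : IsCompl (annihilator z) (annihilator w) := by
  -- For isotropic z the image of `cliffAdj z` lies in its annihilator, so this relation displays
  -- both components of v.
  have key (v : Fin 8 → F) : cliffAdj z *ᵥ (cliffMat w *ᵥ v) + cliffAdj w *ᵥ (cliffMat z *ᵥ v) =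
      hyp z w • v := by
    rw [Matrix.mulVec_mulVec, Matrix.mulVec_mulVec, ← Matrix.add_mulVec, cliffAdj_mul_cliffMat_add,
      Matrix.smul_mulVec, Matrix.one_mulVec]
  have hmem {a : Fin 8 → F} (ha : quad a = 0) (u : Fin 8 → F) : cliffAdj a *ᵥ u ∈ annihilator a := by
    rw [mem_annihilator, Matrix.mulVec_mulVec, cliffMat_mul_cliffAdj, ha, zero_smul,
      Matrix.zero_mulVec]
  refine ⟨Submodule.disjoint_def.2 fun v h1 h2 => ?_, Submodule.codisjoint_iff_exists_add_eq.2 fun v => ?_⟩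
  · have := key v
    rw [mem_annihilator.1 h1, mem_annihilator.1 h2, Matrix.mulVec_zero, Matrix.mulVec_zero,
      add_zero] at this
    exact (smul_eq_zero.1 this.symm).resolve_left hzw
  · refine ⟨_, _, Submodule.smul_mem _ (hyp z w)⁻¹ (hmem hz (cliffMat w *ᵥ v)),
      Submodule.smul_mem _ (hyp z w)⁻¹ (hmem hw (cliffMat z *ᵥ v)), ?_⟩
    rw [← smul_add, key, inv_smul_smul₀ hzw]

namespace IsPosPair

lemma hyp_kappa_kappa (P : IsPosPair h s) (α β : ℂ) :
    hyp (α • castVec ℂ h + ((hyp h h : ℤ) : ℂ) • castVec ℂ s)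
      (β • castVec ℂ h + ((hyp h h : ℤ) : ℂ) • castVec ℂ s) =
      (α * β + dd h s) * ((hyp h h : ℤ) : ℂ) := by
  simp only [map_add, map_smul, LinearMap.add_apply, LinearMap.smul_apply, hyp_castVec, P.ortho,
    hyp_comm (castVec ℂ s) (castVec ℂ h), smul_eq_mul, dd]
  push_cast
  ring

lemma quad_kappa (P : IsPosPair h s) : quad (kappa h s) = 0 := by
  have := hyp_self (kappa h s)
  rw [kappa_eq, P.hyp_kappa_kappa, sqrtNeg_mul_self P.dd_pos] at this
  rw [kappa_eq]
  linear_combination -this / 2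

lemma quad_kappaBar (P : IsPosPair h s) : quad (kappaBar h s) = 0 := by
  have := hyp_self (kappaBar h s)
  rw [kappaBar_eq, P.hyp_kappa_kappa, neg_mul_neg, sqrtNeg_mul_self P.dd_pos] at this
  rw [kappaBar_eq]
  linear_combination -this / 2

lemma hyp_kappa_kappaBar (P : IsPosPair h s) :
    hyp (kappa h s) (kappaBar h s) = ((2 * dd h s * hyp h h : ℤ) : ℂ) := by
  rw [kappa_eq, kappaBar_eq, P.hyp_kappa_kappa, mul_neg, sqrtNeg_mul_self P.dd_pos]
  push_cast
  ring

lemma isCompl (P : IsPosPair h s) :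
    IsCompl (annihilator (kappa h s)) (annihilator (kappaBar h s)) := by
  refine isCompl_annihilator P.quad_kappa P.quad_kappaBar ?_
  rw [P.hyp_kappa_kappaBar, Int.cast_ne_zero]
  have := P.dd_pos
  have := P.h_pos
  positivity

lemma isKAction (P : IsPosPair h s) : IsKAction h s P.action where
  isCompl := P.isCompl
  on_kappa x v hv := by
    obtain ⟨a, b, rfl⟩ := exists_eq_add_mul_sqrtNegK P.dd_pos x
    rw [P.action_map, Matrix.add_mulVec, Matrix.smul_mulVec, Matrix.smul_mulVec, Matrix.one_mulVec,
      P.sqrtMat_mulVec_of_mem (sqrtNeg_mul_self P.dd_pos) hv, smul_smul, ← add_smul]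
    rfl
  on_kappaBar x v hv := by
    obtain ⟨a, b, rfl⟩ := exists_eq_add_mul_sqrtNegK P.dd_pos x
    rw [P.action_map, Matrix.add_mulVec, Matrix.smul_mulVec, Matrix.smul_mulVec, Matrix.one_mulVec,
      P.sqrtMat_mulVec_of_mem (by rw [neg_mul_neg, sqrtNeg_mul_self P.dd_pos]) hv, smul_smul,
      ← add_smul]
    congr 1
    simp [sqrtNegK, conj_sqrtNeg]

end IsPosPair

end Action


/-! ### Complex structures, polarizations and Weil type -/

/-- The alternating form `(N v, w)` defined by an endomorphism `N` that is skew for `hyp`. -/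
def skewForm (N : Matrix (Fin 8) (Fin 8) ℝ) (hN : ∀ v, hyp (N *ᵥ v) v = 0) : Coh (Fin 8) 2 where
  toFun m := hyp (N *ᵥ m 0) (m 1)
  map_update_add' m i a b := by
    fin_cases i <;> simp [Function.update, Matrix.mulVec_add]
  map_update_smul' m i c a := by
    fin_cases i <;> simp [Function.update, Matrix.mulVec_smul]
  map_eq_zero_of_eq' m i j hij hne := by
    have : m 0 = m 1 := by
      fin_cases i <;> fin_cases j <;> simp_all
    rw [this, hN]

namespace IsPosFrame

variable {h s x y : Fin 8 → ℝ}

/-- The complex structure on `V ⊗ ℝ` for which `Z_{x + i y}` is the eigenspace of `-i`. -/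
def complexStructure (x y : Fin 8 → ℝ) : Matrix (Fin 8) (Fin 8) ℝ := (quad y)⁻¹ • twist y x

lemma complexStructure_mul_self (H : IsPosFrame h s x y) (hxy : quad x = quad y) :
    complexStructure x y * complexStructure x y = -1 := by
  have := H.y_pos.ne'
  rw [complexStructure, Matrix.smul_mul, Matrix.mul_smul, twist_mul_self (by rw [hyp_comm, H.xy]),
    hxy, smul_smul, smul_smul]
  have : (quad y)⁻¹ * (quad y)⁻¹ * -(quad y * quad y) = -1 := by field_simp
  rw [this, neg_smul, one_smul]

/-- The torus defined by a positive frame. -/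
def torus (H : IsPosFrame h s x y) (hxy : quad x = quad y) : ComplexTorus (Fin 8) :=
  ⟨complexStructure x y, H.complexStructure_mul_self hxy⟩

lemma hyp_complexStructure (H : IsPosFrame h s x y) (v w : Fin 8 → ℝ) :
    hyp (complexStructure x y *ᵥ v) w = -hyp v (complexStructure x y *ᵥ w) := by
  rw [complexStructure, Matrix.smul_mulVec, Matrix.smul_mulVec, map_smul, map_smul,
    LinearMap.smul_apply, hyp_twist_mulVec_of_ortho (by rw [hyp_comm, H.xy]), smul_neg]

lemma sqrtMat_comm_complexStructure (H : IsPosFrame h s x y) :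
    sqrtMat h s * complexStructure x y = complexStructure x y * sqrtMat h s := by
  simp only [complexStructure, sqrtMat, Matrix.smul_mul, Matrix.mul_smul, H.twist_comm_twist]
  rw [smul_comm]

/-- Through this identity E(Jv, v) becomes a multiple of (Pv, v), with P the volume element. -/
lemma sqrtMat_mul_complexStructure (h s x y : Fin 8 → ℝ) :
    sqrtMat h s * complexStructure x y = (2 * (quad y)⁻¹) • vol h s x y := by
  simp only [complexStructure, sqrtMat, Matrix.smul_mul, Matrix.mul_smul, smul_smul, vol]
  rw [mul_comm]

lemma polarization_definite (H : IsPosFrame h s x y) : ∃ ε : ℝ, (ε = 1 ∨ ε = -1) ∧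
    ∀ v : Fin 8 → ℝ, v ≠ 0 → 0 < ε * hyp (sqrtMat h s *ᵥ (complexStructure x y *ᵥ v)) v := by
  obtain ⟨ε, hε, hpos⟩ := H.vol_definite
  refine ⟨ε, hε, fun v hv => ?_⟩
  have := hpos v hv
  have := H.y_pos
  rw [Matrix.mulVec_mulVec, sqrtMat_mul_complexStructure, Matrix.smul_mulVec, map_smul,
    LinearMap.smul_apply, smul_eq_mul, mul_left_comm]
  positivity

end IsPosFrame

/-- If an invertible matrix conjugates `A` to `B` up to sign, the kernels have equal dimension. -/
lemma finrank_ker_le_of_mul_eq {n : Type*} [Fintype n] [DecidableEq n] {F : Type*} [Field F]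
    {A B S S' : Matrix n n F} (hS : S' * S = 1) (hAB : B * S = -(S * A)) :
    Module.finrank F (LinearMap.ker A.toLin') ≤ Module.finrank F (LinearMap.ker B.toLin') := by
  have hmaps : ∀ v ∈ LinearMap.ker A.toLin', S.toLin' v ∈ LinearMap.ker B.toLin' := fun v hv => by
    rw [LinearMap.mem_ker, Matrix.toLin'_apply] at hv ⊢
    rw [Matrix.toLin'_apply, Matrix.mulVec_mulVec, hAB, Matrix.neg_mulVec, ← Matrix.mulVec_mulVec,
      hv, Matrix.mulVec_zero, neg_zero]
  refine LinearMap.finrank_le_finrank_of_injective (f := S.toLin'.restrict hmaps) fun v w hvw => ?_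
  have h1 : S *ᵥ v = S *ᵥ w := congrArg Subtype.val hvw
  have h2 := congrArg (S' *ᵥ ·) h1
  simp only [Matrix.mulVec_mulVec, hS, Matrix.one_mulVec] at h2
  exact Subtype.ext h2

namespace IsPosFrame

variable {h s x y : Fin 8 → ℝ}

/-- A non-zero p orthogonal to the frame has q(p) < 0, so `twist h p` is invertible. It shares h
with √(-d) and anticommutes with it, but commutes with J; hence it exchanges the two kernels. -/
lemma finrank_ker_eq (H : IsPosFrame h s x y) (c : ℝ) :
    Module.finrank ℝ (LinearMap.ker (sqrtMat h s - c • complexStructure x y).toLin') =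
      Module.finrank ℝ (LinearMap.ker (sqrtMat h s + c • complexStructure x y).toLin') := by
  obtain ⟨p, hp, ph, ps, px, py⟩ := exists_ortho h s x y
  have hq := (H.quad_neg hp ph ps px py).ne
  have hS : (-(quad h * quad p)⁻¹ • twist h p) * twist h p = 1 := by
    have := H.h_pos.ne'
    rw [Matrix.smul_mul, twist_mul_self ph, smul_smul, neg_mul_neg, inv_mul_cancel₀ (by positivity), one_smul]
  have h1 : sqrtMat h s * twist h p = -(twist h p * sqrtMat h s) := by
    rw [sqrtMat, Matrix.smul_mul, Matrix.mul_smul, twist_anticommute ph H.hs (by rw [hyp_comm, ps]),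
      smul_neg, neg_neg]
  have h2 : complexStructure x y * twist h p = twist h p * complexStructure x y := by
    rw [complexStructure, Matrix.smul_mul, Matrix.mul_smul,
      twist_commute (by rw [hyp_comm, H.hy]) py (by rw [hyp_comm, H.hx]) px]
  refine le_antisymm (finrank_ker_le_of_mul_eq hS ?_) (finrank_ker_le_of_mul_eq hS ?_)
  · rw [Matrix.add_mul, Matrix.mul_sub, h1, Matrix.smul_mul, Matrix.mul_smul, h2]; abel
  · rw [Matrix.sub_mul, Matrix.mul_add, h1, Matrix.smul_mul, Matrix.mul_smul, h2]; abel

end IsPosFrame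

namespace IsPosPair

variable {h s : Fin 8 → ℤ}

lemma hyp_sqrtMat_self (P : IsPosPair h s) (v : Fin 8 → ℝ) :
    hyp (sqrtMat (castVec ℝ h) (castVec ℝ s) *ᵥ v) v = 0 := by
  have := hyp_sqrtMat (P.ortho_cast ℝ) v v
  rw [hyp_comm v] at this
  linarith

/-- The form `E(v, w) = (√(-d) v, w)`. -/
def form (P : IsPosPair h s) : Coh (Fin 8) 2 :=
  skewForm (sqrtMat (castVec ℝ h) (castVec ℝ s)) P.hyp_sqrtMat_self

lemma form_apply (P : IsPosPair h s) (m : Fin 2 → Fin 8 → ℝ) :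
    P.form m = hyp (sqrtMat (castVec ℝ h) (castVec ℝ s) *ᵥ m 0) (m 1) := rfl

lemma isIntegralClass_form (P : IsPosPair h s) : IsIntegralClass P.form := fun v => by
  refine ⟨hyp (sqrtMat h s *ᵥ v 0) (v 1), ?_⟩
  have h1 : sqrtMat (castVec ℝ h) (castVec ℝ s) = (sqrtMat h s).map (Int.castRingHom ℝ) :=
    sqrtMat_map (Int.castRingHom ℝ) h s
  have h2 : (sqrtMat h s).map (Int.castRingHom ℝ) *ᵥ (fun i => (v 0 i : ℝ)) =
      fun i => Int.castRingHom ℝ ((sqrtMat h s *ᵥ v 0) i) := by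
    funext i
    exact (RingHom.map_mulVec (Int.castRingHom ℝ) (sqrtMat h s) (v 0) i).symm
  rw [form_apply, h1, h2]
  exact hyp_map (Int.castRingHom ℝ) _ _

lemma form_middleType (P : IsPosPair h s) {T : ComplexTorus (Fin 8)}
    (hcomm : sqrtMat (castVec ℝ h) (castVec ℝ s) * T.J = T.J * sqrtMat (castVec ℝ h) (castVec ℝ s))
    (hskew : ∀ v w, hyp (T.J *ᵥ v) w = -hyp v (T.J *ᵥ w)) : T.IsMiddleType P.form := by
  intro a b hab v
  have hJJ (w : Fin 8 → ℝ) : T.J *ᵥ (T.J *ᵥ w) = -w := by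
    rw [Matrix.mulVec_mulVec, T.J_mul_J, Matrix.neg_mulVec, Matrix.one_mulVec]
  set N := sqrtMat (castVec ℝ h) (castVec ℝ s) with hN
  have hNJ : N *ᵥ (T.J *ᵥ v 0) = T.J *ᵥ (N *ᵥ v 0) := by
    rw [Matrix.mulVec_mulVec, hcomm, Matrix.mulVec_mulVec]
  simp only [form_apply, ← hN, Matrix.mulVec_add, Matrix.mulVec_smul, map_add, map_smul,
    LinearMap.add_apply, LinearMap.smul_apply, smul_eq_mul]
  rw [hNJ, hskew, hskew, hJJ, map_neg]
  linear_combination (hyp (N *ᵥ v 0) (v 1)) * hab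

lemma action_mem_endQ (P : IsPosPair h s) {T : ComplexTorus (Fin 8)}
    (hcomm : sqrtMat (castVec ℝ h) (castVec ℝ s) * T.J = T.J * sqrtMat (castVec ℝ h) (castVec ℝ s))
    (x : imQuad (dd h s)) : P.action x ∈ T.endQ := by
  obtain ⟨a, b, rfl⟩ := exists_eq_add_mul_sqrtNegK P.dd_pos x
  change _ * _ = _ * _
  rw [P.action_map, Matrix.add_mul, Matrix.mul_add, Matrix.smul_mul, Matrix.smul_mul,
    Matrix.mul_smul, Matrix.mul_smul, hcomm, Matrix.one_mul, Matrix.mul_one]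

lemma coe_add_mul_sqrtNegK (d : ℤ) (a b : ℚ) :
    ((algebraMap ℚ (imQuad d) a + algebraMap ℚ (imQuad d) b * sqrtNegK d : imQuad d) : ℂ) =
      a + b * sqrtNeg d := rfl

/-- N is skew with N² = -d. The cross terms for a + bN cancel, which leaves the multiplier a² + b²d.
-/
lemma form_action (P : IsPosPair h s) (x : imQuad (dd h s)) (v w : Fin 8 → ℝ) :
    P.form ![(P.action x).map (algebraMap ℚ ℝ) *ᵥ v, (P.action x).map (algebraMap ℚ ℝ) *ᵥ w] =
      Complex.normSq (x : ℂ) * P.form ![v, w] := by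
  obtain ⟨a, b, rfl⟩ := exists_eq_add_mul_sqrtNegK P.dd_pos x
  have hn : Complex.normSq (a + b * sqrtNeg (dd h s) : ℂ) = (a : ℝ) ^ 2 + (b : ℝ) ^ 2 * dd h s := by
    have hd : Real.sqrt (dd h s) * Real.sqrt (dd h s) = dd h s :=
      Real.mul_self_sqrt (by exact_mod_cast P.dd_pos.le)
    rw [Complex.normSq_apply]
    simp [sqrtNeg_re, sqrtNeg_im]
    linear_combination (b : ℝ) ^ 2 * hd
  rw [P.action_map, coe_add_mul_sqrtNegK, hn]
  set N := sqrtMat (castVec ℝ h) (castVec ℝ s) with hN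
  have hNN (w : Fin 8 → ℝ) : N *ᵥ (N *ᵥ w) = (-(dd h s : ℝ)) • w := by
    rw [Matrix.mulVec_mulVec, P.sqrtMat_sq, Matrix.smul_mulVec, Matrix.one_mulVec]
  have e1 := hyp_sqrtMat (P.ortho_cast ℝ) (N *ᵥ v) w
  rw [← hN, hNN, map_smul, LinearMap.smul_apply, smul_eq_mul] at e1
  simp only [form_apply, Matrix.cons_val_zero, Matrix.cons_val_one, ← hN, Matrix.add_mulVec,
    Matrix.smul_mulVec, Matrix.one_mulVec, Matrix.mulVec_add, Matrix.mulVec_smul, map_add, map_smul,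
    LinearMap.add_apply, LinearMap.smul_apply, smul_eq_mul, hNN, eq_ratCast]
  have e2 := hyp_sqrtMat (P.ortho_cast ℝ) v w
  rw [← hN] at e2
  linear_combination ((a : ℝ) * b) * e1 - (b : ℝ) ^ 2 * (dd h s) * e2

variable {x y : Fin 8 → ℝ}

lemma finrank_eigenspace (P : IsPosPair h s) (H : IsPosFrame (castVec ℝ h) (castVec ℝ s) x y)
    (hxy : quad x = quad y) (z : imQuad (dd h s))
    (hz : z ∉ Set.range (algebraMap ℚ (imQuad (dd h s)))) :
    Module.finrank ℝ ((H.torus hxy).eigenspace (P.action z) (z : ℂ)) =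
      Module.finrank ℝ ((H.torus hxy).eigenspace (P.action z) (conj (z : ℂ))) := by
  obtain ⟨a, b, rfl⟩ := exists_eq_add_mul_sqrtNegK P.dd_pos z
  have hb : b ≠ 0 := by
    rintro rfl
    exact hz ⟨a, by simp⟩
  -- Subtracting a + bcJ from a + bN leaves b(N - cJ), so both eigenspaces reduce to the kernels for
  -- c = ±√d.
  have key (c : ℝ) (u : ℂ) (hre : u.re = a) (him : u.im = b * c) :
      (H.torus hxy).eigenspace (P.action (algebraMap ℚ _ a + algebraMap ℚ _ b * sqrtNegK (dd h s))) u
        = LinearMap.ker (sqrtMat (castVec ℝ h) (castVec ℝ s) -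
          c • IsPosFrame.complexStructure x y).toLin' := by
    rw [ComplexTorus.eigenspace, P.action_map, hre, him]
    have : (algebraMap ℚ ℝ a • (1 : Matrix (Fin 8) (Fin 8) ℝ) +
        algebraMap ℚ ℝ b • sqrtMat (castVec ℝ h) (castVec ℝ s) -
        ((a : ℝ) • (1 : Matrix (Fin 8) (Fin 8) ℝ) + ((b : ℝ) * c) • (H.torus hxy).J)) =
        (b : ℝ) • (sqrtMat (castVec ℝ h) (castVec ℝ s) - c • IsPosFrame.complexStructure x y) := by
      rw [smul_sub, smul_smul, IsPosFrame.torus, eq_ratCast, eq_ratCast]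
      abel
    rw [this, map_smul, LinearMap.ker_smul _ _ (by exact_mod_cast hb)]
  rw [coe_add_mul_sqrtNegK, key (Real.sqrt (dd h s)) _ (by simp [sqrtNeg_re]) (by simp [sqrtNeg_im]),
    key (-Real.sqrt (dd h s)) _ (by simp [sqrtNeg_re]) (by simp [sqrtNeg_im]), H.finrank_ker_eq,
    neg_smul, sub_neg_eq_add]

/-- One of the two forms `E`, `-E` is a polarization of Weil type. -/
lemma exists_isPolarizedWeilType (P : IsPosPair h s)
    (H : IsPosFrame (castVec ℝ h) (castVec ℝ s) x y) (hxy : quad x = quad y) :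
    ∃ ω : Coh (Fin 8) 2, (ω = P.form ∨ ω = -P.form) ∧
      IsPolarizedWeilType (H.torus hxy) P.action ω := by
  obtain ⟨ε, hε, hpos⟩ := H.polarization_definite
  have hcomm := H.sqrtMat_comm_complexStructure
  have hpol : (H.torus hxy).IsPolarization (ε • P.form) := by
    refine ⟨fun v => ?_, fun a b hab v => ?_, fun v hv => ?_⟩
    · obtain ⟨m, hm⟩ := P.isIntegralClass_form v
      rw [AlternatingMap.smul_apply, hm]
      rcases hε with rfl | rfl
      · exact ⟨m, by simp⟩
      · exact ⟨-m, by simp⟩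
    · rw [AlternatingMap.smul_apply, AlternatingMap.smul_apply]
      exact congrArg (ε • ·)
        (P.form_middleType (T := H.torus hxy) hcomm H.hyp_complexStructure a b hab v)
    · rw [AlternatingMap.smul_apply, P.form_apply, smul_eq_mul]
      exact hpos v hv
  refine ⟨ε • P.form, ?_, ⟨⟨_, hpol⟩, P.action_mem_endQ (T := H.torus hxy) hcomm,
    P.finrank_eigenspace H hxy⟩, hpol,
    fun z v w => ?_⟩
  · rcases hε with rfl | rfl
    · left; simp
    · right; ext v; simp
  · rw [AlternatingMap.smul_apply, AlternatingMap.smul_apply, P.form_action, smul_eq_mul, smul_eq_mul]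
    ring

end IsPosPair


/-! ### A K-stable isotropic subspace and the discriminant -/

section Discriminant

variable {h s : Fin 8 → ℤ}

/-- Both a and b anticommute past z, with two signs that cancel. For the pair s, h this makes the
annihilator stable under K. -/
lemma twist_mulVec_mem_annihilator {F : Type*} [CommRing F] {z a b v : Fin 8 → F}
    (za : hyp z a = 0) (zb : hyp z b = 0) (hv : v ∈ annihilator z) :
    twist a b *ᵥ v ∈ annihilator z := by
  rw [mem_annihilator] at hv ⊢
  rw [twist, Matrix.mulVec_mulVec, ← Matrix.mul_assoc, cliffMat_mul_cliffAdj_swap za, Matrix.neg_mul,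
    Matrix.mul_assoc, cliffAdj_mul_cliffMat_swap zb, Matrix.mul_neg, neg_neg, ← Matrix.mul_assoc,
    ← Matrix.mulVec_mulVec, hv, Matrix.mulVec_zero]

lemma hyp_eq_zero_of_mem_annihilator {F : Type*} [Field F] [CharZero F] {z v w : Fin 8 → F}
    (hz : z ≠ 0) (hv : v ∈ annihilator z) (hw : w ∈ annihilator z) : hyp v w = 0 := by
  have := cliffTwo_add v w z
  rw [cliffTwo, cliffTwo, mem_annihilator.1 hv, mem_annihilator.1 hw, Matrix.mulVec_zero,
    Matrix.mulVec_zero, add_zero] at this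
  exact (smul_eq_zero.1 this.symm).resolve_right hz

lemma cliffAdj_rank {F : Type*} [Field F] (z : Fin 8 → F) :
    (cliffAdj z).rank = (cliffMat z).rank := by
  let σ : Fin 8 ≃ Fin 8 := Equiv.addRight 4
  have : cliffAdj z = ((cliffMat z)ᵀ).submatrix σ σ := by
    ext i j
    fin_cases i <;> fin_cases j <;> simp [cliffAdj, cliffMat, σ]
  rw [this, Matrix.rank_submatrix, Matrix.rank_transpose]

/-- The image of `cliffAdj z` lies in the kernel of `cliffMat z`. The two matrices have equal rank,
being transposes up to a permutation of indices, so the rank is at most the nullity. -/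
lemma four_le_finrank_annihilator {F : Type*} [Field F] {z : Fin 8 → F} (hz : quad z = 0) :
    4 ≤ Module.finrank F (annihilator z) := by
  have h1 : annihilator z = LinearMap.ker (cliffMat z).mulVecLin := by
    ext v; rw [mem_annihilator]; rfl
  have h2 : LinearMap.range (cliffAdj z).mulVecLin ≤ LinearMap.ker (cliffMat z).mulVecLin := by
    rintro _ ⟨v, rfl⟩
    rw [LinearMap.mem_ker, Matrix.mulVecLin_apply, Matrix.mulVecLin_apply, Matrix.mulVec_mulVec,
      cliffMat_mul_cliffAdj, hz, zero_smul, Matrix.zero_mulVec]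
  have h3 := Submodule.finrank_mono h2
  have h4 := (cliffMat z).mulVecLin.finrank_range_add_finrank_ker
  have h5 := cliffAdj_rank z
  rw [Matrix.rank, Matrix.rank] at h5
  simp only [Module.finrank_fin_fun] at h4
  rw [h1]
  omega

/-- A subspace of dimension at least three contains a non-zero vector in the kernel of two forms. -/
lemma exists_mem_ne_zero_of_two_lt_finrank {F V : Type*} [Field F] [AddCommGroup V] [Module F V]
    [FiniteDimensional F V] (Z : Submodule F V) (hZ : 2 < Module.finrank F Z)
    (f g : Module.Dual F V) : ∃ v ∈ Z, v ≠ 0 ∧ f v = 0 ∧ g v = 0 := by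
  have := LinearMap.ker_ne_bot_of_finrank_lt
    (f := (LinearMap.pi ![f, g] : V →ₗ[F] Fin 2 → F) ∘ₗ Z.subtype) (by simpa using hZ)
  obtain ⟨p, hp, hp0⟩ := (Submodule.ne_bot_iff _).1 this
  refine ⟨p, p.2, fun h => hp0 (Subtype.ext h), congr_fun (LinearMap.mem_ker.1 hp) 0,
    congr_fun (LinearMap.mem_ker.1 hp) 1⟩

/-- The Hermitian form `d (x, y) + √(-d) (√(-d) x, y)`, with values in `K`. -/
def hermK (h s : Fin 8 → ℤ) (x y : Fin 8 → ℚ) : imQuad (dd h s) :=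
  algebraMap ℚ _ (dd h s * hyp x y) +
    algebraMap ℚ _ (hyp (sqrtMat (castVec ℚ h) (castVec ℚ s) *ᵥ x) y) * sqrtNegK (dd h s)

lemma coe_hermK (h s : Fin 8 → ℤ) (x y : Fin 8 → ℚ) : (hermK h s x y : ℂ) =
    ((dd h s * hyp x y : ℚ) : ℂ) +
      ((hyp (sqrtMat (castVec ℚ h) (castVec ℚ s) *ᵥ x) y : ℚ) : ℂ) * sqrtNeg (dd h s) := rfl

lemma hermitian_eq (P : IsPosPair h s) (ε : ℝ) (x y : Fin 8 → ℚ) :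
    hermitian P.action (ε • P.form) x y = ε * hermK h s x y := by
  have hN : sqrtMat (castVec ℝ h) (castVec ℝ s) =
      (sqrtMat (castVec ℚ h) (castVec ℚ s)).map (Rat.castHom ℝ) := by
    rw [← sqrtMat_map]
    congr 1
  have hform (v w : Fin 8 → ℚ) : P.form ![fun i => (v i : ℝ), fun i => (w i : ℝ)] =
      ((hyp (sqrtMat (castVec ℚ h) (castVec ℚ s) *ᵥ v) w : ℚ) : ℝ) := by
    have h2 : (sqrtMat (castVec ℚ h) (castVec ℚ s)).map (Rat.castHom ℝ) *ᵥ (fun i => (v i : ℝ)) =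
        fun i => Rat.castHom ℝ ((sqrtMat (castVec ℚ h) (castVec ℚ s) *ᵥ v) i) := by
      funext i
      exact (RingHom.map_mulVec (Rat.castHom ℝ) _ v i).symm
    rw [P.form_apply, hN]
    simp only [Matrix.cons_val_zero, Matrix.cons_val_one]
    rw [h2]
    exact hyp_map (Rat.castHom ℝ) _ _
  have hNN : hyp (sqrtMat (castVec ℚ h) (castVec ℚ s) *ᵥ x)
      (sqrtMat (castVec ℚ h) (castVec ℚ s) *ᵥ y) = dd h s * hyp x y := by
    rw [hyp_sqrtMat (P.ortho_cast ℚ), Matrix.mulVec_mulVec, P.sqrtMat_sq, Matrix.smul_mulVec,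
      Matrix.one_mulVec, map_smul, smul_eq_mul]
    ring
  rw [hermitian, AlternatingMap.smul_apply, AlternatingMap.smul_apply, P.action_sqrtNegK, hform,
    hform, hNN, coe_hermK]
  simp only [smul_eq_mul]
  push_cast
  ring

lemma conj_hermK (P : IsPosPair h s) (x y : Fin 8 → ℚ) :
    conj (hermK h s x y : ℂ) = hermK h s y x := by
  rw [coe_hermK, coe_hermK, hyp_sqrtMat (P.ortho_cast ℚ) y, hyp_comm y x, hyp_comm y]
  simp [conj_sqrtNeg]

lemma hermK_action (P : IsPosPair h s) (c : imQuad (dd h s)) (x y : Fin 8 → ℚ) :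
    (hermK h s (P.action c *ᵥ x) y : ℂ) = conj (c : ℂ) * hermK h s x y := by
  obtain ⟨a, b, rfl⟩ := exists_eq_add_mul_sqrtNegK P.dd_pos c
  have h1 : P.action (algebraMap ℚ _ a + algebraMap ℚ _ b * sqrtNegK (dd h s)) =
      a • (1 : Matrix (Fin 8) (Fin 8) ℚ) + b • sqrtMat (castVec ℚ h) (castVec ℚ s) := by
    simpa using P.action_map (S := ℚ) a b
  have hNN : sqrtMat (castVec ℚ h) (castVec ℚ s) *ᵥ (sqrtMat (castVec ℚ h) (castVec ℚ s) *ᵥ x) =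
      (-(dd h s : ℚ)) • x := by
    rw [Matrix.mulVec_mulVec, P.sqrtMat_sq, Matrix.smul_mulVec, Matrix.one_mulVec]
  rw [h1, IsPosPair.coe_add_mul_sqrtNegK, coe_hermK, coe_hermK]
  simp only [Matrix.add_mulVec, Matrix.smul_mulVec, Matrix.one_mulVec, Matrix.mulVec_add,
    Matrix.mulVec_smul, hNN, map_add, map_smul, LinearMap.add_apply, LinearMap.smul_apply,
    smul_eq_mul, map_mul, conj_sqrtNeg, map_ratCast]
  push_cast
  linear_combination (b : ℂ) * (hyp (sqrtMat (castVec ℚ h) (castVec ℚ s) *ᵥ x) y : ℚ) *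
    sqrtNeg_mul_self P.dd_pos

lemma hermK_add (h s : Fin 8 → ℤ) (x x' y : Fin 8 → ℚ) :
    (hermK h s (x + x') y : ℂ) = hermK h s x y + hermK h s x' y := by
  simp only [coe_hermK, Matrix.mulVec_add, map_add, LinearMap.add_apply]
  push_cast
  ring

lemma hermK_ne_zero (P : IsPosPair h s) {x y : Fin 8 → ℚ} (hxy : hyp x y ≠ 0) :
    (hermK h s x y : ℂ) ≠ 0 := fun h0 => by
  have := congrArg Complex.re h0
  have hd : (dd h s : ℝ) ≠ 0 := by exact_mod_cast P.dd_pos.ne'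
  rw [coe_hermK] at this
  simp [sqrtNeg_re, hd, hxy] at this

/-- A rational isotropic vector orthogonal to `h` and `s`. -/
lemma exists_rational_isotropic (h s : Fin 8 → ℤ) : ∃ z : Fin 8 → ℚ, z ≠ 0 ∧ quad z = 0 ∧
    hyp z (castVec ℚ h) = 0 ∧ hyp z (castVec ℚ s) = 0 := by
  let f (a : Fin 8 → ℤ) : Module.Dual ℚ (Fin 4 → ℚ) :=
    ∑ i : Fin 4, (a (Fin.natAdd 4 i) : ℚ) • LinearMap.proj i
  -- The first four coordinates span a rational isotropic 4-space, where orthogonality to h and s is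
  -- two linear conditions.
  obtain ⟨t, ht, ht'⟩ := exists_ne_zero_forall_eq_zero (by norm_num : 2 < 4) ![f h, f s]
  have hf (a : Fin 8 → ℤ) : hyp (Fin.append t (0 : Fin 4 → ℚ) : Fin 8 → ℚ) (castVec ℚ a) = f a t := by
    simp [hyp, f, castVec, mul_comm, -Fin.natAdd_eq_addNat]
  refine ⟨(Fin.append t (0 : Fin 4 → ℚ) : Fin 8 → ℚ), fun h0 => ht ?_, ?_, ?_, ?_⟩
  · funext i
    have := congr_fun h0 (Fin.castAdd 4 i)
    simpa using this
  · simp [quad, -Fin.natAdd_eq_addNat]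
  · rw [hf]; exact ht' 0
  · rw [hf]; exact ht' 1

lemma exists_hyp_ne_zero {F : Type*} [Field F] {x : Fin 8 → F} (hx : x ≠ 0) :
    ∃ y, hyp x y ≠ 0 := by
  by_contra! hcon
  exact hx (hyp_ext fun z => by rw [hyp_comm, hcon, map_zero])

/-- The annihilator of z is totally isotropic for the Hermitian form H and contains b₀, b₁. With b₂
chosen so that H(b₁, b₂) = 0, the Gram determinant is H₀₂H₂₀H₁₃H₃₁, the norm of H₀₂H₁₃. -/
lemma hasTrivialDiscriminant (P : IsPosPair h s) {ε : ℝ} (hε : ε = 1 ∨ ε = -1) :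
    HasTrivialDiscriminant P.action (ε • P.form) := by
  obtain ⟨z, hz, hqz, hzh, hzs⟩ := exists_rational_isotropic h s
  have hdim := four_le_finrank_annihilator hqz
  obtain ⟨b₀, hb₀, hb₀', -, -⟩ := exists_mem_ne_zero_of_two_lt_finrank (annihilator z) (by omega) 0 0
  obtain ⟨b₂, h02⟩ := exists_hyp_ne_zero hb₀'
  -- The two conditions are the rational components of H(b₁, b₂) = 0.
  obtain ⟨b₁, hb₁, hb₁', h12, h12'⟩ := exists_mem_ne_zero_of_two_lt_finrank (annihilator z)
    (by omega) (hyp b₂) (hyp b₂ ∘ₗ (sqrtMat (castVec ℚ h) (castVec ℚ s)).mulVecLin)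
  obtain ⟨b₃, h13⟩ := exists_hyp_ne_zero hb₁'
  have hiso {v w : Fin 8 → ℚ} (hv : v ∈ annihilator z) (hw : w ∈ annihilator z) :
      (hermK h s v w : ℂ) = 0 := by
    rw [coe_hermK, hyp_eq_zero_of_mem_annihilator hz hv hw, sqrtMat, Matrix.smul_mulVec, map_smul,
      LinearMap.smul_apply,
      hyp_eq_zero_of_mem_annihilator hz (twist_mulVec_mem_annihilator hzs hzh hv) hw]
    simp
  have e00 := hiso hb₀ hb₀
  have e01 := hiso hb₀ hb₁
  have e10 := hiso hb₁ hb₀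
  have e11 := hiso hb₁ hb₁
  have e12 : (hermK h s b₁ b₂ : ℂ) = 0 := by
    rw [LinearMap.comp_apply, Matrix.mulVecLin_apply] at h12'
    rw [coe_hermK, hyp_comm, h12, hyp_comm, h12']
    simp
  have e21 : (hermK h s b₂ b₁ : ℂ) = 0 := by rw [← conj_hermK P, e12, map_zero]
  have n02 := hermK_ne_zero P h02
  have n13 := hermK_ne_zero P h13
  have e20 := conj_hermK P b₀ b₂
  have e31 := conj_hermK P b₁ b₃
  have n20 : (hermK h s b₂ b₀ : ℂ) ≠ 0 := by rw [← e20]; simpa using n02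
  have n31 : (hermK h s b₃ b₁ : ℂ) ≠ 0 := by rw [← e31]; simpa using n13
  refine ⟨4, ![b₀, b₁, b₂, b₃], ?_, hermK h s b₀ b₂ * hermK h s b₁ b₃, ?_, ?_⟩
  -- Both sides have dimension 8 over ℚ, so injectivity is enough. Pairing a relation with b₁, b₀,
  -- b₂, b₃ in this order kills c₃, c₂, c₀, c₁ one at a time.
  · let f : (Fin 4 → imQuad (dd h s)) →ₗ[ℚ] (Fin 8 → ℚ) :=
      ∑ j, ((Matrix.mulVecBilin ℚ ℚ).flip (![b₀, b₁, b₂, b₃] j) ∘ₗ P.action.toLinearMap ∘ₗ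
        LinearMap.proj j)
    have hf : (fun c : Fin 4 → imQuad (dd h s) => ∑ j, (P.action (c j)).mulVec (![b₀, b₁, b₂, b₃] j))
        = f := by
      funext c
      simp [f]
    have hfin : FiniteDimensional ℚ (imQuad (dd h s)) :=
      (imQuadPowerBasis P.dd_pos).finite
    have hfr : Module.finrank ℚ (Fin 4 → imQuad (dd h s)) = Module.finrank ℚ (Fin 8 → ℚ) := by
      rw [Module.finrank_pi_fintype]
      simp [finrank_imQuad P.dd_pos]
    have hinj : Function.Injective f := by
      refine (injective_iff_map_eq_zero f).2 fun c hc => ?_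
      rw [← hf] at hc
      have key (y : Fin 8 → ℚ) : conj (c 0 : ℂ) * hermK h s b₀ y + conj (c 1 : ℂ) * hermK h s b₁ y +
          conj (c 2 : ℂ) * hermK h s b₂ y + conj (c 3 : ℂ) * hermK h s b₃ y = 0 := by
        simp only [Fin.sum_univ_four] at hc
        rw [← hermK_action P, ← hermK_action P, ← hermK_action P, ← hermK_action P, ← hermK_add,
          ← hermK_add, ← hermK_add]
        have := congrArg (fun v => (hermK h s v y : ℂ)) hc
        refine Eq.trans this ?_
        simp [coe_hermK]
      have hconj {u : imQuad (dd h s)} {w : ℂ} (hw : w ≠ 0) (hu : conj (u : ℂ) * w = 0) : u = 0 := by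
        have := (mul_eq_zero.1 hu).resolve_right hw
        exact Subtype.ext (by simpa using this)
      have k1 := key b₁
      have k0 := key b₀
      rw [e01, e11, e21, mul_zero, mul_zero, mul_zero, add_zero, add_zero, zero_add] at k1
      have c3 := hconj n31 k1
      rw [e00, e10, c3] at k0
      simp only [mul_zero, zero_add, ZeroMemClass.coe_zero, map_zero, zero_mul, add_zero] at k0
      have c2 := hconj n20 k0
      have k2 := key b₂
      rw [e12, c3, c2] at k2
      simp only [mul_zero, ZeroMemClass.coe_zero, map_zero, zero_mul, add_zero] at k2
      have c0 := hconj n02 k2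
      have k3 := key b₃
      rw [c0, c3, c2] at k3
      simp only [ZeroMemClass.coe_zero, map_zero, zero_mul, add_zero, zero_add] at k3
      have c1 := hconj n13 k3
      funext i
      fin_cases i <;> assumption
    have hbij : Function.Bijective f :=
      ⟨hinj, (LinearMap.injective_iff_surjective_of_finrank_eq_finrank hfr).1 hinj⟩
    rw [← hf] at hbij
    exact hbij
  · intro h0
    have := congrArg (Subtype.val) h0
    simp only [MulMemClass.coe_mul, ZeroMemClass.coe_zero] at this
    exact (mul_ne_zero n02 n13) this
  · have hε4 : (ε : ℂ) ^ 4 = 1 := by rcases hε with rfl | rfl <;> norm_num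
    simp only [hermitian_eq, Matrix.det_succ_row_zero, Fin.sum_univ_succ]
    simp [Fin.succAbove, e00, e01, e10, e11, e12, e21]
    rw [e20, e31]
    linear_combination ((hermK h s b₀ b₂ : ℂ) * hermK h s b₁ b₃ *
      (hermK h s b₂ b₀ * hermK h s b₃ b₁)) * hε4

end Discriminant


/-! ### The Cayley class -/

section Cayley

lemma hyp_cliffTwo_eq_twist {R : Type*} [CommRing R] (z v w s : Fin 8 → R) :
    hyp z (cliffTwo v w s) = hyp v (twist z s *ᵥ w) := by
  rw [hyp_cliffTwo, hyp_cliffMat_mulVec, Matrix.mulVec_mulVec, twist]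

lemma cliffTwo_self {F : Type*} [Field F] [CharZero F] (v z : Fin 8 → F) :
    cliffTwo v v z = quad v • z := by
  have h := cliffTwo_add v v z
  rw [hyp_self, mul_smul, ← two_smul F] at h
  exact smul_right_injective _ (two_ne_zero (α := F)) h

/-- The adjoint of a·b is b·a. Each summand of c_s thus becomes a pairing of two vectors of S^+, a
form in which the circle action is visible. -/
lemma hyp_cliffTwo_cliffTwo {R : Type*} [CommRing R] (s a b c e : Fin 8 → R) :
    hyp s (cliffTwo a b (cliffTwo c e s)) = hyp (cliffTwo b a s) (cliffTwo c e s) := by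
  rw [hyp_cliffTwo, hyp_comm _ (cliffTwo c e s), hyp_cliffTwo, hyp_comm]

lemma cliffTwo_map {R S : Type*} [CommRing R] [CommRing S] (f : R →+* S) (v w z : Fin 8 → R) :
    cliffTwo (fun i => f (v i)) (fun i => f (w i)) (fun i => f (z i)) =
      fun i => f (cliffTwo v w z i) := by
  funext i
  fin_cases i <;> simp [cliffTwo, cliffOdd, cliffMat, Matrix.vecHead, Matrix.vecTail]

lemma cayley_summand (s : Fin 8 → ℝ) (v : Fin 4 → Fin 8 → ℝ) :
    (((hyp s) ∘ₗ evenCoord ∘ₗ LinearMap.applyₗ (evenSpinor s)).compMultilinearMap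
      ((MultilinearMap.mkPiAlgebraFin ℝ 4 (Module.End ℝ (Spinor ℝ))).compLinearMap
        fun _ => cliff)) v = hyp s (cliffTwo (v 0) (v 1) (cliffTwo (v 2) (v 3) s)) := by
  rw [LinearMap.compMultilinearMap_apply, MultilinearMap.compLinearMap_apply,
    MultilinearMap.mkPiAlgebraFin_apply]
  simp only [List.ofFn_succ, List.ofFn_zero, List.prod_cons, List.prod_nil, mul_one,
    LinearMap.comp_apply, LinearMap.applyₗ_apply_apply]
  change hyp s (evenCoord (cliff (v 0) (cliff (v 1) (cliff (v 2) (cliff (v 3) (evenSpinor s)))))) = _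
  rw [cliff_cliff_evenSpinor, cliff_cliff_evenSpinor, evenCoord_evenSpinor]

lemma cayley_apply (s : Fin 8 → ℤ) (v : Fin 4 → Fin 8 → ℝ) :
    cayley s v = ∑ σ : Equiv.Perm (Fin 4), Equiv.Perm.sign σ •
      hyp (castVec ℝ s) (cliffTwo (v (σ 0)) (v (σ 1))
        (cliffTwo (v (σ 2)) (v (σ 3)) (castVec ℝ s))) := by
  rw [cayley, MultilinearMap.alternatization_apply]
  refine Finset.sum_congr rfl fun σ _ => ?_
  rw [MultilinearMap.domDomCongr_apply]
  exact congrArg _ (cayley_summand _ _)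

lemma isIntegralClass_cayley (s : Fin 8 → ℤ) : IsIntegralClass (cayley s) := fun v => by
  refine ⟨∑ σ : Equiv.Perm (Fin 4), Equiv.Perm.sign σ •
      hyp s (cliffTwo (v (σ 0)) (v (σ 1)) (cliffTwo (v (σ 2)) (v (σ 3)) s)), ?_⟩
  rw [cayley_apply, Int.cast_sum]
  refine Finset.sum_congr rfl fun σ _ => ?_
  have h1 := hyp_map (Int.castRingHom ℝ) s
    (cliffTwo (v (σ 0)) (v (σ 1)) (cliffTwo (v (σ 2)) (v (σ 3)) s))
  rw [← cliffTwo_map, ← cliffTwo_map] at h1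
  rw [Units.smul_def, Units.smul_def, zsmul_eq_mul, smul_eq_mul, Int.cast_mul]
  exact congrArg _ h1

/-- The rotation of `S^+ ⊗ ℝ` induced by `a + b J`. -/
def rotation (x y : Fin 8 → ℝ) (a b : ℝ) (z : Fin 8 → ℝ) : Fin 8 → ℝ :=
  z + ((a * b * hyp z y - b ^ 2 * hyp z x) / quad y) • x +
    ((-(a * b * hyp z x) - b ^ 2 * hyp z y) / quad y) • y

namespace IsPosFrame

variable {h s x y : Fin 8 → ℝ}

lemma hyp_rotation (x y : Fin 8 → ℝ) (a b : ℝ) (z w : Fin 8 → ℝ) :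
    hyp z (rotation x y a b w) = hyp (rotation x y a (-b) z) w := by
  simp only [rotation, map_add, map_smul, LinearMap.add_apply, LinearMap.smul_apply, smul_eq_mul,
    hyp_comm w x, hyp_comm w y]
  ring

lemma rotation_rotation (H : IsPosFrame h s x y) (hxy : quad x = quad y) {a b : ℝ}
    (hab : a ^ 2 + b ^ 2 = 1) (z : Fin 8 → ℝ) :
    rotation x y a b (rotation x y a (-b) z) = z := by
  have hq := H.y_pos.ne'
  have h1 : hyp (rotation x y a (-b) z) x =
      (1 - 2 * b ^ 2) * hyp z x - 2 * a * b * hyp z y := by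
    simp only [rotation, map_add, map_smul, LinearMap.add_apply, LinearMap.smul_apply, smul_eq_mul,
      hyp_self, hxy, hyp_comm y x, H.xy]
    field_simp
    ring
  have h2 : hyp (rotation x y a (-b) z) y =
      (1 - 2 * b ^ 2) * hyp z y + 2 * a * b * hyp z x := by
    simp only [rotation, map_add, map_smul, LinearMap.add_apply, LinearMap.smul_apply, smul_eq_mul,
      hyp_self, H.xy]
    field_simp
    ring
  rw [rotation, h1, h2, rotation]
  funext i
  simp only [Pi.add_apply, Pi.smul_apply, smul_eq_mul]
  field_simp
  linear_combination (2 * b ^ 2 * (x i * hyp z x + y i * hyp z y)) * hab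

lemma twist_mul_twist (H : IsPosFrame h s x y) (z : Fin 8 → ℝ) :
    twist z s * twist y x = twist y x * twist z s + (hyp z y • twist x s - hyp z x • twist y s) := by
  have h1 := congrArg (· * cliffMat s) (cliffAdj_mul_mul_sub z x y)
  simp only [Matrix.sub_mul, Matrix.smul_mul] at h1
  have h2 : cliffAdj z * (cliffMat y * cliffAdj x) * cliffMat s = twist z s * twist y x := by
    rw [twist, twist, Matrix.mul_assoc, Matrix.mul_assoc, Matrix.mul_assoc,
      cliffAdj_mul_cliffMat_swap (a := x) (by rw [hyp_comm, H.sx]), Matrix.mul_neg,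
      ← Matrix.mul_assoc (cliffMat y), cliffMat_mul_cliffAdj_swap (a := y) (by rw [hyp_comm, H.sy]),
      Matrix.neg_mul, neg_neg, Matrix.mul_assoc]
  rw [h2, Matrix.mul_assoc] at h1
  exact sub_eq_iff_eq_add'.1 h1

/-- The element a + bJ is a spin lift of a rotation of the plane ⟨x, y⟩ by the double angle. It
moves z but not s, which is orthogonal to the plane. -/
lemma conj_twist (H : IsPosFrame h s x y) (hxy : quad x = quad y) {a b : ℝ}
    (hab : a ^ 2 + b ^ 2 = 1) (z : Fin 8 → ℝ) :
    (a • 1 - b • complexStructure x y) * twist z s * (a • 1 + b • complexStructure x y) =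
      twist (rotation x y a b z) s := by
  have hq := H.y_pos.ne'
  have hTJ : twist z s * complexStructure x y = complexStructure x y * twist z s +
      ((quad y)⁻¹ * hyp z y) • twist x s - ((quad y)⁻¹ * hyp z x) • twist y s := by
    rw [complexStructure, Matrix.mul_smul, H.twist_mul_twist, smul_add, smul_sub, smul_smul,
      smul_smul, Matrix.smul_mul, add_sub_assoc]
  have hJx : complexStructure x y * twist x s = twist y s := by
    rw [complexStructure, twist, twist, Matrix.smul_mul, Matrix.mul_assoc,
      ← Matrix.mul_assoc (cliffMat x), cliffMat_mul_cliffAdj, hxy, Matrix.smul_mul, Matrix.one_mul,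
      Matrix.mul_smul, inv_smul_smul₀ hq, twist]
  have hJJ := H.complexStructure_mul_self hxy
  have hJy : complexStructure x y * twist y s = -twist x s := by
    rw [← hJx, ← Matrix.mul_assoc, hJJ, Matrix.neg_mul, Matrix.one_mul]
  have hr : twist (rotation x y a b z) s = twist z s +
      ((a * b * hyp z y - b ^ 2 * hyp z x) / quad y) • twist x s +
      ((-(a * b * hyp z x) - b ^ 2 * hyp z y) / quad y) • twist y s := by
    rw [rotation, twist, cliffAdj_add, cliffAdj_add, cliffAdj_smul, cliffAdj_smul, Matrix.add_mul,
      Matrix.add_mul, Matrix.smul_mul, Matrix.smul_mul]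
    rfl
  have hexp : (a • 1 - b • complexStructure x y) * twist z s * (a • 1 + b • complexStructure x y) =
      (a ^ 2) • twist z s + (a * b) • (twist z s * complexStructure x y -
        complexStructure x y * twist z s) -
        (b ^ 2) • (complexStructure x y * (twist z s * complexStructure x y)) := by
    simp only [Matrix.sub_mul, Matrix.mul_add, Matrix.smul_mul, Matrix.mul_smul, Matrix.one_mul,
      Matrix.mul_one, smul_sub, smul_smul, Matrix.mul_assoc]
    module
  rw [hexp, hTJ, Matrix.mul_sub, Matrix.mul_add, ← Matrix.mul_assoc, hJJ, Matrix.mul_smul,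
    Matrix.mul_smul, hJx, hJy, hr, Matrix.neg_mul, Matrix.one_mul]
  have ha : a ^ 2 = 1 - b ^ 2 := by linarith
  rw [ha]
  module

lemma hyp_cliffTwo_invariant (H : IsPosFrame h s x y) (hxy : quad x = quad y) {a b : ℝ}
    (hab : a ^ 2 + b ^ 2 = 1) (z v w : Fin 8 → ℝ) :
    hyp z (cliffTwo (a • v + b • complexStructure x y *ᵥ v)
      (a • w + b • complexStructure x y *ᵥ w) s) = hyp (rotation x y a b z) (cliffTwo v w s) := by
  rw [hyp_cliffTwo_eq_twist, hyp_cliffTwo_eq_twist, ← H.conj_twist hxy hab]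
  have h1 (u : Fin 8 → ℝ) : hyp (a • v + b • complexStructure x y *ᵥ v) u =
      hyp v ((a • 1 - b • complexStructure x y) *ᵥ u) := by
    rw [Matrix.sub_mulVec, Matrix.smul_mulVec, Matrix.smul_mulVec, Matrix.one_mulVec]
    simp only [map_add, map_sub, map_smul, LinearMap.add_apply, LinearMap.smul_apply, smul_eq_mul,
      H.hyp_complexStructure]
    ring
  rw [h1, ← Matrix.mulVec_mulVec, ← Matrix.mulVec_mulVec, Matrix.add_mulVec, Matrix.smul_mulVec,
    Matrix.smul_mulVec, Matrix.one_mulVec]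

/-- Applying the circle element to one pair of arguments can be transferred to a rotation of the
other member of the pairing. Doing so on both sides produces a rotation and its inverse. -/
lemma hyp_cliffTwo_cliffTwo_invariant (H : IsPosFrame h s x y) (hxy : quad x = quad y) {a b : ℝ}
    (hab : a ^ 2 + b ^ 2 = 1) (g : (Fin 8 → ℝ) → Fin 8 → ℝ)
    (hg : ∀ v, g v = a • v + b • complexStructure x y *ᵥ v) (v₁ v₂ v₃ v₄ : Fin 8 → ℝ) :
    hyp (cliffTwo (g v₁) (g v₂) s) (cliffTwo (g v₃) (g v₄) s) =
      hyp (cliffTwo v₁ v₂ s) (cliffTwo v₃ v₄ s) := by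
  have e (z v w : Fin 8 → ℝ) : hyp z (cliffTwo (g v) (g w) s) =
      hyp (rotation x y a b z) (cliffTwo v w s) := by
    rw [hg, hg, H.hyp_cliffTwo_invariant hxy hab]
  rw [e, hyp_comm, hyp_rotation, e, H.rotation_rotation hxy hab,
    hyp_comm]

end IsPosFrame

/-- A product of pairwise anticommuting elements changes by the sign of a permutation. -/
lemma prod_ofFn_comp_perm {A : Type*} [Ring A] (σ : Equiv.Perm (Fin 4)) :
    ∀ a : Fin 4 → A, (∀ i j, i ≠ j → a i * a j = -(a j * a i)) →
      (List.ofFn (a ∘ σ)).prod = (Equiv.Perm.sign σ : ℤ) • (List.ofFn a).prod := by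
  -- Adjacent transpositions generate the symmetric group, and for these a single anticommutation
  -- suffices.
  have hσ : σ ∈ Submonoid.closure
      (Set.range fun i : Fin 3 => Equiv.swap i.castSucc i.succ) := by
    rw [Equiv.Perm.mclosure_swap_castSucc_succ]; trivial
  induction hσ using Submonoid.closure_induction with
  | one => intro a _; simp
  | mul σ τ _ _ h1 h2 =>
    intro a ha
    have e1 := h1 a ha
    have e2 := h2 (a ∘ σ) fun i j hij => ha _ _ fun h => hij (σ.injective h)
    rw [Equiv.Perm.coe_mul, ← Function.comp_assoc, e2, e1, smul_smul, map_mul, Units.val_mul, mul_comm]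
  | mem τ h =>
    obtain ⟨i, rfl⟩ := h
    intro a ha
    rw [Equiv.Perm.sign_swap (Fin.castSucc_lt_succ).ne]
    fin_cases i
    · have := ha 1 0 (by decide)
      simp [List.ofFn_succ, Equiv.swap_apply_def, ← mul_assoc, this]
    · have := ha 2 1 (by decide)
      simp [List.ofFn_succ, Equiv.swap_apply_def, ← mul_assoc, this]
    · have := ha 3 2 (by decide)
      simp [List.ofFn_succ, Equiv.swap_apply_def, this]

/-- Pairwise orthogonal vectors anticommute in the Clifford algebra, so the 24 signed summands
coincide. -/
lemma cayley_of_ortho (s : Fin 8 → ℤ) (v : Fin 4 → Fin 8 → ℝ)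
    (hv : ∀ i j, i ≠ j → hyp (v i) (v j) = 0) :
    cayley s v = 24 * hyp (cliffTwo (v 1) (v 0) (castVec ℝ s)) (cliffTwo (v 2) (v 3) (castVec ℝ s)) := by
  have hF (w : Fin 4 → Fin 8 → ℝ) :
      hyp (castVec ℝ s) (cliffTwo (w 0) (w 1) (cliffTwo (w 2) (w 3) (castVec ℝ s))) =
      hyp (castVec ℝ s) (evenCoord ((List.ofFn fun i => cliff (w i)).prod
        (evenSpinor (castVec ℝ s)))) := by
    simp only [List.ofFn_succ, List.ofFn_zero, List.prod_cons, List.prod_nil, mul_one]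
    change _ = hyp _ (evenCoord (cliff (w 0) (cliff (w 1) (cliff (w 2) (cliff (w 3)
      (evenSpinor (castVec ℝ s)))))))
    rw [cliff_cliff_evenSpinor, cliff_cliff_evenSpinor, evenCoord_evenSpinor]
  have hanti : ∀ i j, i ≠ j → cliff (v i) * cliff (v j) = -(cliff (v j) * cliff (v i)) := by
    intro i j hij
    have := cliff_mul_add (v i) (v j)
    rw [hv i j hij, zero_smul] at this
    exact eq_neg_of_add_eq_zero_left this
  rw [cayley_apply, ← hyp_cliffTwo_cliffTwo]
  have hterm (σ : Equiv.Perm (Fin 4)) : Equiv.Perm.sign σ •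
      hyp (castVec ℝ s) (cliffTwo (v (σ 0)) (v (σ 1))
        (cliffTwo (v (σ 2)) (v (σ 3)) (castVec ℝ s))) = hyp (castVec ℝ s) (cliffTwo (v 0) (v 1)
        (cliffTwo (v 2) (v 3) (castVec ℝ s))) := by
    have h1 := prod_ofFn_comp_perm σ (fun i => cliff (v i)) hanti
    rw [hF v, hF (fun i => v (σ i))]
    have h2 : (List.ofFn fun i => cliff (v (σ i))).prod = (List.ofFn ((fun i => cliff (v i)) ∘ σ)).prod := rfl
    rw [h2, h1, LinearMap.smul_apply, map_zsmul, map_zsmul, Units.smul_def, smul_smul,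
      ← Units.val_mul, Int.units_mul_self, Units.val_one, one_smul]
  rw [Finset.sum_congr rfl fun σ _ => hterm σ, Finset.sum_const, Finset.card_univ, Fintype.card_perm]
  simp [Nat.factorial]

/-- In every summand of the wedge product v₀ is an argument of one of the two factors, and that
factor vanishes. -/
lemma wedge_self_eq_zero {ι : Type*} (ω : Coh ι 2) (v : Fin 4 → ι → ℝ)
    (hv : ∀ i, ω ![v 0, v i] = 0) : wedge ω ω v = 0 := by
  have key (m : Fin 2 → ι → ℝ) (hm : ∀ i, ∃ k, m i = v k) (i₀ : Fin 2) (h₀ : m i₀ = v 0) :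
      ω m = 0 := by
    fin_cases i₀
    · obtain ⟨k, hk⟩ := hm 1
      rw [← hv k]
      congr 1
      funext i
      fin_cases i <;> assumption
    · obtain ⟨k, hk⟩ := hm 0
      rw [← neg_eq_zero, ← ω.map_swap m (i := 0) (j := 1) (by decide), ← hv k]
      congr 1
      funext i
      fin_cases i <;> simpa
  rw [wedge, AlternatingMap.domDomCongr_apply, LinearMap.compAlternatingMap_apply,
    AlternatingMap.domCoprod_apply, sum_apply, map_sum]
  refine Finset.sum_eq_zero fun σ _ => ?_
  induction σ using Quotient.inductionOn' with
  | _ σ =>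
  rw [AlternatingMap.domCoprod.summand_mk'', smul_apply, MultilinearMap.domDomCongr_apply,
    MultilinearMap.domCoprod_apply, LinearMap.map_smul_of_tower, LinearMap.mul'_apply]
  have : ∃ j, v (finSumFinEquiv (σ j)) = v 0 := ⟨σ.symm (Sum.inl 0), by simp; rfl⟩
  obtain ⟨j | j, hj⟩ := this
  · have h0 := key (fun i => v (finSumFinEquiv (σ (Sum.inl i)))) (fun i => ⟨_, rfl⟩) j hj
    exact smul_eq_zero_of_right _ (mul_eq_zero_of_left h0 _)
  · have h0 := key (fun i => v (finSumFinEquiv (σ (Sum.inr i)))) (fun i => ⟨_, rfl⟩) j hj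
    exact smul_eq_zero_of_right _ (mul_eq_zero_of_right _ h0)

lemma middleType_cayley {h : Fin 8 → ℝ} {s : Fin 8 → ℤ} {x y : Fin 8 → ℝ}
    (H : IsPosFrame h (castVec ℝ s) x y) (hxy : quad x = quad y) :
    (H.torus hxy).IsMiddleType (cayley s) := by
  intro a b hab v
  rw [cayley_apply, cayley_apply]
  refine Finset.sum_congr rfl fun σ _ => congrArg _ ?_
  rw [hyp_cliffTwo_cliffTwo, hyp_cliffTwo_cliffTwo]
  exact H.hyp_cliffTwo_cliffTwo_invariant hxy hab
    (fun v => a • v + b • IsPosFrame.complexStructure x y *ᵥ v) (fun _ => rfl) _ _ _ _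

lemma mul_mul_eq_neg_of_anticommute {A : Type*} [Ring A] {a b c : A} (hab : a * b = b * a)
    (hbc : b * c = c * b) (hac : a * c = -(c * a)) : a * b * (b * c) = -(b * c * (a * b)) := by
  have h1 : a * b * (b * c) = b * b * (a * c) := by
    rw [hab, mul_assoc, ← mul_assoc a, hab]; simp only [mul_assoc]
  have h2 : b * c * (a * b) = b * b * (c * a) := by
    rw [hab, mul_assoc, ← mul_assoc c, ← hbc]; simp only [mul_assoc]
  rw [h1, h2, hac, mul_neg]

/-- The classes are separated by one quadruple, built from an eigenvector v of the volume element
and a negative vector p orthogonal to the frame: v, `twist s x` v, `twist s p` v, `twist x p` v.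
These are pairwise orthogonal and ω pairs v to zero with each, so ω∧ω vanishes on them, while c_s is
a non-zero product of values of q. -/
lemma IsPosPair.cayley_ne {h s : Fin 8 → ℤ} {x y : Fin 8 → ℝ} (P : IsPosPair h s)
    (H : IsPosFrame (castVec ℝ h) (castVec ℝ s) x y) {ω : Coh (Fin 8) 2}
    (hω : ω = P.form ∨ ω = -P.form) (q : ℝ) : cayley s ≠ q • wedge ω ω := by
  obtain ⟨v, ε, hε, hv, hPv⟩ := H.exists_vol_eigenvector
  obtain ⟨p, hp, ph, ps, px, py⟩ := IsPosFrame.exists_ortho (castVec ℝ h) (castVec ℝ s) x y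
  have hqp := (H.quad_neg hp ph ps px py).ne
  set h' := castVec ℝ h with hh'
  set s' := castVec ℝ s with hs'
  have hsh : hyp s' h' = 0 := by rw [hyp_comm, H.hs]
  have hself {a b : Fin 8 → ℝ} (hab : hyp a b = 0) : hyp v (twist a b *ᵥ v) = 0 := by
    have := hyp_twist_mulVec_of_ortho hab v v
    rw [hyp_comm] at this
    linarith
  have hsp := twist_swap ps
  have hxp := twist_swap px
  have hsx := twist_swap H.sx
  obtain ⟨w, w0, w1, w2, w3⟩ : ∃ w : Fin 4 → Fin 8 → ℝ, w 0 = v ∧ w 1 = twist s' x *ᵥ v ∧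
      w 2 = twist s' p *ᵥ v ∧ w 3 = twist x p *ᵥ v :=
    ⟨![v, twist s' x *ᵥ v, twist s' p *ᵥ v, twist x p *ᵥ v], rfl, rfl, rfl, rfl⟩
  have w01 : hyp (w 0) (w 1) = 0 := by rw [w0, w1]; exact hself H.sx
  have w02 : hyp (w 0) (w 2) = 0 := by rw [w0, w2]; exact hself ps
  have w03 : hyp (w 0) (w 3) = 0 := by rw [w0, w3]; exact hself px
  have w12 : hyp (w 1) (w 2) = 0 := by
    rw [w1, w2, hyp_twist_twist, px, mul_zero]
  have w13 : hyp (w 1) (w 3) = 0 := by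
    rw [w1, w3, hsx, Matrix.neg_mulVec, map_neg, LinearMap.neg_apply, hyp_twist_twist, ps, mul_zero, neg_zero]
  have w23 : hyp (w 2) (w 3) = 0 := by
    rw [w2, w3, hsp, hxp, Matrix.neg_mulVec, Matrix.neg_mulVec, map_neg, map_neg, LinearMap.neg_apply,
      hyp_twist_twist, H.sx, mul_zero, neg_zero, neg_zero]
  have hw : ∀ i j, i ≠ j → hyp (w i) (w j) = 0 := by
    intro i j hij
    fin_cases i <;> fin_cases j <;> first
      | exact absurd rfl hij
      | assumption
      | (rw [hyp_comm]; assumption)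
  have hcay : cayley s w = 24 * (quad s' * quad v * (quad x * (quad s' * quad p * (2 * quad v)))) := by
    rw [cayley_of_ortho s w hw]
    have e1 : cliffTwo (w 1) (w 0) s' = -(quad s' * quad v) • x := by
      have e := cliffTwo_add (w 1) (w 0) s'
      rw [hyp_comm, w01, zero_smul] at e
      rw [eq_neg_of_add_eq_zero_left e, neg_smul]
      have e4 : cliffMat s' *ᵥ (twist s' x *ᵥ v) = quad s' • (cliffMat x *ᵥ v) := by
        rw [Matrix.mulVec_mulVec, twist, ← Matrix.mul_assoc, cliffMat_mul_cliffAdj,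
          Matrix.smul_mul, Matrix.one_mul, Matrix.smul_mulVec]
      rw [w0, w1, cliffTwo, e4, Matrix.mulVec_smul, ← smul_smul, ← cliffTwo_self v x, cliffTwo]
    -- Exchanging s and x makes the last pairing a norm, that of `cliffMat x` w₂.
    have e2 : cliffMat s' *ᵥ w 3 = -(cliffMat x *ᵥ w 2) := by
      rw [w2, w3, Matrix.mulVec_mulVec, Matrix.mulVec_mulVec, twist, twist, ← Matrix.mul_assoc,
        ← Matrix.mul_assoc, cliffMat_mul_cliffAdj_swap H.sx, Matrix.neg_mul, Matrix.neg_mulVec]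
    rw [← hs', e1, map_smul, LinearMap.smul_apply, hyp_cliffTwo, e2, map_neg,
      hyp_cliffMat_cliffMat_same]
    rw [w2, hyp_twist_twist_same, hyp_self, smul_eq_mul]
    ring
  have hform (i : Fin 4) : P.form ![w 0, w i] = 0 := by
    rw [P.form_apply, sqrtMat]
    simp only [Matrix.cons_val_zero, Matrix.cons_val_one, ← hh', ← hs']
    rw [Matrix.smul_mulVec, map_smul, LinearMap.smul_apply]
    rw [w0]
    suffices hyp (twist s' h' *ᵥ v) (w i) = 0 by rw [this, smul_zero]
    fin_cases i
    · change hyp (twist s' h' *ᵥ v) (w 0) = 0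
      rw [w0, hyp_comm, hself hsh]
    · change hyp (twist s' h' *ᵥ v) (w 1) = 0
      rw [w1, hyp_twist_twist, H.hx, mul_zero]
    · change hyp (twist s' h' *ᵥ v) (w 2) = 0
      rw [w2, hyp_twist_twist, ph, mul_zero]
    · change hyp (twist s' h' *ᵥ v) (w 3) = 0
      rw [w3, ← hyp_twist_mulVec]
      have hps : hyp p s' = 0 := by rw [hyp_comm, ps]
      have hph : hyp p h' = 0 := by rw [hyp_comm, ph]
      have hxs : hyp x s' = 0 := by rw [hyp_comm, H.sx]
      have hxh : hyp x h' = 0 := by rw [hyp_comm, H.hx]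
      have hyx : hyp y x = 0 := by rw [hyp_comm, H.xy]
      have hcomm := twist_commute hps hph hxs hxh
      -- The last pairing is (Mv, v) with M anticommuting with the symmetric P. As Pv = λv with λ ≠
      -- 0, one gets λ(Mv, v) = -λ(Mv, v).
      have hMP : twist p x * twist s' h' * IsPosFrame.vol h' s' x y =
          -(IsPosFrame.vol h' s' x y * (twist p x * twist s' h')) :=
        mul_mul_eq_neg_of_anticommute hcomm H.twist_comm_twist
          (twist_anticommute_right (a := y) py hyx (by rw [hyp_comm, px]))
      set M := twist p x * twist s' h' with hM
      have h1 : hyp (M *ᵥ (IsPosFrame.vol h' s' x y *ᵥ v)) v =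
          -hyp (M *ᵥ v) (IsPosFrame.vol h' s' x y *ᵥ v) := by
        rw [Matrix.mulVec_mulVec, hMP, Matrix.neg_mulVec, ← Matrix.mulVec_mulVec, map_neg,
          LinearMap.neg_apply, H.hyp_vol_mulVec]
      rw [hPv, Matrix.mulVec_smul, map_smul, map_smul, LinearMap.smul_apply, smul_eq_mul] at h1
      have hr : ε * IsPosFrame.volNorm h' s' x y ≠ 0 :=
        mul_ne_zero (by rcases hε with rfl | rfl <;> norm_num) H.volNorm_pos.ne'
      have h2 : (ε * IsPosFrame.volNorm h' s' x y) * hyp (M *ᵥ v) v = 0 := by linarith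
      rw [Matrix.mulVec_mulVec]
      exact (mul_eq_zero.1 h2).resolve_left hr
  have hform' (i : Fin 4) : ω ![w 0, w i] = 0 := by
    rcases hω with rfl | rfl
    · exact hform i
    · rw [AlternatingMap.neg_apply, hform, neg_zero]
  intro heq
  have h1 := congrArg (fun α : Coh (Fin 8) 4 => α w) heq
  simp only [AlternatingMap.smul_apply] at h1
  rw [hcay, wedge_self_eq_zero ω w hform', smul_zero] at h1
  have e1 := H.s_pos.ne'
  have e2 := H.x_pos.ne'
  simp [e1, e2, hqp, hv] at h1

end Cayley


/-! ### The period domain and its tori -/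

section Periods

/-- The complexification of a real vector. -/
def toC (x : Fin 8 → ℝ) : Fin 8 → ℂ := fun i => (x i : ℂ)

lemma hyp_toC (x y : Fin 8 → ℝ) : hyp (toC x) (toC y) = (hyp x y : ℝ) :=
  hyp_map Complex.ofRealHom x y

lemma toC_castVec (h : Fin 8 → ℤ) : toC (castVec ℝ h) = castVec ℂ h := by
  funext i; simp [toC, castVec]

lemma eq_toC_add (z : Fin 8 → ℂ) :
    z = toC (fun i => (z i).re) + Complex.I • toC (fun i => (z i).im) := by
  funext i
  simp [toC, mul_comm Complex.I, Complex.re_add_im]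

lemma map_mulVec_toC (M : Matrix (Fin 8) (Fin 8) ℝ) (v : Fin 8 → ℝ) :
    M.map (algebraMap ℝ ℂ) *ᵥ toC v = toC (M *ᵥ v) := by
  funext i
  exact (RingHom.map_mulVec (algebraMap ℝ ℂ) M v i).symm

/-- A point of the period domain, in coordinates. -/
def IsPeriod (h s : Fin 8 → ℤ) (z : Fin 8 → ℂ) : Prop :=
  (hyp z z = 0 ∧ 0 < (hyp z (fun i => conj (z i))).re) ∧ hyp z (castVec ℂ s) = 0 ∧
    hyp z (castVec ℂ h) = 0

lemma isPeriod_smul {h s : Fin 8 → ℤ} {z : Fin 8 → ℂ} {a : ℂ} (ha : a ≠ 0)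
    (hz : IsPeriod h s z) : IsPeriod h s (a • z) := by
  obtain ⟨⟨h1, h2⟩, h3, h4⟩ := hz
  refine ⟨⟨by simp [h1], ?_⟩, by simp [h3], by simp [h4]⟩
  have : (fun i => conj ((a • z) i)) = conj a • fun i => conj (z i) := by
    funext i; simp
  rw [this, map_smul, map_smul, LinearMap.smul_apply, smul_eq_mul, smul_eq_mul, ← mul_assoc,
    mul_comm (conj a), Complex.mul_conj, Complex.re_ofReal_mul]
  exact mul_pos (Complex.normSq_pos.2 ha) h2

lemma isPeriod_smul_iff {h s : Fin 8 → ℤ} {z : Fin 8 → ℂ} {a : ℂ} (ha : a ≠ 0) :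
    IsPeriod h s (a • z) ↔ IsPeriod h s z :=
  ⟨fun hz => by simpa [smul_smul, ha] using isPeriod_smul (inv_ne_zero ha) hz, isPeriod_smul ha⟩

lemma mem_OmegaPerp {h s : Fin 8 → ℤ} {ℓ : ℙ ℂ (Fin 8 → ℂ)} :
    ℓ ∈ OmegaPerp h s ↔ IsPeriod h s ℓ.rep := Iff.rfl

lemma mk_mem_OmegaPerp {h s : Fin 8 → ℤ} {z : Fin 8 → ℂ} (hz : z ≠ 0) :
    Projectivization.mk ℂ z hz ∈ OmegaPerp h s ↔ IsPeriod h s z := by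
  obtain ⟨a, ha⟩ := Projectivization.exists_smul_eq_mk_rep ℂ z hz
  rw [mem_OmegaPerp, ← ha]
  exact isPeriod_smul_iff a.ne_zero

lemma annihilator_smul {F : Type*} [Field F] {a : F} (ha : a ≠ 0) (z : Fin 8 → F) :
    annihilator (a • z) = annihilator z := by
  ext v
  rw [mem_annihilator, mem_annihilator, cliffMat_smul, Matrix.smul_mulVec, smul_eq_zero]
  simp [ha]

lemma isPeriod_toC_add_iff {h s : Fin 8 → ℤ} {x y : Fin 8 → ℝ} :
    IsPeriod h s (toC x + Complex.I • toC y) ↔ ((hyp x x = hyp y y ∧ hyp x y = 0) ∧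
      0 < hyp x x + hyp y y) ∧ (hyp x (castVec ℝ s) = 0 ∧ hyp y (castVec ℝ s) = 0) ∧
        hyp x (castVec ℝ h) = 0 ∧ hyp y (castVec ℝ h) = 0 := by
  have hc : (fun i => conj ((toC x + Complex.I • toC y) i)) = toC x + (-Complex.I) • toC y := by
    funext i
    simp [toC]
  have e1 : hyp (toC x + Complex.I • toC y) (toC x + Complex.I • toC y) =
      (hyp x x - hyp y y : ℝ) + (2 * hyp x y : ℝ) * Complex.I := by
    simp only [map_add, map_smul, LinearMap.add_apply, LinearMap.smul_apply, smul_eq_mul, hyp_toC,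
      hyp_comm y x]
    push_cast
    linear_combination ((hyp y y : ℝ) : ℂ) * Complex.I_mul_I
  have e2 : hyp (toC x + Complex.I • toC y) (toC x + (-Complex.I) • toC y) =
      (hyp x x + hyp y y : ℝ) := by
    simp only [map_add, map_smul, LinearMap.add_apply, LinearMap.smul_apply, smul_eq_mul, hyp_toC,
      hyp_comm y x]
    push_cast
    linear_combination -((hyp y y : ℝ) : ℂ) * Complex.I_mul_I
  have e3 (a : Fin 8 → ℤ) : hyp (toC x + Complex.I • toC y) (castVec ℂ a) =
      (hyp x (castVec ℝ a) : ℝ) + (hyp y (castVec ℝ a) : ℝ) * Complex.I := by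
    rw [← toC_castVec, map_add, LinearMap.add_apply, map_smul, LinearMap.smul_apply, hyp_toC,
      hyp_toC, smul_eq_mul, mul_comm]
  have e4 (a b : ℝ) : (a : ℂ) + b * Complex.I = 0 ↔ a = 0 ∧ b = 0 := by
    simp [Complex.ext_iff]
  rw [IsPeriod, hc, e1, e2, e3, e3, e4, e4, e4, Complex.ofReal_re]
  simp [sub_eq_zero]

lemma IsPeriod.isPosFrame {h s : Fin 8 → ℤ} (P : IsPosPair h s) {x y : Fin 8 → ℝ}
    (hz : IsPeriod h s (toC x + Complex.I • toC y)) :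
    IsPosFrame (castVec ℝ h) (castVec ℝ s) x y ∧ quad x = quad y := by
  obtain ⟨⟨⟨h1, h2⟩, h3⟩, ⟨h4, h5⟩, h6, h7⟩ := isPeriod_toC_add_iff.1 hz
  rw [hyp_self, hyp_self] at h1 h3
  have hpos {a : Fin 8 → ℤ} (ha : 0 < hyp a a) : 0 < quad (castVec ℝ a) := by
    have h1 := hyp_self (castVec ℝ a)
    rw [hyp_castVec] at h1
    have h2 : (0 : ℝ) < (hyp a a : ℤ) := by exact_mod_cast ha
    linarith
  exact ⟨⟨P.ortho_cast ℝ, by rw [hyp_comm, h6], by rw [hyp_comm, h7], by rw [hyp_comm, h4],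
    by rw [hyp_comm, h5], h2, hpos P.h_pos, hpos P.s_pos, by linarith, by linarith⟩, by linarith⟩

lemma eq_zero_of_hyp_toC {z : Fin 8 → ℂ} (hz : ∀ v : Fin 8 → ℝ, hyp z (toC v) = 0) : z = 0 := by
  refine hyp_ext fun w => ?_
  rw [map_zero, hyp_comm, eq_toC_add w, map_add, map_smul, hz, hz]
  simp

lemma hyp_map_mulVec {J : Matrix (Fin 8) (Fin 8) ℝ} (hJ : ∀ v w, hyp (J *ᵥ v) w = -hyp v (J *ᵥ w))
    (z w : Fin 8 → ℂ) : hyp (J.map (algebraMap ℝ ℂ) *ᵥ z) w = -hyp z (J.map (algebraMap ℝ ℂ) *ᵥ w) := by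
  rw [eq_toC_add z, eq_toC_add w]
  simp only [Matrix.mulVec_add, Matrix.mulVec_smul, map_mulVec_toC, map_add, map_smul,
    LinearMap.add_apply, LinearMap.smul_apply, hyp_toC, hJ, smul_eq_mul]
  push_cast
  ring

/-- Moving the skew J across the form turns complex linearity of (z, ·) into an eigenvector equation
for z, with i replaced by -i. -/
lemma isTorusOf_iff {T : ComplexTorus (Fin 8)} (hJ : ∀ v w, hyp (T.J *ᵥ v) w = -hyp v (T.J *ᵥ w))
    (ℓ : ℙ ℂ (Fin 8 → ℂ)) : T.IsTorusOf ℓ ↔ ∀ z, z ∈ annihilator ℓ.rep ↔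
      T.J.map (algebraMap ℝ ℂ) *ᵥ z = -Complex.I • z := by
  refine forall_congr' fun z => iff_congr Iff.rfl ⟨fun h => ?_, fun h v => ?_⟩
  · suffices h0 : T.J.map (algebraMap ℝ ℂ) *ᵥ z - -Complex.I • z = 0 from sub_eq_zero.1 h0
    refine eq_zero_of_hyp_toC fun v => ?_
    have := h v
    change hyp z (toC (T.J *ᵥ v)) = Complex.I * hyp z (toC v) at this
    rw [← map_mulVec_toC] at this
    rw [map_sub, LinearMap.sub_apply, hyp_map_mulVec hJ, this, map_smul, LinearMap.smul_apply,
      smul_eq_mul]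
    ring
  · change hyp z (toC (T.J *ᵥ v)) = Complex.I * hyp z (toC v)
    rw [← map_mulVec_toC, ← neg_eq_iff_eq_neg.2 (hyp_map_mulVec hJ z (toC v)), h, map_smul,
      LinearMap.smul_apply, smul_eq_mul]
    ring

/-- Multiplying the annihilator equation for x + iy by the invertible `cliffAdj y` gives Jz = -iz up
to the factor q(y). -/
lemma IsPosFrame.isTorusOf {h s x y : Fin 8 → ℝ} (H : IsPosFrame h s x y) (hxy : quad x = quad y)
    {ℓ : ℙ ℂ (Fin 8 → ℂ)} (hℓ : ℓ.rep = toC x + Complex.I • toC y) :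
    (H.torus hxy).IsTorusOf ℓ := by
  rw [isTorusOf_iff (T := H.torus hxy) H.hyp_complexStructure]
  intro z
  have hq : ((quad y : ℝ) : ℂ) ≠ 0 := by exact_mod_cast H.y_pos.ne'
  have hJ : (H.torus hxy).J.map (algebraMap ℝ ℂ) =
      ((quad y : ℝ) : ℂ)⁻¹ • (cliffAdj (toC y) * cliffMat (toC x)) := by
    have h1 : twist (toC y) (toC x) = (twist y x).map (algebraMap ℝ ℂ) :=
      twist_map (algebraMap ℝ ℂ) y x
    rw [← twist, h1]
    ext i j
    simp [IsPosFrame.torus, IsPosFrame.complexStructure]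
  have hqC : quad (toC y) = ((quad y : ℝ) : ℂ) := quad_map Complex.ofRealHom y
  rw [mem_annihilator, hℓ, cliffMat_add, cliffMat_smul, Matrix.add_mulVec, Matrix.smul_mulVec, hJ,
    Matrix.smul_mulVec, ← Matrix.mulVec_mulVec]
  constructor
  · intro h0
    rw [eq_neg_of_add_eq_zero_left h0, Matrix.mulVec_neg, Matrix.mulVec_smul, Matrix.mulVec_mulVec,
      cliffAdj_mul_cliffMat, hqC, Matrix.smul_mulVec, Matrix.one_mulVec, smul_neg, smul_comm,
      inv_smul_smul₀ hq, neg_smul]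
  · intro h0
    rw [inv_smul_eq_iff₀ hq] at h0
    have h1 := congrArg (cliffMat (toC y) *ᵥ ·) h0
    simp only [Matrix.mulVec_mulVec, ← Matrix.mul_assoc, cliffMat_mul_cliffAdj, hqC, Matrix.mulVec_smul] at h1
    rw [Matrix.smul_mul, Matrix.one_mul, Matrix.smul_mulVec] at h1
    have h2 := smul_right_injective _ hq h1
    rw [h2, neg_smul, neg_add_cancel]

/-- The set of periods is non-empty. -/
lemma exists_isPeriod (h s : Fin 8 → ℤ) : ∃ z, IsPeriod h s z := by
  let f (a : Fin 8 → ℤ) : Module.Dual ℝ (Fin 4 → ℝ) :=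
    ∑ i : Fin 4, ((a (Fin.castAdd 4 i) : ℝ) + a (Fin.natAdd 4 i)) • LinearMap.proj i
  -- The diagonal vectors (t, t) form a positive definite 4-space. Orthogonality to h and s leaves
  -- room in it for two orthogonal vectors.
  let diag (t : Fin 4 → ℝ) : Fin 8 → ℝ := Fin.append t t
  have hf (a : Fin 8 → ℤ) (t : Fin 4 → ℝ) : hyp (diag t) (castVec ℝ a) = f a t := by
    simp only [hyp, f, castVec, diag, LinearMap.mk₂_apply, Fin.append_left, Fin.append_right,
      LinearMap.sum_apply, LinearMap.smul_apply, LinearMap.proj_apply, smul_eq_mul]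
    exact Finset.sum_congr rfl fun i _ => by ring
  have hd (t u : Fin 4 → ℝ) : hyp (diag t) (diag u) = 2 * ∑ i, t i * u i := by
    simp only [hyp, diag, LinearMap.mk₂_apply, Fin.append_left, Fin.append_right, Finset.mul_sum]
    exact Finset.sum_congr rfl fun i _ => by ring
  have hpos {t : Fin 4 → ℝ} (ht : t ≠ 0) : 0 < hyp (diag t) (diag t) := by
    obtain ⟨i, hi⟩ := Function.ne_iff.1 ht
    rw [hd]
    exact mul_pos two_pos (Finset.sum_pos' (fun i _ => mul_self_nonneg _)
      ⟨i, Finset.mem_univ i, mul_self_pos.2 hi⟩)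
  obtain ⟨t, ht, ht'⟩ := exists_ne_zero_forall_eq_zero (by norm_num : 2 < 4) ![f h, f s]
  obtain ⟨u, hu, hu'⟩ := exists_ne_zero_forall_eq_zero (by norm_num : 3 < 4)
    ![f h, f s, ∑ i : Fin 4, t i • LinearMap.proj i]
  have h2 : ∑ i, t i * u i = 0 := by
    have := hu' 2
    simpa using this
  have pt := hpos ht
  have pu := hpos hu
  have st := Real.mul_self_sqrt pt.le
  have su := Real.mul_self_sqrt pu.le
  -- Scaling each vector by the length of the other equalizes the norms.
  refine ⟨toC (Real.sqrt (hyp (diag u) (diag u)) • diag t) +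
    Complex.I • toC (Real.sqrt (hyp (diag t) (diag t)) • diag u), isPeriod_toC_add_iff.2 ?_⟩
  simp only [map_smul, LinearMap.smul_apply, smul_eq_mul, hf, hd t u, h2]
  rw [show f s t = 0 from ht' 1, show f h t = 0 from ht' 0, show f s u = 0 from hu' 1,
    show f h u = 0 from hu' 0, ← mul_assoc, ← mul_assoc, st, su]
  refine ⟨⟨⟨by ring, by ring⟩, by positivity⟩, by simp⟩

lemma nonempty_OmegaPerp (h s : Fin 8 → ℤ) : (OmegaPerp h s).Nonempty := by
  obtain ⟨z, hz⟩ := exists_isPeriod h s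
  have hz0 : z ≠ 0 := by
    rintro rfl
    have := hz.1.2
    simp at this
  exact ⟨_, (mk_mem_OmegaPerp hz0).2 hz⟩

lemma isProjectiveSubmanifold_OmegaPerp {h s : Fin 8 → ℤ} (P : IsPosPair h s) :
    IsProjectiveSubmanifold 4 (OmegaPerp h s) := by
  intro z hz
  obtain ⟨hz0, hz⟩ := hz
  rw [mk_mem_OmegaPerp] at hz
  let Q : (Fin 8 → ℂ) →L[ℂ] (Fin 8 → ℂ) →L[ℂ] ℂ :=
    LinearMap.toContinuousLinearMap ((LinearMap.toContinuousLinearMap (𝕜 := ℂ) (E := Fin 8 → ℂ)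
      (F' := ℂ)).toLinearMap ∘ₗ hyp)
  have hQ (a b : Fin 8 → ℂ) : Q a b = hyp a b := rfl
  let cs := castVec ℂ s
  let ch := castVec ℂ h
  let zb : Fin 8 → ℂ := fun i => conj (z i)
  have hcont : Continuous fun w : Fin 8 → ℂ => hyp w (fun i => conj (w i)) := by
    simp only [hyp_apply]
    fun_prop
  let F : (Fin 8 → ℂ) → Fin 3 → ℂ := fun w => ![Q w w, Q cs w, Q ch w]
  let F' (w : Fin 8 → ℂ) : (Fin 8 → ℂ) →L[ℂ] Fin 3 → ℂ :=
    ContinuousLinearMap.pi ![(2 : ℂ) • Q w, Q cs, Q ch]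
  have hF (w : Fin 8 → ℂ) : HasFDerivAt F (F' w) w := by
    rw [hasFDerivAt_pi']
    have h0 : HasFDerivAt (fun w => Q w w) ((2 : ℂ) • Q w) w := by
      have h1 := Q.hasFDerivAt_of_bilinear (hasFDerivAt_id w) (hasFDerivAt_id w)
      refine h1.congr_fderiv ?_
      ext1 v
      change hyp w v + hyp v w = 2 * hyp w v
      rw [hyp_comm v w]
      ring
    intro i
    fin_cases i
    · exact h0
    · exact (Q cs).hasFDerivAt
    · exact (Q ch).hasFDerivAt
  -- The cone has dimension 8 - 3 = 5. Besides positivity, the open set demands (w, z̄) ≠ 0 for the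
  -- fixed conjugate of the base point; this gives the submersion and excludes w = 0.
  refine ⟨3, {w | hyp w zb ≠ 0 ∧ 0 < (hyp w (fun i => conj (w i))).re}, F, by simp, ?_, ⟨?_, hz.1.2⟩,
    fun w _ => (hF w).differentiableAt.differentiableWithinAt, fun w hw => ?_, ?_⟩
  · refine IsOpen.inter (isOpen_ne_fun ?_ continuous_const)
      (isOpen_lt continuous_const (Complex.continuous_re.comp hcont))
    exact (Q.flip zb).continuous
  · intro h0
    have := hz.1.2
    rw [show hyp z (fun i => conj (z i)) = 0 from h0] at this
    simp at this
  · rw [(hF w).fderiv]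
    intro u
    have n1 : hyp w zb ≠ 0 := hw.1
    have n2 : hyp cs cs ≠ 0 := by
      rw [hyp_castVec]
      exact_mod_cast P.s_pos.ne'
    have n3 : hyp ch ch ≠ 0 := by
      rw [hyp_castVec]
      exact_mod_cast P.h_pos.ne'
    have hconj {a : Fin 8 → ℤ} (ha : hyp z (castVec ℂ a) = 0) : hyp (castVec ℂ a) zb = 0 := by
      have h1 := hyp_map (starRingEnd ℂ) z (castVec ℂ a)
      rw [ha, map_zero] at h1
      rw [hyp_comm, ← h1]
      congr 1
      funext i
      simp [castVec]
    have e1 : hyp cs zb = 0 := hconj hz.2.1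
    have e2 : hyp ch zb = 0 := hconj hz.2.2
    have e3 : hyp ch cs = 0 := P.ortho_cast ℂ
    have e4 : hyp cs ch = 0 := by rw [hyp_comm, e3]
    -- The vectors s, h and z̄ are orthogonal to one another, so the s- and h-coefficients solve the
    -- linear equations and the z̄-coefficient then corrects the quadratic one.
    refine ⟨(u 1 / hyp cs cs) • cs + (u 2 / hyp ch ch) • ch +
      ((u 0 - 2 * (u 1 / hyp cs cs * hyp w cs + u 2 / hyp ch ch * hyp w ch)) / (2 * hyp w zb)) • zb, ?_⟩
    funext i
    fin_cases i
    · change 2 * hyp w _ = u 0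
      simp only [map_add, map_smul, smul_eq_mul]
      field_simp
      ring
    · change hyp cs _ = u 1
      simp only [map_add, map_smul, smul_eq_mul, e1, e4]
      field_simp
      ring
    · change hyp ch _ = u 2
      simp only [map_add, map_smul, smul_eq_mul, e2, e3]
      field_simp
      ring
  · ext w
    have hFw : F w = 0 ↔ hyp w w = 0 ∧ hyp w cs = 0 ∧ hyp w ch = 0 := by
      rw [hyp_comm w cs, hyp_comm w ch]
      simp [F, hQ, funext_iff, Fin.forall_fin_succ]
    constructor
    · rintro ⟨⟨hw0, hw⟩, hD⟩
      have hw := (mk_mem_OmegaPerp hw0).1 hw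
      exact ⟨hD, hFw.2 ⟨hw.1.1, hw.2⟩⟩
    · rintro ⟨hD, hw⟩
      obtain ⟨h1, h2⟩ := hFw.1 hw
      have hw0 : w ≠ 0 := by
        rintro rfl
        exact hD.1 (by simp)
      exact ⟨⟨hw0, (mk_mem_OmegaPerp hw0).2 ⟨⟨h1, hD.2⟩, h2⟩⟩, hD⟩

end Periods


/-! ### Recovering the period from a compatible complex structure -/

section Completeness

lemma cliffMat_zero {F : Type*} [CommRing F] : cliffMat (0 : Fin 8 → F) = 0 := by
  rw [← zero_smul F (0 : Fin 8 → F), cliffMat_smul, zero_smul]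

lemma cliffTwo_eq_zero {F : Type*} [CommRing F] {v w z : Fin 8 → F} (hw : w ∈ annihilator z)
    (h : hyp w v = 0) : cliffOdd w *ᵥ (cliffMat z *ᵥ v) = 0 := by
  have h1 := cliffTwo_add w v z
  rwa [cliffTwo, cliffTwo, mem_annihilator.1 hw, Matrix.mulVec_zero, add_zero, h, zero_smul] at h1

lemma cliffMat_cliffTwo_mulVec {F : Type*} [CommRing F] {u v w z : Fin 8 → F}
    (h : hyp w v = 0) (hw : w ∈ annihilator z) :
    cliffMat (cliffTwo u v z) *ᵥ w = hyp w u • (cliffMat z *ᵥ v) := by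
  have h1 := cliffMat_cliffOdd_add w u (cliffMat z *ᵥ v)
  rwa [cliffTwo_eq_zero hw h, cliffMat_zero, Matrix.zero_mulVec, add_zero] at h1

lemma mem_annihilator_cliffTwo {F : Type*} [CommRing F] {u v w z : Fin 8 → F}
    (hu : hyp w u = 0) (hv : hyp w v = 0) (hw : w ∈ annihilator z) :
    w ∈ annihilator (cliffTwo u v z) := by
  rw [mem_annihilator, cliffMat_cliffTwo_mulVec hv hw, hu, zero_smul]

lemma left_mem_annihilator_cliffTwo {F : Type*} [Field F] [CharZero F] {u : Fin 8 → F}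
    (hu : hyp u u = 0) (v z : Fin 8 → F) : u ∈ annihilator (cliffTwo u v z) := by
  rw [mem_annihilator, cliffTwo]
  have h1 := cliffMat_cliffOdd_add u u (cliffMat z *ᵥ v)
  rw [hu, zero_smul, ← two_smul F] at h1
  exact (smul_eq_zero.1 h1).resolve_left two_ne_zero

lemma cliffTwo_swap {F : Type*} [CommRing F] {u v : Fin 8 → F} (h : hyp u v = 0) (z : Fin 8 → F) :
    cliffTwo u v z = -cliffTwo v u z :=
  eq_neg_of_add_eq_zero_left (by rw [cliffTwo_add, h, zero_smul])

lemma right_mem_annihilator_cliffTwo {F : Type*} [Field F] [CharZero F] {u v : Fin 8 → F}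
    (hv : hyp v v = 0) (h : hyp u v = 0) (z : Fin 8 → F) : v ∈ annihilator (cliffTwo u v z) := by
  rw [cliffTwo_swap h, ← neg_one_smul F, annihilator_smul (neg_ne_zero.2 one_ne_zero)]
  exact left_mem_annihilator_cliffTwo hv u z

lemma quad_eq_zero_of_mem {F : Type*} [Field F] {v z : Fin 8 → F} (hv : v ∈ annihilator z)
    (hv0 : v ≠ 0) : quad z = 0 := by
  have h1 : cliffAdj z *ᵥ (cliffMat z *ᵥ v) = quad z • v := by
    rw [Matrix.mulVec_mulVec, cliffAdj_mul_cliffMat, Matrix.smul_mulVec, Matrix.one_mulVec]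
  rw [mem_annihilator.1 hv, Matrix.mulVec_zero] at h1
  exact (smul_eq_zero.1 h1.symm).resolve_right hv0

/-- The polarized Clifford relation applied to v makes (z, w)v vanish. This gives the orthogonality
of a period to κ and κ̄, and shows that z and z̄ have no common annihilated vector when (z, z̄) ≠ 0.
-/
lemma hyp_eq_zero_of_mem {F : Type*} [Field F] {v z w : Fin 8 → F} (hz : v ∈ annihilator z)
    (hw : v ∈ annihilator w) (hv0 : v ≠ 0) : hyp z w = 0 := by
  have h1 : cliffAdj z *ᵥ (cliffMat w *ᵥ v) + cliffAdj w *ᵥ (cliffMat z *ᵥ v) = hyp z w • v := by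
    rw [Matrix.mulVec_mulVec, Matrix.mulVec_mulVec, ← Matrix.add_mulVec, cliffAdj_mul_cliffMat_add,
      Matrix.smul_mulVec, Matrix.one_mulVec]
  rw [mem_annihilator.1 hz, mem_annihilator.1 hw, Matrix.mulVec_zero, Matrix.mulVec_zero,
    add_zero] at h1
  exact (smul_eq_zero.1 h1.symm).resolve_right hv0

/-- The norm of `u · v · z'` with respect to `u' · v' · z`. -/
lemma hyp_cliffTwo_conj {F : Type*} [CommRing F] {u v u' v' z z' : Fin 8 → F}
    (hu' : u' ∈ annihilator z') (hv' : v' ∈ annihilator z') (huv : hyp u' v = 0) :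
    hyp (cliffTwo u v z') (cliffTwo u' v' z) = hyp u' u * hyp v v' * hyp z' z := by
  have h4 : cliffAdj z' *ᵥ (cliffMat z *ᵥ v') + cliffAdj z *ᵥ (cliffMat z' *ᵥ v') =
      hyp z' z • v' := by
    rw [Matrix.mulVec_mulVec, Matrix.mulVec_mulVec, ← Matrix.add_mulVec, cliffAdj_mul_cliffMat_add,
      Matrix.smul_mulVec, Matrix.one_mulVec]
  rw [mem_annihilator.1 hv', Matrix.mulVec_zero, add_zero] at h4
  rw [hyp_cliffTwo, cliffMat_cliffTwo_mulVec huv hu', map_smul, LinearMap.smul_apply, hyp_cliffMat_mulVec, h4, map_smul,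
    smul_eq_mul, smul_eq_mul]
  ring

/-- Isotropic spinors with the same annihilator are proportional. -/
lemma mk_eq_mk_of_annihilator_eq {w z : Fin 8 → ℂ} (hw : w ≠ 0) (hz : z ≠ 0) (hq : quad z = 0)
    (h : annihilator w = annihilator z) :
    Projectivization.mk ℂ w hw = Projectivization.mk ℂ z hz := by
  -- The image of `cliffAdj z` lies in the annihilator of z, hence in that of w.
  have h0 : cliffMat w * cliffAdj z = 0 := by
    refine Matrix.mulVec_injective (funext fun v => ?_)
    rw [← Matrix.mulVec_mulVec, Matrix.zero_mulVec, ← mem_annihilator, h, mem_annihilator,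
      Matrix.mulVec_mulVec, cliffMat_mul_cliffAdj, hq, zero_smul, Matrix.zero_mulVec]
  obtain ⟨j, hj⟩ := Function.ne_iff.1 hz
  rw [Projectivization.mk_eq_mk_iff']
  refine ⟨w j / z j, funext fun i => ?_⟩
  have := proportional_of_cliffMat_mul_cliffAdj_eq_zero h0 i j
  have hj : z j ≠ 0 := hj
  simp only [Pi.smul_apply, smul_eq_mul]
  field_simp
  linear_combination -this

/-- The vector `v + i J v`, on which `J` acts as `-i`. -/
def holVec (J : Matrix (Fin 8) (Fin 8) ℝ) (v : Fin 8 → ℝ) : Fin 8 → ℂ :=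
  toC v + Complex.I • toC (J *ᵥ v)

lemma toC_add (v w : Fin 8 → ℝ) : toC (v + w) = toC v + toC w := by
  funext i; simp [toC]

lemma toC_smul (a : ℝ) (v : Fin 8 → ℝ) : toC (a • v) = (a : ℂ) • toC v := by
  funext i; simp [toC]

variable {J : Matrix (Fin 8) (Fin 8) ℝ}

lemma holVec_add (v w : Fin 8 → ℝ) : holVec J (v + w) = holVec J v + holVec J w := by
  rw [holVec, holVec, holVec, Matrix.mulVec_add, toC_add, toC_add, smul_add]
  abel

lemma holVec_smul (a : ℝ) (v : Fin 8 → ℝ) : holVec J (a • v) = (a : ℂ) • holVec J v := by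
  rw [holVec, holVec, Matrix.mulVec_smul, toC_smul, toC_smul, smul_add, smul_comm]

lemma holVec_mulVec (hJ : J * J = -1) (v : Fin 8 → ℝ) :
    holVec J (J *ᵥ v) = -Complex.I • holVec J v := by
  rw [holVec, holVec, Matrix.mulVec_mulVec, hJ, Matrix.neg_mulVec, Matrix.one_mulVec,
    ← neg_one_smul ℝ v, toC_smul, smul_add, smul_smul, smul_smul, neg_mul, Complex.I_mul_I]
  simp [add_comm]

lemma map_mulVec_holVec {N : Matrix (Fin 8) (Fin 8) ℝ} (hN : N * J = J * N) (v : Fin 8 → ℝ) :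
    N.map (algebraMap ℝ ℂ) *ᵥ holVec J v = holVec J (N *ᵥ v) := by
  rw [holVec, holVec, Matrix.mulVec_add, Matrix.mulVec_smul, map_mulVec_toC, map_mulVec_toC,
    Matrix.mulVec_mulVec, Matrix.mulVec_mulVec, hN]

lemma conj_holVec (v : Fin 8 → ℝ) :
    (fun i => conj (holVec J v i)) = toC v + (-Complex.I) • toC (J *ᵥ v) := by
  funext i
  simp [holVec, toC]

lemma exists_eq_holVec {z : Fin 8 → ℂ}
    (hz : J.map (algebraMap ℝ ℂ) *ᵥ z = -Complex.I • z) : ∃ v, z = holVec J v := by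
  refine ⟨fun i => (z i).re, ?_⟩
  have h1 := hz
  rw [eq_toC_add z, Matrix.mulVec_add, Matrix.mulVec_smul, map_mulVec_toC, map_mulVec_toC] at h1
  rw [holVec]
  nth_rw 1 [eq_toC_add z]
  congr 2
  funext i
  have h2 := congrArg Complex.re (congr_fun h1 i)
  simp [toC] at h2
  simp [toC, h2]

lemma hyp_holVec_conj (hJ : J * J = -1) (hs : ∀ v w, hyp (J *ᵥ v) w = -hyp v (J *ᵥ w))
    (v w : Fin 8 → ℝ) : hyp (holVec J v) (fun i => conj (holVec J w i)) =
      (2 * hyp v w : ℝ) + (2 * hyp (J *ᵥ v) w : ℝ) * Complex.I := by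
  have h1 : hyp (J *ᵥ v) (J *ᵥ w) = hyp v w := by
    rw [hs, Matrix.mulVec_mulVec, hJ, Matrix.neg_mulVec, Matrix.one_mulVec, map_neg, neg_neg]
  have h2 : hyp v (J *ᵥ w) = -hyp (J *ᵥ v) w := by rw [hs, neg_neg]
  rw [conj_holVec, holVec]
  simp only [map_add, map_smul, LinearMap.add_apply, LinearMap.smul_apply, smul_eq_mul, hyp_toC,
    h1, h2]
  push_cast
  linear_combination -((hyp v w : ℝ) : ℂ) * Complex.I_mul_I

lemma hyp_eigenvec_eq_zero (hs : ∀ v w, hyp (J *ᵥ v) w = -hyp v (J *ᵥ w)) {z w : Fin 8 → ℂ}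
    (hz : J.map (algebraMap ℝ ℂ) *ᵥ z = -Complex.I • z)
    (hw : J.map (algebraMap ℝ ℂ) *ᵥ w = -Complex.I • w) : hyp z w = 0 := by
  have h1 := hyp_map_mulVec hs z w
  rw [hz, hw, map_smul, map_smul, LinearMap.smul_apply, smul_eq_mul] at h1
  have h2 : Complex.I * hyp z w = 0 := by linear_combination -h1 / 2
  exact (mul_eq_zero.1 h2).resolve_left Complex.I_ne_zero

lemma IsPosPair.mem_annihilator_of_mulVec {h s : Fin 8 → ℤ} (P : IsPosPair h s) {δ : ℂ}
    (hδ : δ * δ = -(dd h s : ℂ)) {v : Fin 8 → ℂ}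
    (hv : sqrtMat (castVec ℂ h) (castVec ℂ s) *ᵥ v = δ • v) :
    v ∈ annihilator (δ • castVec ℂ h + ((hyp h h : ℤ) : ℂ) • castVec ℂ s) := by
  have hd : (dd h s : ℂ) ≠ 0 := by exact_mod_cast P.dd_pos.ne'
  have hδ0 : δ ≠ 0 := by rintro rfl; simp [hd] at hδ
  have h1 : ((hyp s s : ℤ) : ℂ) • (cliffMat (castVec ℂ h) *ᵥ v) =
      δ • (cliffMat (castVec ℂ s) *ᵥ v) := by
    rw [← Matrix.mulVec_smul _ δ, ← hv, sqrtMat, twist, Matrix.smul_mulVec, Matrix.mulVec_smul,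
      Matrix.mulVec_mulVec, ← Matrix.mul_assoc, cliffMat_mul_cliffAdj, Matrix.smul_mul,
      Matrix.one_mul, Matrix.smul_mulVec, smul_smul, ← hyp_self, hyp_castVec]
  rw [mem_annihilator, cliffMat_add, cliffMat_smul, cliffMat_smul, Matrix.add_mulVec,
    Matrix.smul_mulVec, Matrix.smul_mulVec]
  suffices h2 : δ • (δ • (cliffMat (castVec ℂ h) *ᵥ v) +
      ((hyp h h : ℤ) : ℂ) • (cliffMat (castVec ℂ s) *ᵥ v)) = 0 from
    (smul_eq_zero.1 h2).resolve_left hδ0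
  rw [smul_add, smul_smul, hδ, smul_comm δ, ← h1, smul_smul, ← add_smul, dd]
  push_cast
  rw [neg_add_cancel, zero_smul]

/-- A complex structure which is orthogonal and commutes with `√(-d)`. -/
structure IsCompatible (h s : Fin 8 → ℤ) (J : Matrix (Fin 8) (Fin 8) ℝ) : Prop where
  sq : J * J = -1
  comm : sqrtMat (castVec ℝ h) (castVec ℝ s) * J = J * sqrtMat (castVec ℝ h) (castVec ℝ s)
  skew : ∀ v w, hyp (J *ᵥ v) w = -hyp v (J *ᵥ w)

namespace IsCompatible

variable {h s : Fin 8 → ℤ}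

lemma mulVec_mulVec (C : IsCompatible h s J) (v : Fin 8 → ℝ) : J *ᵥ (J *ᵥ v) = -v := by
  rw [Matrix.mulVec_mulVec, C.sq, Matrix.neg_mulVec, Matrix.one_mulVec]

lemma map_mulVec_eigen (C : IsCompatible h s J) (v : Fin 8 → ℝ) :
    J.map (algebraMap ℝ ℂ) *ᵥ holVec J v = -Complex.I • holVec J v := by
  rw [map_mulVec_holVec rfl, holVec_mulVec C.sq]

lemma sqrtMat_holVec (C : IsCompatible h s J) {c : ℝ} {v : Fin 8 → ℝ}
    (hv : sqrtMat (castVec ℝ h) (castVec ℝ s) *ᵥ v = c • (J *ᵥ v)) :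
    sqrtMat (castVec ℂ h) (castVec ℂ s) *ᵥ holVec J v = (-(c * Complex.I)) • holVec J v := by
  have h1 : sqrtMat (castVec ℂ h) (castVec ℂ s) =
      (sqrtMat (castVec ℝ h) (castVec ℝ s)).map (algebraMap ℝ ℂ) := by
    rw [← sqrtMat_map]
    congr 1
  rw [h1, map_mulVec_holVec C.comm, hv, holVec_smul, holVec_mulVec C.sq, smul_smul, mul_neg]

/-- A non-zero vector of the eigenspace gives a common annihilated vector. -/
lemma holVec_mem_kappa (C : IsCompatible h s J) (P : IsPosPair h s) {v : Fin 8 → ℝ}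
    (hv : sqrtMat (castVec ℝ h) (castVec ℝ s) *ᵥ v = (-Real.sqrt (dd h s)) • (J *ᵥ v)) :
    holVec J v ∈ annihilator (kappa h s) := by
  refine P.mem_annihilator_of_mulVec (sqrtNeg_mul_self P.dd_pos) ?_
  rw [C.sqrtMat_holVec hv, sqrtNeg]
  simp

lemma holVec_mem_kappaBar (C : IsCompatible h s J) (P : IsPosPair h s) {v : Fin 8 → ℝ}
    (hv : sqrtMat (castVec ℝ h) (castVec ℝ s) *ᵥ v = Real.sqrt (dd h s) • (J *ᵥ v)) :
    holVec J v ∈ annihilator (kappaBar h s) := by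
  refine P.mem_annihilator_of_mulVec
    (by rw [neg_mul_neg, sqrtNeg_mul_self P.dd_pos]) ?_
  rw [C.sqrtMat_holVec hv, sqrtNeg]

lemma mulVec_split (C : IsCompatible h s J) (P : IsPosPair h s) (v : Fin 8 → ℝ) :
    ∃ a b, v = a + b ∧
      sqrtMat (castVec ℝ h) (castVec ℝ s) *ᵥ a = (-Real.sqrt (dd h s)) • (J *ᵥ a) ∧
      sqrtMat (castVec ℝ h) (castVec ℝ s) *ᵥ b = Real.sqrt (dd h s) • (J *ᵥ b) := by
  have hc : 0 < Real.sqrt (dd h s) := Real.sqrt_pos.2 (by exact_mod_cast P.dd_pos)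
  have hcc : Real.sqrt (dd h s) * Real.sqrt (dd h s) = dd h s :=
    Real.mul_self_sqrt (by exact_mod_cast P.dd_pos.le)
  have hNJ (w : Fin 8 → ℝ) : J *ᵥ (sqrtMat (castVec ℝ h) (castVec ℝ s) *ᵥ w) =
      sqrtMat (castVec ℝ h) (castVec ℝ s) *ᵥ (J *ᵥ w) := by
    rw [Matrix.mulVec_mulVec, ← C.comm, Matrix.mulVec_mulVec]
  have hNN (w : Fin 8 → ℝ) : sqrtMat (castVec ℝ h) (castVec ℝ s) *ᵥ
      (sqrtMat (castVec ℝ h) (castVec ℝ s) *ᵥ w) = (-(dd h s : ℝ)) • w := by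
    rw [Matrix.mulVec_mulVec, P.sqrtMat_sq, Matrix.smul_mulVec, Matrix.one_mulVec]
  set N := sqrtMat (castVec ℝ h) (castVec ℝ s)
  set c := Real.sqrt (dd h s)
  -- JN/√d is an involution, since J and N commute, J² = -1 and N² = -d; these are its two
  -- projections.
  refine ⟨(1 / 2 : ℝ) • v + (1 / (2 * c)) • (J *ᵥ (N *ᵥ v)),
    (1 / 2 : ℝ) • v - (1 / (2 * c)) • (J *ᵥ (N *ᵥ v)), ?_, ?_, ?_⟩
  · rw [add_add_sub_cancel, ← add_smul]
    norm_num
  all_goals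
    simp only [Matrix.mulVec_add, Matrix.mulVec_sub, Matrix.mulVec_smul, C.mulVec_mulVec, ← hNJ,
      hNN, ← hcc]
    funext i
    simp only [Pi.add_apply, Pi.sub_apply, Pi.smul_apply, smul_eq_mul, Pi.neg_apply]
    field_simp
    ring

lemma hyp_mulVec_mulVec (C : IsCompatible h s J) (v w : Fin 8 → ℝ) :
    hyp (J *ᵥ v) (J *ᵥ w) = hyp v w := by
  rw [C.skew, C.mulVec_mulVec, map_neg, neg_neg]

lemma hyp_mulVec_self (C : IsCompatible h s J) (v : Fin 8 → ℝ) : hyp (J *ᵥ v) v = 0 := by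
  have := C.skew v v
  rw [hyp_comm v] at this
  linarith

/-- The vectors on which `√(-d)` acts as `c J`. -/
def eigenKer (h s : Fin 8 → ℤ) (J : Matrix (Fin 8) (Fin 8) ℝ) (c : ℝ) : Submodule ℝ (Fin 8 → ℝ) :=
  LinearMap.ker (sqrtMat (castVec ℝ h) (castVec ℝ s) - c • J).toLin'

lemma mem_eigenKer {c : ℝ} {v : Fin 8 → ℝ} : v ∈ eigenKer h s J c ↔
    sqrtMat (castVec ℝ h) (castVec ℝ s) *ᵥ v = c • (J *ᵥ v) := by
  rw [eigenKer, LinearMap.mem_ker, Matrix.toLin'_apply, Matrix.sub_mulVec, Matrix.smul_mulVec,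
    sub_eq_zero]

lemma mulVec_mem_eigenKer (C : IsCompatible h s J) {c : ℝ} {v : Fin 8 → ℝ}
    (hv : v ∈ eigenKer h s J c) : J *ᵥ v ∈ eigenKer h s J c := by
  rw [mem_eigenKer] at hv ⊢
  rw [Matrix.mulVec_mulVec, C.comm, ← Matrix.mulVec_mulVec, hv, Matrix.mulVec_smul]

lemma finrank_eigenKer (C : IsCompatible h s J) (P : IsPosPair h s) :
    Module.finrank ℝ (eigenKer h s J (-Real.sqrt (dd h s))) +
      Module.finrank ℝ (eigenKer h s J (Real.sqrt (dd h s))) = 8 := by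
  have hc : 0 < Real.sqrt (dd h s) := Real.sqrt_pos.2 (by exact_mod_cast P.dd_pos)
  have hcompl : IsCompl (eigenKer h s J (-Real.sqrt (dd h s)))
      (eigenKer h s J (Real.sqrt (dd h s))) := by
    refine ⟨Submodule.disjoint_def.2 fun v h1 h2 => ?_,
      Submodule.codisjoint_iff_exists_add_eq.2 fun v => ?_⟩
    · rw [mem_eigenKer] at h1 h2
      rw [h2, ← sub_eq_zero, ← sub_smul, smul_eq_zero] at h1
      have h3 := h1.resolve_left (by linarith)
      have h4 := C.mulVec_mulVec v
      rw [h3, Matrix.mulVec_zero] at h4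
      exact neg_eq_zero.1 h4.symm
    · obtain ⟨a, b, hab, ha, hb⟩ := C.mulVec_split P v
      exact ⟨a, b, mem_eigenKer.2 ha, mem_eigenKer.2 hb, hab.symm⟩
  simpa using Submodule.finrank_add_eq_of_isCompl hcompl

/-- A definite eigenspace of real dimension four has a `J`-stable orthogonal frame. -/
lemma exists_frame (C : IsCompatible h s J) {c ε : ℝ} (h4 : Module.finrank ℝ (eigenKer h s J c) = 4)
    (hdef : ∀ v ∈ eigenKer h s J c, v ≠ 0 → 0 < ε * hyp v v) :
    ∃ v ∈ eigenKer h s J c, ∃ w ∈ eigenKer h s J c, v ≠ 0 ∧ w ≠ 0 ∧ hyp v w = 0 ∧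
      hyp (J *ᵥ v) w = 0 ∧ ∀ u ∈ eigenKer h s J c, ∃ a : Fin 4 → ℝ,
        u = a 0 • v + a 1 • (J *ᵥ v) + a 2 • w + a 3 • (J *ᵥ w) := by
  obtain ⟨v, hv, hv0, -⟩ := exists_mem_ne_zero_of_two_lt_finrank (eigenKer h s J c) (by omega) 0 0
  -- Orthogonality to v and Jv is two conditions on a 4-dimensional space. Definiteness then makes
  -- v, Jv, w, Jw an orthogonal basis.
  obtain ⟨w, hw, hw0, h1, h2⟩ := exists_mem_ne_zero_of_two_lt_finrank (eigenKer h s J c) (by omega)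
    (hyp v) (hyp (J *ᵥ v))
  refine ⟨v, hv, w, hw, hv0, hw0, h1, h2, fun u hu => ?_⟩
  let b : Fin 4 → Fin 8 → ℝ := ![v, J *ᵥ v, w, J *ᵥ w]
  have hb (i : Fin 4) : b i ∈ eigenKer h s J c := by
    fin_cases i
    exacts [hv, C.mulVec_mem_eigenKer hv, hw, C.mulVec_mem_eigenKer hw]
  have hvv : hyp v v ≠ 0 := fun h0 => by simpa [h0] using hdef v hv hv0
  have hww : hyp w w ≠ 0 := fun h0 => by simpa [h0] using hdef w hw hw0
  have h3 : hyp v (J *ᵥ w) = 0 := by rw [← neg_eq_zero, ← C.skew, h2]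
  have hli : LinearIndependent ℝ b := by
    refine LinearMap.linearIndependent_of_isOrthoᵢ (B := hyp) (fun i j hij => ?_) fun i => ?_
    · fin_cases i <;> fin_cases j <;> first | exact absurd rfl hij | skip
      all_goals simp [b, Function.onFun, C.hyp_mulVec_self, C.hyp_mulVec_mulVec,
        h1, h2, h3, hyp_comm v (J *ᵥ v), hyp_comm w (J *ᵥ w), hyp_comm w v, hyp_comm w (J *ᵥ v),
        hyp_comm (J *ᵥ w) v]
    · fin_cases i <;> simpa [b, C.hyp_mulVec_mulVec]
  have hspan : Submodule.span ℝ (Set.range b) = eigenKer h s J c :=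
    Submodule.eq_of_le_of_finrank_eq (Submodule.span_le.2 (Set.range_subset_iff.2 hb))
      (by rw [finrank_span_eq_card hli, h4, Fintype.card_fin])
  rw [← hspan, Submodule.mem_span_range_iff_exists_fun] at hu
  obtain ⟨a, rfl⟩ := hu
  exact ⟨a, by simp [Fin.sum_univ_four, b]⟩

/-- For v, w spanning the first eigenspace over J, put z = (v + iJv)·(w + iJw)·κ̄. It is annihilated
by both of these vectors and by the -i-eigenvectors of J in Z_κ̄, hence by the whole -i-eigenspace.
Its norm (z, z̄) is 4(v,v)(w,w)(κ, κ̄), positive because the form is definite on the eigenspace. -/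
lemma exists_isPeriod (C : IsCompatible h s J) (P : IsPosPair h s) {ε : ℝ}
    (h4 : Module.finrank ℝ (eigenKer h s J (-Real.sqrt (dd h s))) = 4)
    (hdef : ∀ v ∈ eigenKer h s J (-Real.sqrt (dd h s)), v ≠ 0 → 0 < ε * hyp v v) :
    ∃ z, IsPeriod h s z ∧
      ∀ u, u ∈ annihilator z ↔ J.map (algebraMap ℝ ℂ) *ᵥ u = -Complex.I • u := by
  have h4' : Module.finrank ℝ (eigenKer h s J (Real.sqrt (dd h s))) = 4 := by
    have := C.finrank_eigenKer P
    omega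
  obtain ⟨v, hv, w, hw, hv0, hw0, hvw, hJvw, hspan⟩ := C.exists_frame h4 hdef
  obtain ⟨t, ht, ht0, -⟩ := exists_mem_ne_zero_of_two_lt_finrank
    (eigenKer h s J (Real.sqrt (dd h s))) (by omega) 0 0
  have hne {x : Fin 8 → ℝ} (hx : x ≠ 0) : holVec J x ≠ 0 := by
    intro h0
    refine hx (funext fun i => ?_)
    simpa [holVec, toC] using congrArg Complex.re (congr_fun h0 i)
  have iso (x y : Fin 8 → ℝ) : hyp (holVec J x) (holVec J y) = 0 :=
    hyp_eigenvec_eq_zero C.skew (C.map_mulVec_eigen x) (C.map_mulVec_eigen y)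
  have hconjk : (fun i => conj (kappaBar h s i)) = kappa h s := by
    funext i
    simp [kappa, kappaBar, conj_sqrtNeg]
  have hannc {a b : Fin 8 → ℂ} (hab : a ∈ annihilator b) :
      (fun i => conj (a i)) ∈ annihilator fun i => conj (b i) := by
    rw [mem_annihilator] at hab ⊢
    have h1 := cliffMat_map (starRingEnd ℂ) b
    rw [h1]
    funext i
    rw [show (fun i => conj (a i)) = starRingEnd ℂ ∘ a from rfl, ← RingHom.map_mulVec, hab]
    simp
  set z := cliffTwo (holVec J v) (holVec J w) (kappaBar h s) with hz
  have hconjz : (fun i => conj (z i)) = cliffTwo (fun i => conj (holVec J v i))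
      (fun i => conj (holVec J w i)) (kappa h s) := by
    rw [← hconjk]
    exact (cliffTwo_map (starRingEnd ℂ) _ _ _).symm
  have hvk := C.holVec_mem_kappa P (mem_eigenKer.1 hv)
  have hwk := C.holVec_mem_kappa P (mem_eigenKer.1 hw)
  have hconjkb : (fun i => conj (kappa h s i)) = kappaBar h s := by
    funext i
    simp [kappa, kappaBar, conj_sqrtNeg]
  have hvz : holVec J v ∈ annihilator z := left_mem_annihilator_cliffTwo (iso _ _) _ _
  have hwz : holVec J w ∈ annihilator z := right_mem_annihilator_cliffTwo (iso _ _) (iso _ _) _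
  have htz {x : Fin 8 → ℝ} (hx : x ∈ eigenKer h s J (Real.sqrt (dd h s))) :
      holVec J x ∈ annihilator z :=
    mem_annihilator_cliffTwo (iso _ _) (iso _ _) (C.holVec_mem_kappaBar P (mem_eigenKer.1 hx))
  have hquad : quad z = 0 := quad_eq_zero_of_mem hvz (hne hv0)
  have hzz : hyp z z = 0 := by rw [hyp_self, hquad, mul_zero]
  have hnorm : hyp z (fun i => conj (z i)) =
      ((4 * (hyp v v * hyp w w) * (2 * dd h s * hyp h h : ℤ) : ℝ) : ℂ) := by
    have e1 : hyp (fun i => conj (holVec J v i)) (holVec J w) = 0 := by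
      rw [hyp_comm, hyp_holVec_conj C.sq C.skew, hyp_comm w v, hvw, hyp_comm _ v, ← neg_eq_zero]
      have : hyp v (J *ᵥ w) = 0 := by rw [← neg_eq_zero, ← C.skew, hJvw]
      simp [this]
    have m1 := hannc hvk
    have m2 := hannc hwk
    rw [hconjkb] at m1 m2
    rw [hconjz, hz, hyp_cliffTwo_conj m1 m2 e1, hyp_comm _ (holVec J v),
      hyp_holVec_conj C.sq C.skew, hyp_holVec_conj C.sq C.skew, hyp_comm (kappaBar h s),
      P.hyp_kappa_kappaBar, C.hyp_mulVec_self, C.hyp_mulVec_self]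
    push_cast
    ring
  have hpos : 0 < (hyp z (fun i => conj (z i))).re := by
    rw [hnorm, Complex.ofReal_re]
    have p1 := mul_pos (hdef v hv hv0) (hdef w hw hw0)
    have p2 : 0 < hyp v v * hyp w w := by
      have p3 : 0 < (ε * ε) * (hyp v v * hyp w w) := by linarith
      exact pos_of_mul_pos_right p3 (mul_self_nonneg ε)
    have p4 : (0 : ℝ) < (2 * dd h s * hyp h h : ℤ) := by
      have := mul_pos (mul_pos two_pos P.dd_pos) P.h_pos
      exact_mod_cast this
    positivity
  have hk1 : hyp z (kappa h s) = 0 := hyp_eq_zero_of_mem hvz hvk (hne hv0)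
  have hk2 : hyp z (kappaBar h s) = 0 :=
    hyp_eq_zero_of_mem (htz ht) (C.holVec_mem_kappaBar P (mem_eigenKer.1 ht)) (hne ht0)
  have hhs : hyp z (castVec ℂ s) = 0 ∧ hyp z (castVec ℂ h) = 0 := by
    rw [IsPosPair.kappa_eq, map_add, map_smul, map_smul, smul_eq_mul, smul_eq_mul] at hk1
    rw [IsPosPair.kappaBar_eq, map_add, map_smul, map_smul, smul_eq_mul, smul_eq_mul] at hk2
    have n1 : ((hyp h h : ℤ) : ℂ) ≠ 0 := by exact_mod_cast P.h_pos.ne'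
    have n2 := sqrtNeg_ne_zero P.dd_pos
    refine ⟨(mul_eq_zero.1 ?_).resolve_left n1, (mul_eq_zero.1 ?_).resolve_left n2⟩
    · linear_combination (hk1 + hk2) / 2
    · linear_combination (hk1 - hk2) / 2
  have hsub (x : Fin 8 → ℝ) : holVec J x ∈ annihilator z := by
    obtain ⟨a, b, rfl, ha, hb⟩ := C.mulVec_split P x
    obtain ⟨r, rfl⟩ := hspan a (mem_eigenKer.2 ha)
    simp only [holVec_add, holVec_smul, holVec_mulVec C.sq]
    exact Submodule.add_mem _ (Submodule.add_mem _ (Submodule.add_mem _ (Submodule.add_mem _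
      (Submodule.smul_mem _ _ hvz) (Submodule.smul_mem _ _ (Submodule.smul_mem _ _ hvz)))
      (Submodule.smul_mem _ _ hwz)) (Submodule.smul_mem _ _ (Submodule.smul_mem _ _ hwz)))
      (htz (mem_eigenKer.2 hb))
  refine ⟨z, ⟨⟨hzz, hpos⟩, hhs⟩, fun u => ⟨fun hu => ?_, fun hu => ?_⟩⟩
  · set a : Fin 8 → ℝ := fun i => (u i).re
    set b : Fin 8 → ℝ := fun i => (u i).im
    have hu' : u = toC a + Complex.I • toC b := eq_toC_add u
    have hJu : J.map (algebraMap ℝ ℂ) *ᵥ u = toC (J *ᵥ a) + Complex.I • toC (J *ᵥ b) := by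
      rw [hu', Matrix.mulVec_add, Matrix.mulVec_smul, map_mulVec_toC, map_mulVec_toC]
    have hp : u + Complex.I • (J.map (algebraMap ℝ ℂ) *ᵥ u) =
        holVec J a + Complex.I • holVec J b := by
      rw [hJu, holVec, holVec, hu']
      module
    have hq : u - Complex.I • (J.map (algebraMap ℝ ℂ) *ᵥ u) =
        (fun i => conj (holVec J a i)) + Complex.I • fun i => conj (holVec J b i) := by
      rw [hJu, conj_holVec, conj_holVec, hu']
      module
    -- This vector is twice the +i-part of u. It lies in the annihilators of both z and z̄, so it
    -- vanishes because (z, z̄) ≠ 0.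
    have m1 : u - Complex.I • (J.map (algebraMap ℝ ℂ) *ᵥ u) ∈ annihilator z := by
      have h1 := Submodule.sub_mem _ (Submodule.smul_mem _ (2 : ℂ) hu)
        (Submodule.add_mem _ (hsub a) (Submodule.smul_mem _ Complex.I (hsub b)))
      rw [← hp] at h1
      convert h1 using 1
      module
    have m2 : u - Complex.I • (J.map (algebraMap ℝ ℂ) *ᵥ u) ∈
        annihilator fun i => conj (z i) := by
      rw [hq]
      exact Submodule.add_mem _ (hannc (hsub a)) (Submodule.smul_mem _ _ (hannc (hsub b)))
    have h0 : u - Complex.I • (J.map (algebraMap ℝ ℂ) *ᵥ u) = 0 := by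
      by_contra h0
      rw [hyp_eq_zero_of_mem m1 m2 h0] at hpos
      simp at hpos
    have h1 := sub_eq_zero.1 h0
    conv_rhs => rw [h1, smul_smul, neg_mul, Complex.I_mul_I, neg_neg, one_smul]
  · obtain ⟨x, rfl⟩ := exists_eq_holVec hu
    exact hsub x

end IsCompatible

/-! ### Polarized tori of Weil type come from a unique period -/

section Torus

open IsCompatible

variable {h s : Fin 8 → ℤ} {T : ComplexTorus (Fin 8)}

lemma isCompatible_of_isPolarizedWeilType (P : IsPosPair h s) {ε : ℝ} (hε : ε = 1 ∨ ε = -1)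
    (hT : IsPolarizedWeilType T P.action (ε • P.form)) : IsCompatible h s T.J := by
  have hcomm : sqrtMat (castVec ℝ h) (castVec ℝ s) * T.J =
      T.J * sqrtMat (castVec ℝ h) (castVec ℝ s) := by
    have h1 : _ * _ = _ * _ := hT.weil.endo (sqrtNegK (dd h s))
    rwa [P.action_sqrtNegK_map] at h1
  refine ⟨T.J_mul_J, hcomm, fun v w => ?_⟩
  have hε0 : ε ≠ 0 := by rcases hε with rfl | rfl <;> norm_num
  have hd : -(dd h s : ℝ) ≠ 0 := neg_ne_zero.2 (by exact_mod_cast P.dd_pos.ne')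
  have hJ (v w : Fin 8 → ℝ) : hyp (T.J *ᵥ v) (T.J *ᵥ w) = hyp v w := by
    -- Invariance of E under i, tested on (Nv, w), becomes orthogonality of J because N² = -d.
    have h1 := hT.polarization.type_one_one 0 1 (by norm_num)
      ![sqrtMat (castVec ℝ h) (castVec ℝ s) *ᵥ v, w]
    rw [AlternatingMap.smul_apply, AlternatingMap.smul_apply, P.form_apply, P.form_apply] at h1
    have h2 := smul_right_injective _ hε0 h1
    simp only [zero_smul, one_smul, zero_add, Matrix.cons_val_zero, Matrix.cons_val_one,
      Matrix.mulVec_mulVec] at h2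
    rw [← hcomm, ← Matrix.mul_assoc, P.sqrtMat_sq, Matrix.smul_mul, Matrix.smul_mulVec,
      Matrix.smul_mulVec, Matrix.one_mul, Matrix.one_mulVec, map_smul, map_smul,
      LinearMap.smul_apply, LinearMap.smul_apply] at h2
    exact smul_right_injective _ hd h2
  rw [← hJ v (T.J *ᵥ w), Matrix.mulVec_mulVec w, T.J_mul_J, Matrix.neg_mulVec, Matrix.one_mulVec,
    map_neg, neg_neg]

lemma existsUnique_isTorusOf (P : IsPosPair h s) {ε : ℝ} (hε : ε = 1 ∨ ε = -1)
    (hT : IsPolarizedWeilType T P.action (ε • P.form)) :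
    ∃! ℓ, ℓ ∈ OmegaPerp h s ∧ T.IsTorusOf ℓ := by
  have C := isCompatible_of_isPolarizedWeilType P hε hT
  have hc : 0 < Real.sqrt (dd h s) := Real.sqrt_pos.2 (by exact_mod_cast P.dd_pos)
  have hrank : Module.finrank ℝ (eigenKer h s T.J (-Real.sqrt (dd h s))) = 4 := by
    have h1 := C.finrank_eigenKer P
    have h2 := hT.weil.multiplicity (sqrtNegK (dd h s)) fun ⟨q, hq⟩ => by
      have h3 := congrArg Complex.im (congrArg Subtype.val hq)
      have h4 : (sqrtNeg (dd h s)).im = 0 := by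
        rw [show sqrtNeg (dd h s) = (algebraMap ℚ ℂ q) from (congrArg Subtype.val hq).symm]
        simp
      exact (sqrtNeg_im_pos P.dd_pos).ne' h4
    have h5 : T.eigenspace (P.action (sqrtNegK (dd h s))) (sqrtNeg (dd h s)) =
        eigenKer h s T.J (Real.sqrt (dd h s)) := by
      rw [ComplexTorus.eigenspace, eigenKer, P.action_sqrtNegK_map, sqrtNeg_re, sqrtNeg_im, zero_smul,
        zero_add]
    have h6 : T.eigenspace (P.action (sqrtNegK (dd h s))) (conj (sqrtNeg (dd h s))) =
        eigenKer h s T.J (-Real.sqrt (dd h s)) := by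
      rw [ComplexTorus.eigenspace, eigenKer, P.action_sqrtNegK_map, Complex.conj_re, Complex.conj_im,
        sqrtNeg_re, sqrtNeg_im, zero_smul, zero_add]
    rw [show ((sqrtNegK (dd h s) : imQuad (dd h s)) : ℂ) = sqrtNeg (dd h s) from rfl, h5, h6] at h2
    omega
  -- On this eigenspace NJv = √d v, so ω(Jv, v) = √d ε(v, v).
  have hdef : ∀ v ∈ eigenKer h s T.J (-Real.sqrt (dd h s)), v ≠ 0 → 0 < ε * hyp v v := by
    intro v hv hv0
    have h1 := hT.polarization.pos v hv0
    rw [AlternatingMap.smul_apply, P.form_apply, Matrix.cons_val_zero, Matrix.cons_val_one,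
      Matrix.cons_val_zero, mem_eigenKer.1 (C.mulVec_mem_eigenKer hv), C.mulVec_mulVec, smul_neg,
      neg_smul, neg_neg, map_smul, LinearMap.smul_apply, smul_eq_mul, smul_eq_mul,
      mul_left_comm] at h1
    exact pos_of_mul_pos_right h1 hc.le
  obtain ⟨z, hz, hzJ⟩ := C.exists_isPeriod P hrank hdef
  have hz0 : z ≠ 0 := by
    rintro rfl
    have := hz.1.2
    simp at this
  have hqz : quad z = 0 := by
    have := hz.1.1
    rw [hyp_self] at this
    exact (mul_eq_zero.1 this).resolve_left two_ne_zero
  refine ⟨Projectivization.mk ℂ z hz0, ⟨(mk_mem_OmegaPerp hz0).2 hz, ?_⟩, fun ℓ hℓ => ?_⟩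
  · rw [isTorusOf_iff C.skew]
    obtain ⟨a, ha⟩ := Projectivization.exists_smul_eq_mk_rep ℂ z hz0
    rw [← ha]
    change ∀ u, u ∈ annihilator ((a : ℂ) • z) ↔ _
    rwa [annihilator_smul a.ne_zero]
  · rw [← ℓ.mk_rep]
    -- Both annihilators are the -i-eigenspace of J, so the two spinors are proportional.
    refine mk_eq_mk_of_annihilator_eq ℓ.rep_nonzero hz0 hqz (Submodule.ext fun u => ?_)
    rw [hzJ, (isTorusOf_iff C.skew ℓ).1 hℓ.2]

end Torus

end Completeness

end WeilFourfold

end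

/-! ### The main theorem -/

open WeilFourfold
theorem mainTheorem1 (h s : Fin 8 → ℤ) (hperp : hyp h s = 0)
    (hrank : LinearIndependent ℤ ![h, s])
    (hpos : ∀ x ∈ Submodule.span ℤ {h, s}, x ≠ 0 → 0 < hyp x x) :
    IsProjectiveSubmanifold 4 (OmegaPerp h s) ∧ (OmegaPerp h s).Nonempty ∧
    ∃ φ : imQuad (dd h s) →ₐ[ℚ] Matrix (Fin 8) (Fin 8) ℚ, IsKAction h s φ ∧
    ∃ E : Coh (Fin 8) 2,
      (∀ v w : Fin 8 → ℝ, E ![v, w] =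
        hyp (((φ (sqrtNegK (dd h s))).map (algebraMap ℚ ℝ)).mulVec v) w) ∧
      (∀ ℓ ∈ OmegaPerp h s, ∃ T : ComplexTorus (Fin 8), T.IsTorusOf ℓ ∧
        (∀ x, φ x ∈ T.endQ) ∧
        ∃ ω : Coh (Fin 8) 2, (ω = E ∨ ω = -E) ∧
          IsPolarizedWeilType T φ ω ∧
          HasTrivialDiscriminant φ ω ∧
          IsIntegralClass (cayley s) ∧ T.IsMiddleType (cayley s) ∧
          ∀ q : ℚ, cayley s ≠ (q : ℝ) • wedge ω ω) ∧
      (∀ (T : ComplexTorus (Fin 8)) (ω : Coh (Fin 8) 2), (ω = E ∨ ω = -E) →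
        IsPolarizedWeilType T φ ω → ∃! ℓ, ℓ ∈ OmegaPerp h s ∧ T.IsTorusOf ℓ) := by
  have P : IsPosPair h s :=
    ⟨hperp, hpos h (Submodule.subset_span (by simp)) (hrank.ne_zero 0),
      hpos s (Submodule.subset_span (by simp)) (hrank.ne_zero 1)⟩
  have hsign {ω : Coh (Fin 8) 2} (hω : ω = P.form ∨ ω = -P.form) :
      ∃ ε : ℝ, (ε = 1 ∨ ε = -1) ∧ ω = ε • P.form := by
    rcases hω with rfl | rfl
    · exact ⟨1, Or.inl rfl, (one_smul _ _).symm⟩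
    · exact ⟨-1, Or.inr rfl, (neg_one_smul _ _).symm⟩
  refine ⟨isProjectiveSubmanifold_OmegaPerp P, nonempty_OmegaPerp h s, P.action, P.isKAction,
    P.form, fun v w => ?_, fun ℓ hℓ => ?_, fun T ω hω hT => ?_⟩
  · rw [P.form_apply, P.action_sqrtNegK_map]
    rfl
  · have hrep := eq_toC_add ℓ.rep
    have hper := mem_OmegaPerp.1 hℓ
    rw [hrep] at hper
    obtain ⟨H, hxy⟩ := hper.isPosFrame P
    obtain ⟨ω, hω, hW⟩ := P.exists_isPolarizedWeilType H hxy
    obtain ⟨ε, hε, rfl⟩ := hsign hω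
    exact ⟨H.torus hxy, H.isTorusOf hxy hrep, hW.weil.endo, ε • P.form, hω, hW,
      hasTrivialDiscriminant P hε, isIntegralClass_cayley s, middleType_cayley H hxy,
      fun q => P.cayley_ne H hω q⟩
  · obtain ⟨ε, hε, rfl⟩ := hsign hω
    exact existsUnique_isTorusOf P hε hT
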